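/- Setting. Let $A=\sqrt{-\Delta}$ on $\mathbb R^3$ and $\|\cdot\|$ the norm of $(L^2)^3$; for $r\ge 0$ let $H^r$ have the norm $\|\langle A\rangle^r f\|$, $\langle x\rangle=(1+x^2)^{1/2}$, and write $H^r$ also for $(H^r)^3$. Let $M$ be a real $3\times 3$ matrix and $P$ an orthogonal projection on $L^2(\mathbb R^3,\mathbb R^3)$ fibered in Fourier space, $\widehat{Pf}(\xi)=P(\xi)\hat f(\xi)$ (for $M=I$ and $P$ the Leray projection one has the Navier–Stokes equations). Let $0<T<\infty$, $I=\,]0,T]$, $\bar I=[0,T]$. The class $\mathcal S_{1/2,I}$ of strong solutions consists of the $\mathbb R^3$-valued $u\in C(\bar I,H^{1/2})$ such that 1. $u(t)\in PH^{1/2}$ for all $t\in\bar I$; 2. $t\mapsto t^{3/8}A^{5/4}u(t)$ is a bounded continuous map from $I$ to $(L^2)^3$, and $t^{3/8}\|A^{5/4}u(t)\|\to 0$ as $t\to 0$; 3. $u\in C^1(I,\mathcal S'(\mathbb R^3))$ (weak* topology) and $\frac{d}{dt}u=-A^2u-P(Mu\cdot\nabla)u$ on $I$ in the sense of distributions. For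 a scalar $f\in H^{1/2}$ let $\mathrm{rad}(f)\in[0,\infty]$ be the supremum of all $a>0$ such that $\mathbb R^3\ni\eta\mapsto f(\cdot+\eta)\in H^{1/2}$ extends to an analytic and bounded $H^{1/2}$-valued function on $\{\eta\in\mathbb C^3:|\mathrm{Im}\,\eta|<a\}$ ($\mathrm{rad}(f)=0$ if there is no such $a$); for $f=(f_1,f_2,f_3)$ let $\mathrm{rad}(f)=\min_j\mathrm{rad}(f_j)$. Statement. Fix $u\in\mathcal S_{1/2,I}$, put $u_0=u(0)$, and let $t\in I$. For $v\in\mathcal S_{1/2,I}$ with $v_0=v(0)$ define $$r_t(v_0)=\sup\Big\{\alpha\ge 0:\ \sup_{s\in]a,t]}\|e^{\alpha A}v(s)\|<\infty\text{ for some }0\le a<t\Big\}\in[0,\infty].$$ Then $r_t$ is lower semicontinuous at $u_0$ as a function of the initial data in the $H^{1/2}$ topology: $$\liminf_{\|v_0-u_0\|_{H^{1/2}}\to 0} r_t(v_0)\ \ge\ r_t(u_0),$$ the limit being taken over $v\in\mathcal S_{1/2,I}$, $v_0=v(0)$. Suppose moreover that $$\liminf_{s\uparrow t}\mathrm{rad}(u(s))\ge\mathrm{rad}(u(t))$$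 and that for every $0\le\alpha<\mathrm{rad}(u(t))$ there is $0\le a<t$ with $\sup_{s\in]a,t]}\|e^{\alpha A}u(s)\|<\infty$. Then $r_t(u_0)=\mathrm{rad}(u(t))$, and the analyticity radius at time $t$ is lower semicontinuous at $u_0$ as a function of the initial data: $$\liminf_{\|v_0-u_0\|_{H^{1/2}}\to 0}\mathrm{rad}(v(t))\ \ge\ \mathrm{rad}(u(t)),$$ again over $v\in\mathcal S_{1/2,I}$ with $v(0)=v_0$. -/

import Mathlib

open MeasureTheory Filter Set
open scoped Topology ENNReal NNReal FourierTransform Laplacian SchwartzMap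

noncomputable section

/-- Physical space `ℝ³` with its Euclidean norm. -/
abbrev R3 : Type := EuclideanSpace ℝ (Fin 3)

/-- The complex Lebesgue space `L²(ℝ³)`. -/
abbrev L2 : Type := Lp ℂ 2 (volume : Measure R3)

/-- `(L²)³`, with norm `(‖f₁‖² + ‖f₂‖² + ‖f₃‖²)^{1/2}`. -/
abbrev L2Vec : Type := PiLp 2 (fun _ : Fin 3 => L2)

/-- The symbol `|2πξ|` of `A = √(-Δ)` for the Fourier transform
`(𝓕 f)(ξ) = ∫ e^{-2πi x·ξ} f(x) dx`. -/
def symbA (ξ : R3) : ℝ := 2 * Real.pi * ‖ξ‖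

/-- The symbol `⟨2πξ⟩^r` of `⟨A⟩^r`, where `⟨x⟩ = (1 + x²)^{1/2}`. -/
def symbBessel (r : ℝ) (ξ : R3) : ℝ := (1 + symbA ξ ^ 2) ^ (r / 2)

/-- The functions `f ∈ L²` with `⟨A⟩^r f ∈ L²`. For `r ≥ 0` these are all elements of `H^r`. -/
def sobolevSubmodule (r : ℝ) : Submodule ℂ L2 where
  carrier := {f | MemLp (fun ξ => (symbBessel r ξ : ℂ) * (𝓕 f : L2) ξ) 2 volume}
  zero_mem' := by
    have h : (fun ξ => (symbBessel r ξ : ℂ) * (𝓕 (0 : L2) : L2) ξ) =ᵐ[volume] fun _ => 0 := by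
      rw [FourierTransform.fourier_zero]
      filter_upwards [Lp.coeFn_zero ℂ 2 (volume : Measure R3)] with ξ hξ
      rw [hξ, Pi.zero_apply, mul_zero]
    exact (memLp_congr_ae h).2 MemLp.zero'
  add_mem' := by
    intro f g hf hg
    refine (memLp_congr_ae ?_).2 (MemLp.add hf hg)
    rw [FourierTransform.fourier_add]
    filter_upwards [Lp.coeFn_add (𝓕 f : L2) (𝓕 g : L2)] with ξ hξ
    rw [hξ, Pi.add_apply, Pi.add_apply, mul_add]
  smul_mem' := by
    intro c f hf
    refine (memLp_congr_ae ?_).2 (MemLp.const_smul hf c)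
    rw [FourierTransform.fourier_smul]
    filter_upwards [Lp.coeFn_smul c (𝓕 f : L2)] with ξ hξ
    rw [hξ, Pi.smul_apply, Pi.smul_apply, smul_eq_mul, smul_eq_mul, mul_left_comm]

/-- The Sobolev space `H^r(ℝ³)` of complex-valued functions, `r ≥ 0`. A type of its own, so that it
carries the norm `‖⟨A⟩^r f‖` defined below, and not the norm of `L²`. -/
def Sobolev (r : ℝ) : Type := sobolevSubmodule r

namespace Sobolev

variable {r : ℝ}

instance : AddCommGroup (Sobolev r) := inferInstanceAs (AddCommGroup (sobolevSubmodule r))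

instance : Module ℂ (Sobolev r) := inferInstanceAs (Module ℂ (sobolevSubmodule r))

/-- The inclusion `H^r → L²`. -/
def toL2 : Sobolev r →ₗ[ℂ] L2 := (sobolevSubmodule r).subtype

theorem toL2_injective : Function.Injective (toL2 : Sobolev r →ₗ[ℂ] L2) :=
  Subtype.val_injective

theorem memLp_bessel (f : Sobolev r) :
    MemLp (fun ξ => (symbBessel r ξ : ℂ) * (𝓕 (toL2 f) : L2) ξ) 2 volume :=
  f.2

/-- The map `f ↦ ⟨2πξ⟩^r (𝓕 f)(ξ)` from `H^r` to `L²`, i.e. the Fourier transform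
of `⟨A⟩^r f`. -/
def bessel : Sobolev r →ₗ[ℂ] L2 where
  toFun f := MemLp.toLp _ (memLp_bessel f)
  map_add' f g := by
    rw [← MemLp.toLp_add, MemLp.toLp_eq_toLp_iff, map_add, FourierTransform.fourier_add]
    filter_upwards [Lp.coeFn_add (𝓕 (toL2 f) : L2) (𝓕 (toL2 g) : L2)] with ξ hξ
    rw [hξ, Pi.add_apply, Pi.add_apply, mul_add]
  map_smul' c f := by
    rw [RingHom.id_apply, ← MemLp.toLp_const_smul, MemLp.toLp_eq_toLp_iff, map_smul,
      FourierTransform.fourier_smul]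
    filter_upwards [Lp.coeFn_smul c (𝓕 (toL2 f) : L2)] with ξ hξ
    rw [hξ, Pi.smul_apply, Pi.smul_apply, smul_eq_mul, smul_eq_mul, mul_left_comm]

theorem bessel_injective : Function.Injective (bessel : Sobolev r →ₗ[ℂ] L2) := by
  rw [← LinearMap.ker_eq_bot, LinearMap.ker_eq_bot']
  intro f hf
  have h1 : (𝓕 (toL2 f) : L2) = 0 := by
    have h2 := (memLp_bessel f).coeFn_toLp
    have h3 : (memLp_bessel f).toLp _ = (0 : L2) := hf
    rw [h3] at h2
    apply Lp.ext
    filter_upwards [h2, Lp.coeFn_zero ℂ 2 (volume : Measure R3)] with ξ a b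
    rw [b] at a
    have hpos : symbBessel r ξ ≠ 0 := by
      unfold symbBessel
      positivity
    rw [b]
    simpa [hpos] using a.symm
  apply toL2_injective
  have h4 : (𝓕⁻ (𝓕 (toL2 f) : L2) : L2) = toL2 f :=
    FourierTransform.fourierInv_fourier_eq (toL2 f)
  rw [map_zero, ← h4, h1, FourierTransform.fourierInv_zero]

/-- The norm of `H^r` is `‖f‖_{H^r} = ‖⟨A⟩^r f‖_{L²}`. -/
instance : NormedAddCommGroup (Sobolev r) :=
  NormedAddCommGroup.induced (Sobolev r) L2 bessel bessel_injective

instance : NormedSpace ℂ (Sobolev r) := NormedSpace.induced ℂ (Sobolev r) L2 bessel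

end Sobolev

/-- `(H^r)³`, with norm `(‖f₁‖² + ‖f₂‖² + ‖f₃‖²)^{1/2}` in terms of the norm of `H^r`. -/
abbrev SobolevVec (r : ℝ) : Type := PiLp 2 (fun _ : Fin 3 => Sobolev r)

/-- The inclusion `(H^r)³ → (L²)³`. -/
def SobolevVec.toL2Vec {r : ℝ} (f : SobolevVec r) : L2Vec :=
  WithLp.toLp 2 (fun i => Sobolev.toL2 (f i))

/-- `‖e^{αA} f‖ ∈ [0, ∞]` for `f ∈ (L²)³`, with the value `∞` if `e^{αA} f ∉ (L²)³`. -/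
def expNorm (α : ℝ) (f : L2Vec) : ℝ≥0∞ :=
  (∑ i, eLpNorm (fun ξ => (Real.exp (α * symbA ξ) : ℂ) * (𝓕 (f i) : L2) ξ) 2 volume ^ 2)
    ^ (1 / 2 : ℝ)

/-! ### The analyticity radius -/

/-- `Im η` for `η ∈ ℂ³`. -/
def imPart (η : EuclideanSpace ℂ (Fin 3)) : R3 := WithLp.toLp 2 (fun j => (η j).im)

/-- The inclusion `ℝ³ → ℂ³`. -/
def complexify (η : R3) : EuclideanSpace ℂ (Fin 3) := WithLp.toLp 2 (fun j => (η j : ℂ))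

/-- The map `η ↦ f(· + η) ∈ H^r` on `ℝ³` extends to an analytic (that is, complex differentiable)
and bounded `H^r`-valued function on
the tube `{η ∈ ℂ³ : |Im η| < a}`. -/
def IsUniformlyAnalytic {r : ℝ} (f : Sobolev r) (a : ℝ) : Prop :=
  ∃ F : EuclideanSpace ℂ (Fin 3) → Sobolev r,
    (∀ η : R3, (Sobolev.toL2 (F (complexify η)) : R3 → ℂ) =ᵐ[volume]
      fun x => Sobolev.toL2 f (x + η)) ∧
    DifferentiableOn ℂ F {η | ‖imPart η‖ < a} ∧
    ∃ C : ℝ, ∀ η, ‖imPart η‖ < a → ‖F η‖ ≤ C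

/-- The analyticity radius of a scalar function `f ∈ H^r`, an element of `[0, ∞]`; it is `0` if
no `a > 0` is admissible. -/
def scalarRad {r : ℝ} (f : Sobolev r) : ℝ≥0∞ :=
  ⨆ (a : ℝ≥0) (_ : 0 < a ∧ IsUniformlyAnalytic f a), (a : ℝ≥0∞)

/-- The analyticity radius `rad(f) = min_j rad(f_j)` of `f ∈ (H^r)³`. -/
def rad {r : ℝ} (f : SobolevVec r) : ℝ≥0∞ := ⨅ j, scalarRad (f j)

/-! ### Strong solutions -/

/-- An orthogonal projection on `L²(ℝ³, ℝ³)` that is fibered in Fourier space, given by its symbol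
`P(ξ)`: a measurable field of orthogonal projections of `ℂ³`. The condition
`P(-ξ) = conj P(ξ)` says that real vector fields are mapped to real vector fields. -/
structure FiberedProjection where
  symbol : R3 → Matrix (Fin 3) (Fin 3) ℂ
  measurable_symbol : ∀ i j, Measurable (fun ξ => symbol ξ i j)
  isHermitian : ∀ᵐ ξ, (symbol ξ).IsHermitian
  idempotent : ∀ᵐ ξ, symbol ξ * symbol ξ = symbol ξ
  conj_symm : ∀ᵐ ξ, symbol (-ξ) = (symbol ξ).map (starRingEnd ℂ)

/-- `g = P f` in `(L²)³`, i.e. `(𝓕 g)(ξ) = P(ξ) (𝓕 f)(ξ)`. -/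
def FiberedProjection.Maps (P : FiberedProjection) (f g : L2Vec) : Prop :=
  ∀ i, ((𝓕 (g i) : L2) : R3 → ℂ) =ᵐ[volume] fun ξ => ∑ k, P.symbol ξ i k * (𝓕 (f k) : L2) ξ

/-- `w = A^s f` in `(L²)³`. -/
def IsPowA (s : ℝ) (f w : L2Vec) : Prop :=
  ∀ i, ((𝓕 (w i) : L2) : R3 → ℂ) =ᵐ[volume] fun ξ => ((symbA ξ ^ s : ℝ) : ℂ) * (𝓕 (f i) : L2) ξ

/-- `g = ∂_j f` in `L²`. -/
def IsPartial (j : Fin 3) (f g : L2) : Prop :=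
  ((𝓕 g : L2) : R3 → ℂ) =ᵐ[volume] fun ξ => 2 * Real.pi * Complex.I * (ξ j : ℂ) * (𝓕 f : L2) ξ

/-- `N = (M f · ∇) f` in `(L²)³`: for each `i`, `N_i = ∑_j (M f)_j ∂_j f_i` almost everywhere. -/
def IsConvection (M : Matrix (Fin 3) (Fin 3) ℝ) (f N : L2Vec) : Prop :=
  ∃ D : Fin 3 → Fin 3 → L2, (∀ i j, IsPartial j (f i) (D i j)) ∧
    ∀ i, (N i : R3 → ℂ) =ᵐ[volume]
      fun x => ∑ j, (∑ k, (M j k : ℂ) * (f k : R3 → ℂ) x) * (D i j : R3 → ℂ) x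

/-- The pairing `∫ φ f` of `f ∈ L²` with a Schwartz function. -/
def pairing (f : L2) (φ : 𝓢(R3, ℂ)) : ℂ := ∫ x, φ x * (f : R3 → ℂ) x

/-- The class `𝒮_{r,I}`, `I = ]0,T]`, of strong solutions of `∂_t u + P(Mu·∇)u - Δu = 0`. Only the
values of `u` on `[0,T]` matter. -/
structure IsStrongSolution (M : Matrix (Fin 3) (Fin 3) ℝ) (P : FiberedProjection) (r T : ℝ)
    (u : ℝ → SobolevVec r) : Prop where
  /-- `u ∈ C([0,T], H^r)`. -/
  continuousOn : ContinuousOn u (Icc 0 T)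
  /-- The velocity takes values in `ℝ³`. -/
  real_valued : ∀ t ∈ Icc 0 T, ∀ i, ∀ᵐ x : R3, ((u t).toL2Vec i x).im = 0
  /-- `u(t) ∈ P H^r`. -/
  mem_range : ∀ t ∈ Icc 0 T, P.Maps (u t).toL2Vec (u t).toL2Vec
  /-- `t^{3/8} A^{5/4} u` is bounded and continuous from `]0,T]` to `L²`, and tends to `0`
  as `t → 0`. -/
  kato : ∃ w : ℝ → L2Vec,
    (∀ t ∈ Ioc 0 T, IsPowA (5 / 4) (u t).toL2Vec (w t)) ∧
    ContinuousOn w (Ioc 0 T) ∧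
    (∃ C : ℝ, ∀ t ∈ Ioc 0 T, t ^ (3 / 8 : ℝ) * ‖w t‖ ≤ C) ∧
    Tendsto (fun t : ℝ => t ^ (3 / 8 : ℝ) * ‖w t‖) (𝓝[>] 0) (𝓝 0)
  /-- `u ∈ C¹(]0,T], 𝒮')` for the weak* topology, and `du/dt = Δu - P(Mu·∇)u` in the sense of
  distributions; the derivative at `T` is one-sided. -/
  equation : ∃ N PN : ℝ → L2Vec,
    (∀ t ∈ Ioc 0 T, IsConvection M (u t).toL2Vec (N t) ∧ P.Maps (N t) (PN t)) ∧
    ∀ (φ : 𝓢(R3, ℂ)) (i : Fin 3),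
      (∀ t ∈ Ioc 0 T, HasDerivWithinAt (fun s => pairing ((u s).toL2Vec i) φ)
        (pairing ((u t).toL2Vec i) (Δ φ) - pairing (PN t i) φ) (Ioc 0 T) t) ∧
      ContinuousOn (fun t => pairing ((u t).toL2Vec i) (Δ φ) - pairing (PN t i) φ) (Ioc 0 T)

/-- The modified radius: the supremum of all `α ≥ 0` such that
`sup_{s ∈ ]a,t]} ‖e^{αA} v(s)‖ < ∞` for some `0 ≤ a < t`. -/
def modifiedRad {r : ℝ} (t : ℝ) (v : ℝ → SobolevVec r) : ℝ≥0∞ :=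
  ⨆ (α : ℝ≥0) (_ : ∃ a ∈ Ico 0 t, ⨆ s ∈ Ioc a t, expNorm α (v s).toL2Vec < ∞), (α : ℝ≥0∞)

/-- The limit `‖v(0) - u₀‖_{H^r} → 0` for `v` ranging over the class `𝒮_{r,I}`, `I = ]0,T]`. -/
def dataLimit (M : Matrix (Fin 3) (Fin 3) ℝ) (P : FiberedProjection) {r : ℝ} (T : ℝ)
    (u₀ : SobolevVec r) : Filter (ℝ → SobolevVec r) :=
  comap (fun v => v 0) (𝓝 u₀) ⊓ 𝓟 {v | IsStrongSolution M P r T v}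

end

noncomputable section

/-! The heart of the matter is a stability estimate in Gevrey norms. Given `c < r_t(u₀)`, choose `c
< α < α'` and `a < s₀ < t` such that `e^{α'A} u` is bounded on `]a,t]`, and let the exponent grow
along the ramp `l(s) = Λ (s - s₀)₊` with `Λ = α / (t - s₀)`. It vanishes up to `s₀` and reaches `α`
at `t`, so `A^{5/4} e^{l(s)A} u(s)` stays under control: by the Kato condition before `s₀`, and by
the bound on `e^{α'A} u` afterwards. For each `κ > 0` its norm is at most `κ s^{-3/8} + B` with a
constant `B` depending on `κ`.

The difference `w = v - u` solves a heat equation whose forcing is the difference of the nonlinear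
terms. The product estimate `‖(Mf·∇)g‖ ≤ C ‖A^{5/4} f‖ ‖A^{5/4} g‖`
(`exists_lintegral_convolution_sq_le`) survives the insertion of the submultiplicative weight
`e^{lA}`, so the weighted forcing is at most `C (2‖u‖ + ‖w‖) ‖w‖` in the norms `‖A^{5/4} e^{lA} ·‖`.
In Duhamel's formula half of the heat decay pays for the growth of `l`, by completing a square, and
the other half turns `A^{5/4}` into `(s - τ)^{-5/8}`. This is the integral inequality
`IsStrongSolution.gevreyNorm_sub_le`.

That inequality is closed by continuous induction with the barrier `Q e^{μs} s^{-3/8}`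
(`IsStrongSolution.exists_gevreyNorm_sub_le`). Smallness of `κ` handles the part of `u` that is
singular at time `0`, a large `μ` absorbs the bounded but possibly large part `B`, and a small `Q`
handles the quadratic term. The argument runs with `A` replaced by `min(A, R)` in the exponential,
which keeps all norms finite and continuous in time; no constant depends on `R`, so `R → ∞` is
harmless. Hence `e^{cA} v` is bounded on a final interval before `t`, for all `v` with `v(0)` near
`u₀`.

For the second claim, a Paley–Wiener argument (`Sobolev.isUniformlyAnalytic`) gives `r_t(v) ≤
rad(v(t))` for every `v`. The regularity assumed of `u` makes this an equality at `u`, and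
semicontinuity passes from `r_t` to `rad`. -/

/-! ### Fourier transform on `L²`: duality, products and convolutions -/

theorem pairing_fourier (f : L2) (ψ : 𝓢(R3, ℂ)) :
    pairing f (𝓕 ψ) = ∫ ξ, ψ ξ * (𝓕 f : L2) ξ := by
  have h := congrArg (fun u => u ψ) (Lp.fourier_toTemperedDistribution_eq f)
  simp only [TemperedDistribution.fourier_apply] at h
  rw [Lp.toTemperedDistribution_apply, Lp.toTemperedDistribution_apply] at h
  simpa [pairing] using h

theorem symbA_sq_hasTemperateGrowth :
    (fun ξ : R3 => (symbA ξ ^ 2 : ℝ)).HasTemperateGrowth := by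
  have : (fun ξ : R3 => (symbA ξ ^ 2 : ℝ)) = fun ξ => (2 * Real.pi) ^ 2 * ‖ξ‖ ^ 2 := by
    ext ξ; simp [symbA, mul_pow]
  rw [this]
  fun_prop

theorem fourier_fourier_apply (f : 𝓢(R3, ℂ)) (x : R3) : 𝓕 (𝓕 f) x = f (-x) := by
  have h : (𝓕⁻ (𝓕 f) : 𝓢(R3, ℂ)) (-x) = f (-x) := by
    rw [FourierTransform.fourierInv_fourier_eq]
  rw [← h, SchwartzMap.fourierInv_coe, Real.fourierInv_eq_fourier_neg, neg_neg]
  rfl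

theorem laplacian_fourier (ψ : 𝓢(R3, ℂ)) :
    Δ (𝓕 ψ) = 𝓕 (-(SchwartzMap.smulLeftCLM ℂ (fun ξ : R3 => symbA ξ ^ 2) ψ)) := by
  have hg : (fun ξ : R3 => ‖ξ‖ ^ 2).HasTemperateGrowth := by fun_prop
  rw [SchwartzMap.laplacian_eq_fourierMultiplierCLM, SchwartzMap.fourierMultiplierCLM_apply]
  ext x
  rw [smul_apply, SchwartzMap.fourierInv_coe, SchwartzMap.fourier_coe,
    -- The multiplier acts on `𝓕 (𝓕 ψ) = ψ(-·)`; the substitution `y ↦ -y` turns the inverse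
    -- transform into a direct one.
    Real.fourierInv_eq, Real.fourier_eq, ← integral_neg_eq_self, ← integral_smul]
  refine integral_congr_ae (.of_forall fun y => ?_)
  simp only [SchwartzMap.smulLeftCLM_apply_apply hg, fourier_fourier_apply, neg_apply,
    SchwartzMap.smulLeftCLM_apply_apply symbA_sq_hasTemperateGrowth, norm_neg, neg_neg,
    inner_neg_left, smul_comm _ (Real.fourierChar _), smul_smul, neg_smul, neg_mul]
  rw [symbA, mul_pow (2 * Real.pi)]

/-- Integration against an `L²` function is a continuous linear functional on `L²`. -/
theorem exists_clm_integral_mul {k : R3 → ℂ} (hk : MemLp k 2 volume) :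
    ∃ L : L2 →L[ℂ] ℂ, ∀ f : L2, L f = ∫ x, f x * k x := by
  refine ⟨innerSL ℂ (hk.star.toLp _), fun f => ?_⟩
  rw [innerSL_apply_apply, L2.inner_def]
  refine integral_congr_ae ?_
  filter_upwards [hk.star.coeFn_toLp] with x hx
  rw [hx]
  simp

theorem fourier_mul_schwartz (f g : 𝓢(R3, ℂ)) (ξ : R3) :
    𝓕 (fun x => f x * g x) ξ = ∫ η, 𝓕 f (ξ - η) * 𝓕 g η := by
  have h := SchwartzMap.convolution_apply (ContinuousLinearMap.mul ℂ ℂ) (𝓕 g) (𝓕 f) ξ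
  rw [convolution_def] at h
  simp only [ContinuousLinearMap.mul_apply'] at h
  simp_rw [mul_comm (𝓕 f _)]
  rw [← h]
  -- The convolution of Schwartz functions unfolds to the inverse transform of the product of
  -- transforms; the two double transforms are reflections, undone by `x ↦ -x`.
  change _ = (𝓕⁻ (SchwartzMap.pairing (ContinuousLinearMap.mul ℂ ℂ) (𝓕 (𝓕 g)) (𝓕 (𝓕 f)) :
    𝓢(R3, ℂ)) : 𝓢(R3, ℂ)) ξ
  rw [SchwartzMap.fourierInv_coe, Real.fourierInv_eq, Real.fourier_eq,
    ← integral_neg_eq_self]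
  refine integral_congr_ae (.of_forall fun x => ?_)
  simp [SchwartzMap.pairing_apply_apply, fourier_fourier_apply, mul_comm]

theorem memLp_comp_sub_left {k : R3 → ℂ} (hk : MemLp k 2 volume) (ξ : R3) :
    MemLp (fun η => k (ξ - η)) 2 volume :=
  hk.comp_measurePreserving (Measure.measurePreserving_sub_left volume ξ)

theorem fourier_smul_memLp {k : R3 → ℂ} (hk : MemLp k 2 volume) (ξ : R3) :
    MemLp (fun x => Real.fourierChar (-inner ℝ x ξ) • k x) 2 volume := by
  refine hk.congr_norm ?_ (.of_forall fun x => ?_)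
  · refine AEStronglyMeasurable.smul (𝕜 := Circle) ?_ hk.1
    exact (Real.continuous_fourierChar.comp (by fun_prop)).aestronglyMeasurable
  · simp

/-- The Fourier transform of a product of two `L²` functions is the convolution of their Fourier
transforms. -/
theorem fourier_mul_eq_integral (f g : L2) (ξ : R3) :
    𝓕 (fun x => (f : R3 → ℂ) x * g x) ξ =
      ∫ η, (𝓕 f : L2) (ξ - η) * (𝓕 g : L2) η := by
  have hsub : MeasurePreserving (fun η : R3 => ξ - η) volume volume :=
    Measure.measurePreserving_sub_left volume ξ
  have hdense : DenseRange (SchwartzMap.toLpCLM ℝ (E := R3) ℂ 2 volume) :=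
    SchwartzMap.denseRange_toLpCLM ENNReal.ofNat_ne_top
  simp_rw [Real.fourier_eq]
  -- For fixed `ξ` both sides are continuous in each factor for the `L²` norm, so density reduces to
  -- Schwartz functions, one factor at a time.
  refine hdense.induction_on (p := fun f : L2 => ∫ x, Real.fourierChar (-inner ℝ x ξ) •
    ((f : R3 → ℂ) x * g x) = ∫ η, (𝓕 f : L2) (ξ - η) * (𝓕 g : L2) η) f ?_ fun f => ?_
  · obtain ⟨L, hL⟩ := exists_clm_integral_mul (fourier_smul_memLp (Lp.memLp g) ξ)
    obtain ⟨L', hL'⟩ := exists_clm_integral_mul (memLp_comp_sub_left (Lp.memLp (𝓕 g)) ξ)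
    simp_rw [mul_smul_comm] at hL
    refine isClosed_eq (L.continuous.congr hL)
      ((L'.continuous.comp (FourierTransform.continuous_fourier (E := L2))).congr fun h => ?_)
    rw [Function.comp_apply, hL', ← integral_sub_left_eq_self _ _ ξ]
    simp
  refine hdense.induction_on (p := fun g : L2 => ∫ x, Real.fourierChar (-inner ℝ x ξ) •
    ((SchwartzMap.toLpCLM ℝ ℂ 2 volume f : L2) x * g x) =
      ∫ η, (𝓕 (SchwartzMap.toLpCLM ℝ ℂ 2 volume f : L2) : L2) (ξ - η) * (𝓕 g : L2) η) g ?_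
      fun g => ?_
  · obtain ⟨L, hL⟩ := exists_clm_integral_mul (fourier_smul_memLp
      (Lp.memLp (SchwartzMap.toLpCLM ℝ ℂ 2 volume f : L2)) ξ)
    obtain ⟨L', hL'⟩ := exists_clm_integral_mul (memLp_comp_sub_left
      (Lp.memLp (𝓕 (SchwartzMap.toLpCLM ℝ ℂ 2 volume f : L2))) ξ)
    refine isClosed_eq (L.continuous.congr fun h => ?_)
      ((L'.continuous.comp (FourierTransform.continuous_fourier (E := L2))).congr fun h => ?_)
    · refine (hL h).trans (integral_congr_ae (.of_forall fun x => ?_))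
      dsimp only
      rw [mul_smul_comm, mul_comm]
    · refine (hL' _).trans (integral_congr_ae (.of_forall fun x => ?_))
      dsimp only
      rw [mul_comm]
  · have h := fourier_mul_schwartz f g ξ
    rw [Real.fourier_eq] at h
    simp only [SchwartzMap.toLpCLM_apply, SchwartzMap.toLp_fourier_eq]
    convert h using 1
    · refine integral_congr_ae ?_
      filter_upwards [f.coeFn_toLp 2 volume, g.coeFn_toLp 2 volume] with x h1 h2
      rw [h1, h2]
    · refine integral_congr_ae ?_
      filter_upwards [hsub.quasiMeasurePreserving.ae ((𝓕 f).coeFn_toLp 2 volume),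
        (𝓕 g).coeFn_toLp 2 volume] with x h1 h2
      rw [h1, h2]

/-- The `L²` transform and the Fourier integral both satisfy the multiplication formula `∫ ψ 𝓕h = ∫
(𝓕ψ) h`, so they agree against all test functions. This gives pointwise access to the transform of
the convection term, which is a sum of products of `L²` functions. -/
theorem fourier_ae_eq_of_integrable (h : L2) (hi : Integrable (h : R3 → ℂ)) :
    ((𝓕 h : L2) : R3 → ℂ) =ᵐ[volume] 𝓕 (h : R3 → ℂ) := by
  refine ae_eq_of_integral_contDiff_smul_eq ?_ ?_ fun φ hφ hφc => ?_
  · exact (Lp.memLp (𝓕 h)).locallyIntegrable (by norm_num)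
  · exact (VectorFourier.fourierIntegral_continuous Real.continuous_fourierChar
      (by exact continuous_inner) hi).locallyIntegrable
  · have hc : ContDiff ℝ (⊤ : ℕ∞) (fun x => (φ x : ℂ)) := Complex.ofRealCLM.contDiff.comp hφ
    have hcc : HasCompactSupport (fun x => (φ x : ℂ)) :=
      hφc.comp_left (g := fun r : ℝ => (r : ℂ)) Complex.ofReal_zero
    let ψ : 𝓢(R3, ℂ) := hcc.toSchwartzMap hc
    have h1 := pairing_fourier h ψ
    have h2 := VectorFourier.integral_fourierIntegral_smul_eq_flip (μ := (volume : Measure R3))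
      (ν := (volume : Measure R3)) (L := innerₗ R3) Real.continuous_fourierChar
      (by exact continuous_inner) ψ.integrable hi
    rw [flip_innerₗ] at h2
    calc ∫ x, φ x • ((𝓕 h : L2) : R3 → ℂ) x = ∫ x, ψ x * (𝓕 h : L2) x := rfl
      _ = _ := h1.symm.trans h2
      _ = ∫ x, φ x • 𝓕 (h : R3 → ℂ) x := rfl

/-- The Fourier transform of an `L²` function that is a finite sum of products of `L²` functions
is the sum of the convolutions of the Fourier transforms. -/
theorem fourier_sum_mul_ae_eq {ι : Type*} (s : Finset ι) (h : L2) (f g : ι → L2)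
    (hfg : (h : R3 → ℂ) =ᵐ[volume] fun x => ∑ l ∈ s, (f l : R3 → ℂ) x * g l x) :
    ((𝓕 h : L2) : R3 → ℂ) =ᵐ[volume]
      fun ξ => ∑ l ∈ s, ∫ η, (𝓕 (f l) : L2) (ξ - η) * (𝓕 (g l) : L2) η := by
  have hint : ∀ l, Integrable (fun x => (f l : R3 → ℂ) x * g l x) := fun l =>
    (Lp.memLp (f l)).integrable_mul (Lp.memLp (g l))
  have hi : Integrable (h : R3 → ℂ) :=
    (integrable_finsetSum s fun l _ => hint l).congr hfg.symm
  filter_upwards [fourier_ae_eq_of_integrable h hi] with ξ hξ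
  rw [hξ]
  simp_rw [← fourier_mul_eq_integral, Real.fourier_eq]
  rw [← integral_finsetSum s fun l _ => by
    simpa using (Real.fourierIntegral_convergent_iff ξ).2 (hint l)]
  refine integral_congr_ae ?_
  filter_upwards [hfg] with x hx
  rw [hx, Finset.smul_sum]

/-! ### The product estimate as a bilinear convolution inequality -/

theorem lintegral_ball_norm_rpow {p : ℝ} (hp : p < 3) :
    ∃ c : ℝ, 0 ≤ c ∧ ∀ r : ℝ, 0 < r →
      ∫⁻ x in Metric.ball (0 : R3) r, ENNReal.ofReal (‖x‖ ^ (-p)) =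
        ENNReal.ofReal (c * r ^ (3 - p)) := by
  have hfr : Module.finrank ℝ R3 = 3 := by simp
  have hcongr : ∀ r : ℝ, ∀ y ∈ Ioo 0 r, y ^ (-p + 2) = y ^ (Module.finrank ℝ R3 - 1) • y ^ (-p) := by
    intro r y hy
    rw [hfr, smul_eq_mul, add_comm, Real.rpow_add hy.1]
    norm_num
  have hi : ∀ r : ℝ, 0 < r → IntegrableOn (fun y : ℝ => y ^ (-p + 2)) (Ioo 0 r) := fun r hr =>
    (intervalIntegral.integrableOn_Ioo_rpow_iff hr).2 (by linarith)
  refine ⟨3 * (volume.real (Metric.ball (0 : R3) 1) / (3 - p)), ?_, fun r hr => ?_⟩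
  · have : 0 < 3 - p := by linarith
    positivity
  have hI : IntegrableOn (fun x : R3 => ‖x‖ ^ (-p)) (Metric.ball 0 r) := by
    rw [integrableOn_fun_norm_addHaar (μ := volume) (f := fun y : ℝ => y ^ (-p))]
    exact (hi r hr).congr_fun (hcongr r) measurableSet_Ioo
  rw [← ofReal_integral_eq_lintegral_ofReal hI (.of_forall fun x => by positivity)]
  congr 1
  have h1 : ∫ x in Metric.ball (0 : R3) r, ‖x‖ ^ (-p) =
      ∫ x : R3, (Iio r).indicator (fun y : ℝ => y ^ (-p)) ‖x‖ := by
    rw [← integral_indicator Metric.isOpen_ball.measurableSet]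
    congr 1 with x
    simp [indicator]
  rw [h1, integral_fun_norm_addHaar volume ((Iio r).indicator (fun y : ℝ => y ^ (-p)))]
  have h2 : ∫ y in Ioi (0 : ℝ), y ^ (Module.finrank ℝ R3 - 1) •
      (Iio r).indicator (fun y : ℝ => y ^ (-p)) y = ∫ y in (0 : ℝ)..r, y ^ (-p + 2) := by
    rw [intervalIntegral.integral_of_le hr.le, integral_Ioc_eq_integral_Ioo,
      setIntegral_congr_fun measurableSet_Ioo (hcongr r), ← Ioi_inter_Iio,
      ← setIntegral_indicator measurableSet_Iio]
    congr 1 with y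
    simp [indicator]
  rw [h2, integral_rpow (Or.inl (by linarith)), hfr]
  rw [Real.zero_rpow (by linarith)]
  simp only [smul_eq_mul, nsmul_eq_mul]
  rw [show -p + 2 + 1 = 3 - p by ring]
  push_cast
  ring

theorem lintegral_mul_sq_le {α : Type*} [MeasurableSpace α] (μ : Measure α) {f g : α → ℝ≥0∞}
    (hf : AEMeasurable f μ) (hg : AEMeasurable g μ) :
    (∫⁻ x, f x * g x ∂μ) ^ 2 ≤ (∫⁻ x, f x ^ 2 ∂μ) * ∫⁻ x, g x ^ 2 ∂μ := by
  have h := ENNReal.lintegral_mul_le_Lp_mul_Lq μ Real.HolderConjugate.two_two hf hg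
  have h' := pow_le_pow_left' h 2
  simp only [Pi.mul_apply, mul_pow, ENNReal.rpow_ofNat, ← ENNReal.rpow_natCast,
    ← ENNReal.rpow_mul] at h' ⊢
  norm_num at h' ⊢
  exact h'

/-- The squared kernel `|ξ-η|^{-5/2} |η|^{-1/2}` has degree `-3`, so its integral over a ball of
radius proportional to `|ξ|` is scale invariant. Both singularities are integrable, and at each `η`
at least one of `|η|`, `|ξ-η|` is at least `|ξ|/2`, which separates them. -/
theorem lintegral_near_kernel :
    ∃ c : ℝ, 0 ≤ c ∧ ∀ ξ : R3, ξ ≠ 0 →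
      ∫⁻ η in Metric.ball (0 : R3) (2 * ‖ξ‖),
        ENNReal.ofReal (‖ξ - η‖ ^ (-(5 / 4) : ℝ) * ‖η‖ ^ (-(1 / 4) : ℝ)) ^ 2 ≤ ENNReal.ofReal c := by
  obtain ⟨c₁, h1, hc₁⟩ := lintegral_ball_norm_rpow (p := 1 / 2) (by norm_num)
  obtain ⟨c₂, h2, hc₂⟩ := lintegral_ball_norm_rpow (p := 5 / 2) (by norm_num)
  refine ⟨(1 / 2) ^ (-(5 / 2) : ℝ) * (c₁ * 2 ^ (5 / 2 : ℝ)) +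
    (1 / 2) ^ (-(1 / 2) : ℝ) * (c₂ * 3 ^ (1 / 2 : ℝ)), by positivity, fun ξ hξ => ?_⟩
  have hx : 0 < ‖ξ‖ := norm_pos_iff.2 hξ
  have hsq : ∀ x : ℝ, 0 ≤ x → ∀ p : ℝ, (x ^ p) ^ 2 = x ^ (p * 2) := fun x hx p => by
    rw [← Real.rpow_natCast, ← Real.rpow_mul hx]; norm_num
  have hpt : ∀ η : R3, ENNReal.ofReal (‖ξ - η‖ ^ (-(5 / 4) : ℝ) * ‖η‖ ^ (-(1 / 4) : ℝ)) ^ 2 ≤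
      ENNReal.ofReal ((‖ξ‖ / 2) ^ (-(5 / 2) : ℝ)) * ENNReal.ofReal (‖η‖ ^ (-(1 / 2) : ℝ)) +
      ENNReal.ofReal ((‖ξ‖ / 2) ^ (-(1 / 2) : ℝ)) * ENNReal.ofReal (‖ξ - η‖ ^ (-(5 / 2) : ℝ)) := by
    intro η
    rw [← ENNReal.ofReal_pow (by positivity), ← ENNReal.ofReal_mul (by positivity),
      ← ENNReal.ofReal_mul (by positivity), ← ENNReal.ofReal_add (by positivity) (by positivity)]
    refine ENNReal.ofReal_le_ofReal ?_
    rw [mul_pow, hsq _ (norm_nonneg _), hsq _ (norm_nonneg _)]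
    norm_num
    have htri : ‖ξ‖ ≤ ‖ξ - η‖ + ‖η‖ := by simpa using norm_add_le (ξ - η) η
    rcases le_total (‖ξ‖ / 2) ‖η‖ with h | h
    · have h3 : ‖η‖ ^ (-(1 / 2) : ℝ) ≤ (‖ξ‖ / 2) ^ (-(1 / 2) : ℝ) :=
        Real.rpow_le_rpow_of_nonpos (by positivity) h (by norm_num)
      have h4 : 0 ≤ (‖ξ‖ / 2) ^ (-(5 / 2) : ℝ) * ‖η‖ ^ (-(1 / 2) : ℝ) := by positivity
      nlinarith [mul_le_mul_of_nonneg_left h3 (by positivity : 0 ≤ ‖ξ - η‖ ^ (-(5 / 2) : ℝ))]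
    · have h3 : ‖ξ - η‖ ^ (-(5 / 2) : ℝ) ≤ (‖ξ‖ / 2) ^ (-(5 / 2) : ℝ) :=
        Real.rpow_le_rpow_of_nonpos (by positivity) (by linarith) (by norm_num)
      have h4 : 0 ≤ (‖ξ‖ / 2) ^ (-(1 / 2) : ℝ) * ‖ξ - η‖ ^ (-(5 / 2) : ℝ) := by positivity
      nlinarith [mul_le_mul_of_nonneg_right h3 (by positivity : 0 ≤ ‖η‖ ^ (-(1 / 2) : ℝ))]
  have hI2 : ∫⁻ η in Metric.ball (0 : R3) (2 * ‖ξ‖), ENNReal.ofReal (‖ξ - η‖ ^ (-(5 / 2) : ℝ)) ≤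
      ENNReal.ofReal (c₂ * (3 * ‖ξ‖) ^ (3 - 5 / 2 : ℝ)) := by
    rw [← hc₂ _ (by positivity), ← lintegral_indicator Metric.isOpen_ball.measurableSet,
      ← lintegral_indicator Metric.isOpen_ball.measurableSet,
      ← lintegral_sub_left_eq_self (indicator (Metric.ball 0 (3 * ‖ξ‖)) _) ξ]
    refine lintegral_mono fun η => ?_
    by_cases h : η ∈ Metric.ball (0 : R3) (2 * ‖ξ‖)
    · have h' : ξ - η ∈ Metric.ball (0 : R3) (3 * ‖ξ‖) := by
        rw [mem_ball_zero_iff] at h ⊢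
        linarith [norm_sub_le ξ η]
      rw [indicator_of_mem h, indicator_of_mem h']
    · rw [indicator_of_notMem h]
      exact zero_le
  calc _ ≤ ∫⁻ η in Metric.ball (0 : R3) (2 * ‖ξ‖),
      (ENNReal.ofReal ((‖ξ‖ / 2) ^ (-(5 / 2) : ℝ)) * ENNReal.ofReal (‖η‖ ^ (-(1 / 2) : ℝ)) +
      ENNReal.ofReal ((‖ξ‖ / 2) ^ (-(1 / 2) : ℝ)) * ENNReal.ofReal (‖ξ - η‖ ^ (-(5 / 2) : ℝ))) :=
        lintegral_mono hpt
    _ ≤ ENNReal.ofReal ((‖ξ‖ / 2) ^ (-(5 / 2) : ℝ)) *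
          ENNReal.ofReal (c₁ * (2 * ‖ξ‖) ^ (3 - 1 / 2 : ℝ)) +
        ENNReal.ofReal ((‖ξ‖ / 2) ^ (-(1 / 2) : ℝ)) *
          ENNReal.ofReal (c₂ * (3 * ‖ξ‖) ^ (3 - 5 / 2 : ℝ)) := by
      rw [lintegral_add_left (by fun_prop), lintegral_const_mul _ (by fun_prop),
        lintegral_const_mul _ (by fun_prop), hc₁ _ (by positivity)]
      gcongr
    _ = _ := by
      rw [← ENNReal.ofReal_mul (by positivity), ← ENNReal.ofReal_mul (by positivity),
        ← ENNReal.ofReal_add (by positivity) (by positivity)]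
      congr 1
      rw [div_eq_mul_one_div, Real.mul_rpow hx.le (by norm_num), Real.mul_rpow hx.le (by norm_num),
        Real.mul_rpow (by norm_num) hx.le, Real.mul_rpow (by norm_num) hx.le]
      have e1 : ‖ξ‖ ^ (-(5 / 2) : ℝ) * ‖ξ‖ ^ (3 - 1 / 2 : ℝ) = 1 := by
        rw [← Real.rpow_add hx]; norm_num
      have e2 : ‖ξ‖ ^ (-(1 / 2) : ℝ) * ‖ξ‖ ^ (3 - 5 / 2 : ℝ) = 1 := by
        rw [← Real.rpow_add hx]; norm_num
      rw [show (2 : ℝ) ^ (5 / 2 : ℝ) = 2 ^ (3 - 1 / 2 : ℝ) by norm_num,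
        show (3 : ℝ) ^ (1 / 2 : ℝ) = 3 ^ (3 - 5 / 2 : ℝ) by norm_num]
      linear_combination ((1 / 2 : ℝ) ^ (-(5 / 2) : ℝ) * (c₁ * 2 ^ (3 - 1 / 2 : ℝ))) * e1 +
        ((1 / 2) ^ (-(1 / 2) : ℝ) * (c₂ * 3 ^ (3 - 5 / 2 : ℝ))) * e2

/-- Cauchy–Schwarz in `η` puts the whole kernel in one factor, where its square has a bounded
integral; what remains is the integral of `F² * G²`. -/
theorem lintegral_near_sq_le :
    ∃ c : ℝ, 0 ≤ c ∧ ∀ F G : R3 → ℝ≥0∞, Measurable F → Measurable G →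
      ∫⁻ ξ, (∫⁻ η in Metric.ball (0 : R3) (2 * ‖ξ‖),
        ENNReal.ofReal (‖ξ - η‖ ^ (-(5 / 4) : ℝ) * ‖η‖ ^ (-(1 / 4) : ℝ)) *
          (F (ξ - η) * G η)) ^ 2 ≤
        ENNReal.ofReal c * ((∫⁻ ζ, F ζ ^ 2) * ∫⁻ η, G η ^ 2) := by
  obtain ⟨c, hc, h⟩ := lintegral_near_kernel
  refine ⟨c, hc, fun F G hF hG => ?_⟩
  have hae : ∀ᵐ ξ : R3, ξ ≠ 0 := by simp [ae_iff]
  calc _ ≤ ∫⁻ ξ, ENNReal.ofReal c * ∫⁻ η, F (ξ - η) ^ 2 * G η ^ 2 := by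
        refine lintegral_mono_ae ?_
        filter_upwards [hae] with ξ hξ
        refine (lintegral_mul_sq_le _ (by fun_prop) (by fun_prop)).trans ?_
        refine mul_le_mul' (h ξ hξ) ?_
        simp_rw [mul_pow]
        exact setLIntegral_le_lintegral _ _
    _ = ENNReal.ofReal c * ∫⁻ η, ∫⁻ ξ, F (ξ - η) ^ 2 * G η ^ 2 := by
        rw [lintegral_const_mul _ (Measurable.lintegral_prod_right (by fun_prop)),
          lintegral_lintegral_swap (by fun_prop)]
    _ = _ := by
        congr 1
        rw [← lintegral_const_mul _ (by fun_prop)]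
        refine lintegral_congr fun η => ?_
        rw [lintegral_mul_const _ (by fun_prop), lintegral_sub_right_eq_self (fun ζ => F ζ ^ 2) η]

theorem far_kernel_le {ξ η : R3} (hη : 2 * ‖ξ‖ ≤ ‖η‖) (h0 : ξ ≠ 0) :
    ‖ξ - η‖ ^ (-(5 / 4) : ℝ) * ‖η‖ ^ (-(1 / 4) : ℝ) ≤
      3 * ‖ξ‖ ^ (-1 : ℝ) * ‖η‖ ^ (-(1 / 2) : ℝ) := by
  have hx : 0 < ‖ξ‖ := norm_pos_iff.2 h0
  have hy : 0 < ‖η‖ := by linarith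
  have h1 : ‖η‖ / 2 ≤ ‖ξ - η‖ := by
    have := norm_sub_norm_le η ξ
    rw [norm_sub_rev] at this
    linarith
  have h2 : ‖ξ - η‖ ^ (-(5 / 4) : ℝ) ≤ (‖η‖ / 2) ^ (-(5 / 4) : ℝ) :=
    Real.rpow_le_rpow_of_nonpos (by positivity) h1 (by norm_num)
  have h3 : ‖η‖ ^ (-1 : ℝ) ≤ ‖ξ‖ ^ (-1 : ℝ) :=
    Real.rpow_le_rpow_of_nonpos hx (by linarith) (by norm_num)
  have h4 : (2 : ℝ) ^ (5 / 4 : ℝ) ≤ 3 := by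
    have : ((2 : ℝ) ^ (5 / 4 : ℝ)) ^ 4 ≤ 3 ^ 4 := by
      rw [← Real.rpow_natCast, ← Real.rpow_mul (by norm_num)]; norm_num
    exact le_of_pow_le_pow_left₀ (by norm_num) (by norm_num) this
  calc _ ≤ (‖η‖ / 2) ^ (-(5 / 4) : ℝ) * ‖η‖ ^ (-(1 / 4) : ℝ) := by gcongr
    _ = 2 ^ (5 / 4 : ℝ) * (‖η‖ ^ (-1 : ℝ) * ‖η‖ ^ (-(1 / 2) : ℝ)) := by
      rw [Real.div_rpow hy.le (by norm_num), Real.rpow_neg (by norm_num : (0 : ℝ) ≤ 2), div_inv_eq_mul,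
        mul_comm _ ((2 : ℝ) ^ _), mul_assoc, ← Real.rpow_add hy, ← Real.rpow_add hy]
      norm_num
    _ ≤ 3 * (‖ξ‖ ^ (-1 : ℝ) * ‖η‖ ^ (-(1 / 2) : ℝ)) := by gcongr
    _ = _ := by ring

/-- For `|η| ≥ 2|ξ|` the squared kernel decays only like `|η|^{-3}` and is not integrable at
infinity. Instead one uses the bound `3 |ξ|^{-1} |η|^{-1/2}`, keeps the weight with `G` in
Cauchy–Schwarz, and integrates in `ξ` first: the integral of `|ξ|^{-2}` over `|ξ| < |η|` is `c |η|`,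
which cancels the remaining `|η|^{-1}`. -/
theorem lintegral_far_sq_le :
    ∃ c : ℝ, 0 ≤ c ∧ ∀ F G : R3 → ℝ≥0∞, Measurable F → Measurable G →
      ∫⁻ ξ, (∫⁻ η in (Metric.ball (0 : R3) (2 * ‖ξ‖))ᶜ,
        ENNReal.ofReal (‖ξ - η‖ ^ (-(5 / 4) : ℝ) * ‖η‖ ^ (-(1 / 4) : ℝ)) *
          (F (ξ - η) * G η)) ^ 2 ≤
        ENNReal.ofReal c * ((∫⁻ ζ, F ζ ^ 2) * ∫⁻ η, G η ^ 2) := by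
  obtain ⟨c, hc, h⟩ := lintegral_ball_norm_rpow (p := 2) (by norm_num)
  refine ⟨9 * c, by positivity, fun F G hF hG => ?_⟩
  have hae : ∀ᵐ ξ : R3, ξ ≠ 0 := by simp [ae_iff]
  have hmS : MeasurableSet {p : R3 × R3 | p.1 ∈ Metric.ball (0 : R3) ‖p.2‖} := by
    simp only [mem_ball_zero_iff]
    exact measurableSet_lt (by fun_prop) (by fun_prop)
  have hsq : ∀ (x : R3) (p : ℝ), ENNReal.ofReal (‖x‖ ^ p) ^ 2 = ENNReal.ofReal (‖x‖ ^ (p * 2)) := by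
    intro x p
    rw [← ENNReal.ofReal_pow (by positivity), ← Real.rpow_natCast, ← Real.rpow_mul (norm_nonneg _)]
    norm_num
  have hmI : Measurable fun p : R3 × R3 => (Metric.ball (0 : R3) ‖p.2‖).indicator
      (fun ξ => ENNReal.ofReal (‖ξ‖ ^ (-2 : ℝ))) p.1 *
        (ENNReal.ofReal (‖p.2‖ ^ (-1 : ℝ)) * G p.2 ^ 2) := by
    refine Measurable.mul ?_ (by fun_prop)
    have : Measurable ({p : R3 × R3 | p.1 ∈ Metric.ball (0 : R3) ‖p.2‖}.indicator
        fun p => ENNReal.ofReal (‖p.1‖ ^ (-2 : ℝ))) := Measurable.indicator (by fun_prop) hmS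
    exact this
  calc _ ≤ ∫⁻ ξ, (9 * ∫⁻ ζ, F ζ ^ 2) * ∫⁻ η, (Metric.ball (0 : R3) ‖η‖).indicator
          (fun ξ => ENNReal.ofReal (‖ξ‖ ^ (-2 : ℝ))) ξ *
            (ENNReal.ofReal (‖η‖ ^ (-1 : ℝ)) * G η ^ 2) := by
        refine lintegral_mono_ae ?_
        filter_upwards [hae] with ξ hξ
        have hx : 0 < ‖ξ‖ := norm_pos_iff.2 hξ
        calc _ ≤ (∫⁻ η in (Metric.ball (0 : R3) (2 * ‖ξ‖))ᶜ, F (ξ - η) *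
              (3 * ENNReal.ofReal (‖ξ‖ ^ (-1 : ℝ)) * (ENNReal.ofReal (‖η‖ ^ (-(1 / 2) : ℝ)) *
                G η))) ^ 2 := by
              refine pow_le_pow_left' (setLIntegral_mono' Metric.isOpen_ball.measurableSet.compl
                fun η hη => ?_) 2
              rw [mem_compl_iff, mem_ball_zero_iff, not_lt] at hη
              refine (mul_le_mul_left (ENNReal.ofReal_le_ofReal (far_kernel_le hη hξ)) _).trans_eq ?_
              rw [ENNReal.ofReal_mul (by positivity), ENNReal.ofReal_mul (by positivity)]
              norm_num
              ring
          _ ≤ (∫⁻ η in (Metric.ball (0 : R3) (2 * ‖ξ‖))ᶜ, F (ξ - η) ^ 2) *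
              ∫⁻ η in (Metric.ball (0 : R3) (2 * ‖ξ‖))ᶜ, (3 * ENNReal.ofReal (‖ξ‖ ^ (-1 : ℝ)) *
                (ENNReal.ofReal (‖η‖ ^ (-(1 / 2) : ℝ)) * G η)) ^ 2 :=
              lintegral_mul_sq_le _ (by fun_prop) (by fun_prop)
          _ ≤ (∫⁻ ζ, F ζ ^ 2) * ∫⁻ η, 9 * ((Metric.ball (0 : R3) ‖η‖).indicator
              (fun ξ => ENNReal.ofReal (‖ξ‖ ^ (-2 : ℝ))) ξ *
                (ENNReal.ofReal (‖η‖ ^ (-1 : ℝ)) * G η ^ 2)) := by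
              refine mul_le_mul' ?_ ?_
              · refine (setLIntegral_le_lintegral _ _).trans_eq ?_
                exact lintegral_sub_left_eq_self (fun ζ => F ζ ^ 2) ξ
              · rw [← lintegral_indicator Metric.isOpen_ball.measurableSet.compl]
                refine lintegral_mono fun η => ?_
                by_cases hη : η ∈ (Metric.ball (0 : R3) (2 * ‖ξ‖))ᶜ
                swap
                · rw [indicator_of_notMem hη]
                  exact zero_le
                rw [indicator_of_mem hη]
                rw [mem_compl_iff, mem_ball_zero_iff, not_lt] at hη
                rw [indicator_of_mem (by rw [mem_ball_zero_iff]; linarith)]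
                simp only [mul_pow, hsq]
                norm_num
                refine le_of_eq ?_
                ring
          _ = _ := by
              rw [lintegral_const_mul' _ _ (by norm_num)]
              ring
    _ = (9 * ∫⁻ ζ, F ζ ^ 2) * ∫⁻ η, ∫⁻ ξ, (Metric.ball (0 : R3) ‖η‖).indicator
          (fun ξ => ENNReal.ofReal (‖ξ‖ ^ (-2 : ℝ))) ξ *
            (ENNReal.ofReal (‖η‖ ^ (-1 : ℝ)) * G η ^ 2) := by
        rw [lintegral_const_mul _ hmI.lintegral_prod_right, lintegral_lintegral_swap hmI.aemeasurable]
    _ = (9 * ∫⁻ ζ, F ζ ^ 2) * ∫⁻ η, ENNReal.ofReal c * G η ^ 2 := by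
        congr 1
        refine lintegral_congr_ae ?_
        filter_upwards [hae] with η hη
        have hx : 0 < ‖η‖ := norm_pos_iff.2 hη
        rw [lintegral_mul_const _ (Measurable.indicator (by fun_prop)
          Metric.isOpen_ball.measurableSet), lintegral_indicator Metric.isOpen_ball.measurableSet,
          h _ hx, ← mul_assoc, ← ENNReal.ofReal_mul (by positivity), mul_assoc,
          ← Real.rpow_add hx]
        norm_num
    _ = _ := by
        rw [lintegral_const_mul _ (by fun_prop), ENNReal.ofReal_mul (by norm_num)]
        norm_num
        ring

/-- The product estimate `‖(Mf·∇)g‖_{L²} ≤ C ‖A^{5/4} f‖ ‖A^{5/4} g‖` on the Fourier side. -/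
theorem exists_lintegral_convolution_sq_le :
    ∃ c : ℝ, 0 ≤ c ∧ ∀ F G : R3 → ℝ≥0∞, Measurable F → Measurable G →
      ∫⁻ ξ, (∫⁻ η, F (ξ - η) * (ENNReal.ofReal ‖η‖ * G η)) ^ 2 ≤
        ENNReal.ofReal c * ((∫⁻ ζ, (ENNReal.ofReal (‖ζ‖ ^ (5 / 4 : ℝ)) * F ζ) ^ 2) *
          ∫⁻ η, (ENNReal.ofReal (‖η‖ ^ (5 / 4 : ℝ)) * G η) ^ 2) := by
  obtain ⟨c₁, h₁, hn⟩ := lintegral_near_sq_le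
  obtain ⟨c₂, h₂, hf⟩ := lintegral_far_sq_le
  refine ⟨2 * (c₁ + c₂), by positivity, fun F G hF hG => ?_⟩
  set F' : R3 → ℝ≥0∞ := fun ζ => ENNReal.ofReal (‖ζ‖ ^ (5 / 4 : ℝ)) * F ζ with hF'
  set G' : R3 → ℝ≥0∞ := fun ζ => ENNReal.ofReal (‖ζ‖ ^ (5 / 4 : ℝ)) * G ζ with hG'
  have mF : Measurable F' := by fun_prop
  have mG : Measurable G' := by fun_prop
  set J : R3 → R3 → ℝ≥0∞ := fun ξ η =>
    ENNReal.ofReal (‖ξ - η‖ ^ (-(5 / 4) : ℝ) * ‖η‖ ^ (-(1 / 4) : ℝ)) * (F' (ξ - η) * G' η) with hJ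
  have hae : ∀ᵐ ξ : R3, ξ ≠ 0 := by simp [ae_iff]
  have hpt : ∀ ξ, ∫⁻ η, F (ξ - η) * (ENNReal.ofReal ‖η‖ * G η) = ∫⁻ η, J ξ η := by
    intro ξ
    refine lintegral_congr_ae ?_
    filter_upwards [hae, (Measure.measurePreserving_sub_left volume ξ).quasiMeasurePreserving.ae hae]
      with η h1 h2
    have e1 : ‖ξ - η‖ ^ (-(5 / 4) : ℝ) * ‖ξ - η‖ ^ (5 / 4 : ℝ) = 1 := by
      rw [← Real.rpow_add (norm_pos_iff.2 h2)]; norm_num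
    have e2 : ‖η‖ ^ (-(1 / 4) : ℝ) * ‖η‖ ^ (5 / 4 : ℝ) = ‖η‖ := by
      rw [← Real.rpow_add (norm_pos_iff.2 h1)]; norm_num
    -- The derivative `|η|` is redistributed: `5/4` powers go to each factor, and the kernel
    -- `|ξ-η|^{-5/4} |η|^{-1/4}` is left over.
    have e3 : ENNReal.ofReal (‖ξ - η‖ ^ (-(5 / 4) : ℝ) * ‖η‖ ^ (-(1 / 4) : ℝ)) *
        (ENNReal.ofReal (‖ξ - η‖ ^ (5 / 4 : ℝ)) * ENNReal.ofReal (‖η‖ ^ (5 / 4 : ℝ))) =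
        ENNReal.ofReal ‖η‖ := by
      rw [← ENNReal.ofReal_mul (by positivity), ← ENNReal.ofReal_mul (by positivity)]
      congr 1
      linear_combination ‖η‖ ^ (-(1 / 4) : ℝ) * ‖η‖ ^ (5 / 4 : ℝ) * e1 + e2
    simp only [hJ, hF', hG']
    rw [← e3]
    ring
  have hmS : MeasurableSet {p : R3 × R3 | p.2 ∈ Metric.ball (0 : R3) (2 * ‖p.1‖)} := by
    simp only [mem_ball_zero_iff]
    exact measurableSet_lt (by fun_prop) (by fun_prop)
  have hmJ : Measurable (Function.uncurry J) := by
    simp only [hJ]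
    fun_prop
  have hmN : Measurable fun ξ => ∫⁻ η in Metric.ball (0 : R3) (2 * ‖ξ‖), J ξ η := by
    have : Measurable ({p : R3 × R3 | p.2 ∈ Metric.ball (0 : R3) (2 * ‖p.1‖)}.indicator
        (Function.uncurry J)) := hmJ.indicator hmS
    convert this.lintegral_prod_right' (ν := volume) using 2 with ξ
    rw [← lintegral_indicator Metric.isOpen_ball.measurableSet]
    rfl
  calc _ = ∫⁻ ξ, ((∫⁻ η in Metric.ball (0 : R3) (2 * ‖ξ‖), J ξ η) +
        ∫⁻ η in (Metric.ball (0 : R3) (2 * ‖ξ‖))ᶜ, J ξ η) ^ 2 := by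
        refine lintegral_congr fun ξ => ?_
        rw [hpt]
        congr 1
        exact (lintegral_add_compl _ Metric.isOpen_ball.measurableSet).symm
    _ ≤ ∫⁻ ξ, (2 * (∫⁻ η in Metric.ball (0 : R3) (2 * ‖ξ‖), J ξ η) ^ 2 +
        2 * (∫⁻ η in (Metric.ball (0 : R3) (2 * ‖ξ‖))ᶜ, J ξ η) ^ 2) := by
        refine lintegral_mono fun ξ => ?_
        dsimp only
        rw [← mul_add]
        have := ENNReal.rpow_add_le_mul_rpow_add_rpow
          (∫⁻ η in Metric.ball (0 : R3) (2 * ‖ξ‖), J ξ η)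
          (∫⁻ η in (Metric.ball (0 : R3) (2 * ‖ξ‖))ᶜ, J ξ η) (p := 2) (by norm_num)
        norm_num at this
        exact this
    _ ≤ 2 * (ENNReal.ofReal c₁ * ((∫⁻ ζ, F' ζ ^ 2) * ∫⁻ η, G' η ^ 2)) +
        2 * (ENNReal.ofReal c₂ * ((∫⁻ ζ, F' ζ ^ 2) * ∫⁻ η, G' η ^ 2)) := by
        rw [lintegral_add_left (by fun_prop), lintegral_const_mul _ (by fun_prop),
          lintegral_const_mul' _ _ (by norm_num)]
        gcongr
        · exact hn F' G' mF mG
        · exact hf F' G' mF mG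
    _ = _ := by
        rw [ENNReal.ofReal_mul (by norm_num), ENNReal.ofReal_add h₁ h₂]
        norm_num
        ring

/-! ### Weak heat equation and Duhamel's inequality -/

/-- The symbol `e^{-r|2πξ|²}` of the heat semigroup. -/
def symbHeat (r : ℝ) (ξ : R3) : ℝ := Real.exp (-r * symbA ξ ^ 2)

theorem continuous_symbA : Continuous symbA := by unfold symbA; fun_prop

theorem contDiff_symbA_sq : ContDiff ℝ (⊤ : ℕ∞) fun ξ : R3 => symbA ξ ^ 2 := by
  have : (fun ξ : R3 => (symbA ξ ^ 2 : ℝ)) = fun ξ => (2 * Real.pi) ^ 2 * ‖ξ‖ ^ 2 := by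
    ext ξ; simp [symbA, mul_pow]
  rw [this]
  exact contDiff_const.mul (contDiff_norm_sq ℝ)

theorem symbA_nonneg (ξ : R3) : 0 ≤ symbA ξ := by unfold symbA; positivity

theorem measurable_symbA : Measurable symbA := continuous_symbA.measurable

theorem measurable_symbHeat (r : ℝ) : Measurable (symbHeat r) := by
  have := measurable_symbA
  unfold symbHeat
  fun_prop

theorem abs_symbHeat_le_one {r : ℝ} (hr : 0 ≤ r) (ξ : R3) : |symbHeat r ξ| ≤ 1 := by
  unfold symbHeat
  rw [Real.abs_exp, Real.exp_le_one_iff]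
  have : 0 ≤ r * symbA ξ ^ 2 := by positivity
  linarith

theorem MeasureTheory.MemLp.ofReal_mul {b : R3 → ℝ} {K : ℝ} {f : R3 → ℂ} (hf : MemLp f 2 volume)
    (hb : Measurable b) (hK : ∀ ξ, |b ξ| ≤ K) : MemLp (fun ξ => (b ξ : ℂ) * f ξ) 2 volume := by
  refine hf.of_le_mul (c := K) ?_ (.of_forall fun ξ => ?_)
  · exact (Complex.measurable_ofReal.comp hb).aestronglyMeasurable.mul hf.1
  · rw [norm_mul, Complex.norm_real, Real.norm_eq_abs]
    exact mul_le_mul_of_nonneg_right (hK ξ) (norm_nonneg _)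

theorem norm_integral_mul_le {f g : R3 → ℂ} (hf : MemLp f 2 volume) (hg : MemLp g 2 volume) :
    ‖∫ ξ, f ξ * g ξ‖ ≤ (eLpNorm f 2 volume).toReal * (eLpNorm g 2 volume).toReal := by
  have h := norm_inner_le_norm (𝕜 := ℂ) (hf.star.toLp _) (hg.toLp _)
  rw [Lp.norm_toLp, Lp.norm_toLp, eLpNorm_star, L2.inner_def] at h
  refine le_of_eq_of_le (congrArg norm (integral_congr_ae ?_)) h
  filter_upwards [hf.star.coeFn_toLp, hg.coeFn_toLp] with ξ h1 h2
  rw [h1, h2]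
  simp [mul_comm]

/-- The bilinear pairing `∫ f g` of two elements of `L²`. -/
def bilinL2 : L2 →L[ℂ] L2 →L[ℂ] ℂ :=
  ContinuousLinearMap.lpPairing volume 2 2 (ContinuousLinearMap.mul ℂ ℂ)

theorem bilinL2_apply (f g : L2) : bilinL2 f g = ∫ ξ, f ξ * g ξ := by
  simp [bilinL2, ContinuousLinearMap.lpPairing_eq_integral]

theorem bilinL2_toLp {ψ : R3 → ℂ} (hψ : MemLp ψ 2 volume) (g : L2) :
    bilinL2 (hψ.toLp ψ) g = ∫ ξ, ψ ξ * g ξ := by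
  rw [bilinL2_apply]
  refine integral_congr_ae ?_
  filter_upwards [hψ.coeFn_toLp] with ξ h
  rw [h]

/-- Product rule for a pairing of a strongly differentiable and a strongly continuous, weakly
differentiable function. -/
theorem hasDerivAt_pairing {E F : Type*} [NormedAddCommGroup E] [NormedSpace ℂ E]
    [NormedAddCommGroup F] [NormedSpace ℂ F]
    (B : E →L[ℂ] F →L[ℂ] ℂ) {Ψ : ℝ → E} {y : ℝ → F} {Ψ' : E} {d : ℂ} {τ : ℝ}
    (hΨ : HasDerivAt Ψ Ψ' τ) (hy : ContinuousAt y τ)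
    (hd : HasDerivAt (fun σ => B (Ψ τ) (y σ)) d τ) :
    HasDerivAt (fun σ => B (Ψ σ) (y σ)) (B Ψ' (y τ) + d) τ := by
  rw [hasDerivAt_iff_tendsto_slope] at hΨ hd ⊢
  have h1 : Tendsto (fun σ => B (slope Ψ τ σ) (y σ)) (𝓝[≠] τ) (𝓝 (B Ψ' (y τ))) := by
    have hc : Continuous fun p : E × F => B p.1 p.2 := by fun_prop
    exact (hc.tendsto (Ψ', y τ)).comp (hΨ.prodMk_nhds (hy.tendsto.mono_left nhdsWithin_le_nhds))
  refine (h1.add hd).congr fun σ => ?_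
  have e : B ((σ - τ)⁻¹ • (Ψ σ - Ψ τ)) (y σ) = (σ - τ)⁻¹ • B (Ψ σ - Ψ τ) (y σ) := by
    rw [← Complex.coe_smul, map_smul, ← Complex.coe_smul]
    rfl
  simp only [slope_def_module, e, ← smul_add]
  congr 1
  simp

/-- A mean value inequality with an integrable bound on the derivative. -/
theorem norm_le_add_integral_of_hasDerivAt {f f' : ℝ → ℂ} {k : ℝ → ℝ} {s : ℝ} (hs : 0 ≤ s)
    (hf : ContinuousOn f (Icc 0 s)) (hd : ∀ τ ∈ Ioo 0 s, HasDerivAt f (f' τ) τ)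
    (hk : IntegrableOn k (Ioo 0 s)) (hle : ∀ τ ∈ Ioo 0 s, ‖f' τ‖ ≤ k τ) :
    ‖f s‖ ≤ ‖f 0‖ + ∫ τ in Ioo 0 s, k τ := by
  -- The function `f'` is not assumed measurable; this comes from the measurability of `deriv f`.
  have hae : f' =ᵐ[volume.restrict (Ioo 0 s)] deriv f := by
    filter_upwards [ae_restrict_mem measurableSet_Ioo] with τ hτ
    exact (hd τ hτ).deriv.symm
  have hint : IntegrableOn f' (Ioo 0 s) := by
    refine Integrable.mono' hk ((measurable_deriv f).aestronglyMeasurable.congr hae.symm) ?_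
    filter_upwards [ae_restrict_mem measurableSet_Ioo] with τ hτ using hle τ hτ
  have hI : IntervalIntegrable f' volume 0 s := by
    rw [intervalIntegrable_iff_integrableOn_Ioo_of_le hs]
    exact hint
  have h := intervalIntegral.integral_eq_sub_of_hasDerivAt_of_le hs hf hd hI
  rw [intervalIntegral.integral_of_le hs, integral_Ioc_eq_integral_Ioo] at h
  have h2 : ‖∫ τ in Ioo 0 s, f' τ‖ ≤ ∫ τ in Ioo 0 s, k τ := by
    refine norm_integral_le_of_norm_le hk ?_
    filter_upwards [ae_restrict_mem measurableSet_Ioo] with τ hτ using hle τ hτ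
  rw [h] at h2
  calc ‖f s‖ = ‖f 0 + (f s - f 0)‖ := by congr 1; ring
    _ ≤ _ := (norm_add_le _ _).trans (by linarith)

/-- On the compact support of `ψ` the symbol `|2πξ|²` is bounded, so the Taylor remainder of the
exponential is `O((σ - τ)²)` uniformly in `ξ`, hence in `L²`. -/
theorem hasDerivAt_toLp_heat {ψ : R3 → ℂ} (hc : HasCompactSupport ψ) (s τ : ℝ)
    (hm : ∀ σ : ℝ, MemLp (fun ξ => (symbHeat (s - σ) ξ : ℂ) * ψ ξ) 2 volume)
    (hm' : MemLp (fun ξ => ((symbA ξ ^ 2 : ℝ) : ℂ) * ((symbHeat (s - τ) ξ : ℂ) * ψ ξ)) 2 volume) :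
    HasDerivAt (fun σ => (hm σ).toLp _) (hm'.toLp _) τ := by
  obtain ⟨K, hK⟩ : ∃ K : ℝ, ∀ ξ ∈ tsupport ψ, symbA ξ ^ 2 ≤ K := by
    obtain ⟨K, hK⟩ := hc.isCompact.bddAbove_image (f := fun ξ => symbA ξ ^ 2)
      (continuous_symbA.pow 2).continuousOn
    exact ⟨K, fun ξ hξ => hK (mem_image_of_mem _ hξ)⟩
  set K' : ℝ := max K 1
  have hK' : ∀ ξ ∈ tsupport ψ, symbA ξ ^ 2 ≤ K' := fun ξ hξ => (hK ξ hξ).trans (le_max_left _ _)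
  have hK0 : 0 < K' := lt_of_lt_of_le one_pos (le_max_right _ _)
  rw [hasDerivAt_iff_isLittleO]
  refine Asymptotics.IsBigO.trans_isLittleO (g := fun σ : ℝ => (σ - τ) ^ 2) ?_ ?_
  · refine Asymptotics.IsBigO.of_bound (K' ^ 2 * ‖(hm τ).toLp _‖) ?_
    filter_upwards [Metric.ball_mem_nhds τ (inv_pos.2 hK0)] with σ hσ
    rw [Metric.mem_ball, Real.dist_eq] at hσ
    rw [mul_right_comm]
    refine Lp.norm_le_mul_norm_of_ae_le_mul ?_
    filter_upwards [Lp.coeFn_sub ((hm σ).toLp _ - (hm τ).toLp _) ((σ - τ) • hm'.toLp _),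
      Lp.coeFn_sub ((hm σ).toLp _) ((hm τ).toLp _),
      Lp.coeFn_smul (σ - τ) (hm'.toLp _), (hm σ).coeFn_toLp, (hm τ).coeFn_toLp,
      hm'.coeFn_toLp] with ξ h1 h2 h3 h4 h5 h6
    rw [h1, Pi.sub_apply, h2, Pi.sub_apply, h3, Pi.smul_apply, h4, h5, h6]
    by_cases hξ : ξ ∈ tsupport ψ
    swap
    · simp [image_eq_zero_of_notMem_tsupport hξ]
    have he : symbHeat (s - σ) ξ = Real.exp ((σ - τ) * symbA ξ ^ 2) * symbHeat (s - τ) ξ := by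
      unfold symbHeat
      rw [← Real.exp_add]
      congr 1
      ring
    have hsmall : ‖(σ - τ) * symbA ξ ^ 2‖ ≤ |σ - τ| * K' := by
      rw [norm_mul, Real.norm_eq_abs, Real.norm_eq_abs, abs_of_nonneg (sq_nonneg (symbA ξ))]
      exact mul_le_mul_of_nonneg_left (hK' ξ hξ) (abs_nonneg _)
    have hone : |σ - τ| * K' ≤ 1 := by
      have := mul_le_mul_of_nonneg_right hσ.le hK0.le
      rwa [inv_mul_cancel₀ hK0.ne'] at this
    have hexp := Real.norm_exp_sub_one_sub_id_le (hsmall.trans hone)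
    have e : ((symbHeat (s - σ) ξ : ℂ) * ψ ξ - (symbHeat (s - τ) ξ : ℂ) * ψ ξ -
        (σ - τ) • (((symbA ξ ^ 2 : ℝ) : ℂ) * ((symbHeat (s - τ) ξ : ℂ) * ψ ξ))) =
        ((Real.exp ((σ - τ) * symbA ξ ^ 2) - 1 - (σ - τ) * symbA ξ ^ 2 : ℝ) : ℂ) *
          ((symbHeat (s - τ) ξ : ℂ) * ψ ξ) := by
      rw [he, Complex.real_smul]
      push_cast
      ring
    rw [e, norm_mul, Complex.norm_real]
    refine mul_le_mul_of_nonneg_right (hexp.trans ?_) (norm_nonneg _)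
    calc ‖(σ - τ) * symbA ξ ^ 2‖ ^ 2 ≤ (|σ - τ| * K') ^ 2 :=
          pow_le_pow_left₀ (norm_nonneg _) hsmall 2
      _ = K' ^ 2 * ‖(σ - τ) ^ 2‖ := by
          rw [mul_pow, sq_abs, Real.norm_eq_abs, abs_of_nonneg (sq_nonneg _)]; ring
  · have h1 : (fun σ : ℝ => (σ - τ) ^ 2) = fun σ => (σ - τ) * (σ - τ) := by
      ext σ; ring
    rw [h1]
    have h2 : (fun σ : ℝ => σ - τ) =o[𝓝 τ] fun _ => (1 : ℝ) := by
      rw [Asymptotics.isLittleO_one_iff]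
      exact Continuous.tendsto' (by fun_prop) _ _ (sub_self τ)
    simpa using h2.mul_isBigO (Asymptotics.isBigO_refl (fun σ : ℝ => σ - τ) (𝓝 τ))

/-- Weak form of the equation `y' = -|2πξ|² y - n` on `]0,T[`, tested with smooth compactly
supported functions. -/
def IsWeakHeatSolution (T : ℝ) (y n : ℝ → L2) : Prop :=
  ∀ ψ : R3 → ℂ, ContDiff ℝ (⊤ : ℕ∞) ψ → HasCompactSupport ψ → ∀ t ∈ Ioo 0 T,
    HasDerivAt (fun s => ∫ ξ, ψ ξ * y s ξ)
      (-(∫ ξ, ((symbA ξ ^ 2 : ℝ) : ℂ) * ψ ξ * y t ξ) - ∫ ξ, ψ ξ * n t ξ) t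

theorem contDiff_symbHeat (r : ℝ) : ContDiff ℝ (⊤ : ℕ∞) (symbHeat r) := by
  unfold symbHeat
  exact Real.contDiff_exp.comp (contDiff_const.mul contDiff_symbA_sq)

theorem contDiff_ofReal_mul {b : R3 → ℝ} {ψ : R3 → ℂ} (hb : ContDiff ℝ (⊤ : ℕ∞) b)
    (hψ : ContDiff ℝ (⊤ : ℕ∞) ψ) : ContDiff ℝ (⊤ : ℕ∞) fun ξ => (b ξ : ℂ) * ψ ξ :=
  (Complex.ofRealCLM.contDiff.comp hb).mul hψ

theorem memLp_of_contDiff {ψ : R3 → ℂ} (hψ : ContDiff ℝ (⊤ : ℕ∞) ψ) (hc : HasCompactSupport ψ) :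
    MemLp ψ 2 volume :=
  hψ.continuous.memLp_of_hasCompactSupport hc

/-- Duhamel's formula, tested and in absolute value. -/
theorem IsWeakHeatSolution.norm_integral_le {T : ℝ} {y n : ℝ → L2} (h : IsWeakHeatSolution T y n)
    (hy : ContinuousOn y (Icc 0 T)) {s : ℝ} (hs : s ∈ Ioc 0 T) {ψ : R3 → ℂ}
    (hψ : ContDiff ℝ (⊤ : ℕ∞) ψ) (hc : HasCompactSupport ψ) {k : ℝ → ℝ}
    (hk : IntegrableOn k (Ioo 0 s))
    (hle : ∀ τ ∈ Ioo 0 s, ‖∫ ξ, ψ ξ * ((symbHeat (s - τ) ξ : ℂ) * n τ ξ)‖ ≤ k τ) :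
    ‖∫ ξ, ψ ξ * y s ξ‖ ≤
      ‖∫ ξ, ψ ξ * ((symbHeat s ξ : ℂ) * y 0 ξ)‖ + ∫ τ in Ioo 0 s, k τ := by
  have hcd : ∀ σ : ℝ, ContDiff ℝ (⊤ : ℕ∞) fun ξ => (symbHeat (s - σ) ξ : ℂ) * ψ ξ := fun σ =>
    contDiff_ofReal_mul (contDiff_symbHeat _) hψ
  have hcc : ∀ σ : ℝ, HasCompactSupport fun ξ => (symbHeat (s - σ) ξ : ℂ) * ψ ξ := fun σ =>
    hc.mul_left
  have hm : ∀ σ : ℝ, MemLp (fun ξ => (symbHeat (s - σ) ξ : ℂ) * ψ ξ) 2 volume := fun σ =>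
    memLp_of_contDiff (hcd σ) (hcc σ)
  have hm' : ∀ σ : ℝ, MemLp (fun ξ => ((symbA ξ ^ 2 : ℝ) : ℂ) *
      ((symbHeat (s - σ) ξ : ℂ) * ψ ξ)) 2 volume := fun σ =>
    memLp_of_contDiff (contDiff_ofReal_mul contDiff_symbA_sq (hcd σ)) (hcc σ).mul_left
  -- The test function is transported by the backward heat flow. Its derivative cancels the term
  -- `-|2πξ|² y` of the equation, so only the forcing contributes to the derivative of the pairing.
  let Ψ : ℝ → L2 := fun σ => (hm σ).toLp _
  have hΨ : ∀ τ, HasDerivAt Ψ ((hm' τ).toLp _) τ := fun τ =>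
    hasDerivAt_toLp_heat hc s τ hm (hm' τ)
  have key := norm_le_add_integral_of_hasDerivAt
    (f := fun τ => bilinL2 (Ψ τ) (y τ))
    (f' := fun τ => -∫ ξ, (symbHeat (s - τ) ξ : ℂ) * ψ ξ * n τ ξ) hs.1.le ?_ ?_ hk ?_
  · simp only [Ψ, bilinL2_toLp] at key
    have e1 : ∫ ξ, (symbHeat (s - s) ξ : ℂ) * ψ ξ * y s ξ = ∫ ξ, ψ ξ * y s ξ := by
      congr 1 with ξ
      simp [symbHeat]
    have e2 : ∫ ξ, (symbHeat (s - 0) ξ : ℂ) * ψ ξ * y 0 ξ =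
        ∫ ξ, ψ ξ * ((symbHeat s ξ : ℂ) * y 0 ξ) := by
      congr 1 with ξ
      rw [sub_zero]
      ring
    rwa [e1, e2] at key
  · have h1 : Continuous Ψ :=
      continuous_iff_continuousAt.2 fun τ => (hΨ τ).continuousAt
    have h2 : ContinuousOn y (Icc 0 s) := hy.mono (Icc_subset_Icc_right hs.2)
    exact (bilinL2.continuous.comp_continuousOn h1.continuousOn).clm_apply h2
  · intro τ hτ
    have hτT : τ ∈ Ioo 0 T := ⟨hτ.1, hτ.2.trans_le hs.2⟩
    have hd := h _ (hcd τ) (hcc τ) τ hτT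
    simp_rw [← bilinL2_toLp (hm τ)] at hd
    refine (hasDerivAt_pairing bilinL2 (hΨ τ) (hy.continuousAt (Icc_mem_nhds hτT.1 hτT.2))
      hd).congr_deriv ?_
    rw [bilinL2_toLp, bilinL2_toLp]
    ring
  · intro τ hτ
    rw [norm_neg]
    refine le_of_eq_of_le (congrArg norm (integral_congr_ae (.of_forall fun ξ => ?_))) (hle τ hτ)
    dsimp only
    ring

/-- Duhamel's inequality for bounded multipliers. -/
theorem IsWeakHeatSolution.eLpNorm_le_of_bounded {T : ℝ} {y n : ℝ → L2}
    (h : IsWeakHeatSolution T y n) (hy : ContinuousOn y (Icc 0 T)) {ν : ℝ → ℝ} {s : ℝ}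
    (hs : s ∈ Ioc 0 T) (hν : IntegrableOn ν (Ioo 0 s)) (hn : ∀ τ ∈ Ioo 0 s, ‖n τ‖ ≤ ν τ)
    {q : R3 → ℝ} (hq : Measurable q) {K : ℝ} (hK : ∀ ξ, |q ξ| ≤ K) {a : ℝ} (ha : 0 ≤ a)
    {k : ℝ → ℝ} (hk : IntegrableOn k (Ioo 0 s)) (hk0 : ∀ τ ∈ Ioo 0 s, 0 ≤ k τ)
    (hA : eLpNorm (fun ξ => (q ξ : ℂ) * ((symbHeat s ξ : ℂ) * y 0 ξ)) 2 volume ≤ ENNReal.ofReal a)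
    (hle : ∀ τ ∈ Ioo 0 s, eLpNorm (fun ξ => (q ξ : ℂ) * ((symbHeat (s - τ) ξ : ℂ) * n τ ξ)) 2 volume
      ≤ ENNReal.ofReal (k τ)) :
    eLpNorm (fun ξ => (q ξ : ℂ) * y s ξ) 2 volume ≤
      ENNReal.ofReal (a + ∫ τ in Ioo 0 s, k τ) := by
  have hqy : MemLp (fun ξ => (q ξ : ℂ) * y s ξ) 2 volume := (Lp.memLp (y s)).ofReal_mul hq hK
  set N : ℝ := (eLpNorm (fun ξ => (q ξ : ℂ) * y s ξ) 2 volume).toReal with hN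
  have hN0 : 0 ≤ N := ENNReal.toReal_nonneg
  have hqys : MemLp (fun ξ => star ((q ξ : ℂ) * y s ξ)) 2 volume := hqy.star
  have hNs : (eLpNorm (fun ξ => star ((q ξ : ℂ) * y s ξ)) 2 volume).toReal = N := by
    rw [hN]; congr 1; exact eLpNorm_star
  -- Duality: `ζ = q · conj (q y(s))` satisfies `∫ ζ y(s) = N²`, while its pairing with
  -- `e^{-r|2πξ|²} z` is at most `N` times the weighted norm of the latter.
  have hζ : MemLp (fun ξ => (q ξ : ℂ) * star ((q ξ : ℂ) * y s ξ)) 2 volume := hqys.ofReal_mul hq hK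
  have hheat : ∀ r : ℝ, 0 ≤ r → ∀ z : L2, MemLp (fun ξ => (symbHeat r ξ : ℂ) * z ξ) 2 volume :=
    fun r hr z => (Lp.memLp z).ofReal_mul (measurable_symbHeat r) (abs_symbHeat_le_one hr)
  have hheat_le : ∀ r : ℝ, 0 ≤ r → ∀ z : L2,
      (eLpNorm (fun ξ => (symbHeat r ξ : ℂ) * z ξ) 2 volume).toReal ≤ ‖z‖ := by
    intro r hr z
    rw [Lp.norm_def]
    refine ENNReal.toReal_mono (Lp.eLpNorm_ne_top z) (eLpNorm_mono fun ξ => ?_)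
    rw [norm_mul, Complex.norm_real]
    exact mul_le_of_le_one_left (norm_nonneg _) (abs_symbHeat_le_one hr ξ)
  have hζz : ∀ r : ℝ, 0 ≤ r → ∀ z : L2, ∀ c : ℝ, 0 ≤ c →
      eLpNorm (fun ξ => (q ξ : ℂ) * ((symbHeat r ξ : ℂ) * z ξ)) 2 volume ≤ ENNReal.ofReal c →
      ‖∫ ξ, ((q ξ : ℂ) * star ((q ξ : ℂ) * y s ξ)) * ((symbHeat r ξ : ℂ) * z ξ)‖ ≤ N * c := by
    intro r hr z c hc hcz
    have h1 := norm_integral_mul_le hqys ((hheat r hr z).ofReal_mul hq hK)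
    rw [hNs] at h1
    refine le_trans (le_of_eq ?_)
      (h1.trans (mul_le_mul_of_nonneg_left (ENNReal.toReal_le_of_le_ofReal hc hcz) hN0))
    congr 1
    refine integral_congr_ae (.of_forall fun ξ => ?_)
    dsimp only
    ring
  have hself : ‖∫ ξ, ((q ξ : ℂ) * star ((q ξ : ℂ) * y s ξ)) * y s ξ‖ = N * N := by
    have h1 : ‖hqy.toLp _‖ = N := Lp.norm_toLp _ _
    have h2 := inner_self_eq_norm_sq_to_K (𝕜 := ℂ) (hqy.toLp _)
    rw [h1, L2.inner_def] at h2
    have h3 : ∫ ξ, ((q ξ : ℂ) * star ((q ξ : ℂ) * y s ξ)) * y s ξ = (N : ℂ) ^ 2 := by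
      refine Eq.trans (integral_congr_ae ?_) h2
      filter_upwards [hqy.coeFn_toLp] with ξ hξ
      rw [hξ, RCLike.inner_apply']
      simp only [map_mul, Complex.conj_ofReal, RCLike.star_def]
      ring
    rw [h3]
    simp [pow_two, abs_of_nonneg hN0]
  set D : ℝ := ‖y s‖ + ‖y 0‖ + ∫ τ in Ioo 0 s, ν τ with hD
  set S : ℝ := a + ∫ τ in Ioo 0 s, k τ with hS
  have hS0 : 0 ≤ S := by
    have : 0 ≤ ∫ τ in Ioo 0 s, k τ := setIntegral_nonneg measurableSet_Ioo hk0
    positivity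
  -- Since `ζ` need not be smooth or compactly supported, it is replaced by a test function within
  -- `ε` in `L²`. The error is measured in unweighted norms, collected in `D`; this is the role of
  -- the bound `ν`.
  have hmain : ∀ ε : ℝ, 0 < ε → N * N ≤ N * S + ε * D := by
    intro ε hε
    obtain ⟨ψ, hc, hψ, hclose⟩ := hζ.exist_eLpNorm_sub_le (by norm_num) (by norm_num) hε
    have hψm := memLp_of_contDiff hψ hc
    have hdiff : ∀ z : R3 → ℂ, MemLp z 2 volume →
        ‖(∫ ξ, ((q ξ : ℂ) * star ((q ξ : ℂ) * y s ξ)) * z ξ) - ∫ ξ, ψ ξ * z ξ‖ ≤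
          ε * (eLpNorm z 2 volume).toReal := by
      intro z hz
      have h1 := norm_integral_mul_le (hζ.sub hψm) hz
      have h2 : (eLpNorm ((fun ξ => (q ξ : ℂ) * star ((q ξ : ℂ) * y s ξ)) - ψ) 2 volume).toReal ≤ ε :=
        ENNReal.toReal_le_of_le_ofReal hε.le hclose
      have hi1 : Integrable fun ξ => ((q ξ : ℂ) * star ((q ξ : ℂ) * y s ξ)) * z ξ :=
        hζ.integrable_mul hz
      have hi2 : Integrable fun ξ => ψ ξ * z ξ := hψm.integrable_mul hz
      rw [← integral_sub hi1 hi2]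
      refine le_trans (le_of_eq ?_)
        (h1.trans (mul_le_mul_of_nonneg_right h2 ENNReal.toReal_nonneg))
      congr 1
      refine integral_congr_ae (.of_forall fun ξ => ?_)
      simp only [Pi.sub_apply]
      ring
    have hψz : ∀ r : ℝ, 0 ≤ r → ∀ z : L2, ∀ c : ℝ, 0 ≤ c →
        eLpNorm (fun ξ => (q ξ : ℂ) * ((symbHeat r ξ : ℂ) * z ξ)) 2 volume ≤ ENNReal.ofReal c →
        ‖∫ ξ, ψ ξ * ((symbHeat r ξ : ℂ) * z ξ)‖ ≤ N * c + ε * ‖z‖ := by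
      intro r hr z c hc0 hcz
      have h1 := hdiff _ (hheat r hr z)
      have h2 := hζz r hr z c hc0 hcz
      have h3 := norm_sub_norm_le (∫ ξ, ψ ξ * ((symbHeat r ξ : ℂ) * z ξ))
        (∫ ξ, ((q ξ : ℂ) * star ((q ξ : ℂ) * y s ξ)) * ((symbHeat r ξ : ℂ) * z ξ))
      rw [norm_sub_rev] at h3
      have h4 := mul_le_mul_of_nonneg_left (hheat_le r hr z) hε.le
      linarith
    have hduh := h.norm_integral_le hy hs hψ hc (k := fun τ => N * k τ + ε * ν τ)
      ((hk.const_mul N).add (hν.const_mul ε)) fun τ hτ =>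
        (hψz _ (by linarith [hτ.2]) _ _ (hk0 τ hτ) (hle τ hτ)).trans
          (by gcongr; exact hn τ hτ)
    have h0 := hψz s hs.1.le (y 0) a ha hA
    have hys := hdiff _ (Lp.memLp (y s))
    rw [← Lp.norm_def] at hys
    have h3 := norm_sub_norm_le
      (∫ ξ, ((q ξ : ℂ) * star ((q ξ : ℂ) * y s ξ)) * y s ξ) (∫ ξ, ψ ξ * y s ξ)
    rw [hself] at h3
    rw [integral_add (hk.const_mul N) (hν.const_mul ε), integral_const_mul, integral_const_mul]
      at hduh
    rw [hS, hD]
    linarith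
  have hle2 : N * N ≤ N * S := by
    refine le_of_forall_pos_le_add fun δ hδ => ?_
    have hD1 : 0 < |D| + 1 := by positivity
    refine (hmain (δ / (|D| + 1)) (by positivity)).trans ?_
    gcongr
    rw [div_mul_eq_mul_div, div_le_iff₀ hD1]
    nlinarith [le_abs_self D]
  have hNS : N ≤ S := by
    rcases hN0.eq_or_lt with h0 | h0
    · rw [← h0]; exact hS0
    · exact le_of_mul_le_mul_left hle2 h0
  rw [← ENNReal.ofReal_toReal hqy.eLpNorm_ne_top]
  exact ENNReal.ofReal_le_ofReal hNS

theorem eLpNorm_le_of_tendsto {f : ℕ → R3 → ℂ} {g : R3 → ℂ} {c : ℝ≥0∞}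
    (hf : ∀ j, AEStronglyMeasurable (f j) volume)
    (hlim : ∀ ξ, Tendsto (fun j => f j ξ) atTop (𝓝 (g ξ)))
    (hle : ∀ j, eLpNorm (f j) 2 volume ≤ c) : eLpNorm g 2 volume ≤ c :=
  (Lp.eLpNorm_lim_le_liminf_eLpNorm hf g (.of_forall hlim)).trans
    (liminf_le_of_frequently_le' (.of_forall hle))

/-- Duhamel's inequality for nonnegative multipliers. -/
theorem IsWeakHeatSolution.eLpNorm_le {T : ℝ} {y n : ℝ → L2}
    (h : IsWeakHeatSolution T y n) (hy : ContinuousOn y (Icc 0 T)) {ν : ℝ → ℝ} {s : ℝ}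
    (hs : s ∈ Ioc 0 T) (hν : IntegrableOn ν (Ioo 0 s)) (hn : ∀ τ ∈ Ioo 0 s, ‖n τ‖ ≤ ν τ)
    {q : R3 → ℝ} (hq : Measurable q) (hq0 : ∀ ξ, 0 ≤ q ξ) {a : ℝ} (ha : 0 ≤ a)
    {k : ℝ → ℝ} (hk : IntegrableOn k (Ioo 0 s)) (hk0 : ∀ τ ∈ Ioo 0 s, 0 ≤ k τ)
    (hA : eLpNorm (fun ξ => (q ξ : ℂ) * ((symbHeat s ξ : ℂ) * y 0 ξ)) 2 volume ≤ ENNReal.ofReal a)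
    (hle : ∀ τ ∈ Ioo 0 s, eLpNorm (fun ξ => (q ξ : ℂ) * ((symbHeat (s - τ) ξ : ℂ) * n τ ξ)) 2 volume
      ≤ ENNReal.ofReal (k τ)) :
    eLpNorm (fun ξ => (q ξ : ℂ) * y s ξ) 2 volume ≤
      ENNReal.ofReal (a + ∫ τ in Ioo 0 s, k τ) := by
  have hmin : ∀ (j : ℕ) (ξ : R3) (z : ℂ), ‖((min (q ξ) j : ℝ) : ℂ) * z‖ ≤ ‖(q ξ : ℂ) * z‖ := by
    intro j ξ z
    rw [norm_mul, norm_mul, Complex.norm_real, Complex.norm_real, Real.norm_eq_abs,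
      Real.norm_eq_abs, abs_of_nonneg (le_min (hq0 ξ) j.cast_nonneg), abs_of_nonneg (hq0 ξ)]
    exact mul_le_mul_of_nonneg_right (min_le_left _ _) (norm_nonneg _)
  have hqj : ∀ j : ℕ, Measurable fun ξ => min (q ξ) (j : ℝ) := fun j => hq.min measurable_const
  -- Truncate the multiplier to `min q j`, use the bounded case, and let `j → ∞` by Fatou.
  refine eLpNorm_le_of_tendsto (f := fun (j : ℕ) ξ => ((min (q ξ) j : ℝ) : ℂ) * y s ξ)
    (fun j => ?_) (fun ξ => ?_) fun j => ?_
  · exact (Complex.measurable_ofReal.comp (hqj j)).aestronglyMeasurable.mul (Lp.aestronglyMeasurable _)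
  · refine tendsto_const_nhds.congr' ?_
    filter_upwards [eventually_ge_atTop ⌈q ξ⌉₊] with j hj
    rw [min_eq_left ((Nat.le_ceil _).trans (by exact_mod_cast hj))]
  · refine h.eLpNorm_le_of_bounded hy hs hν hn (hqj j) (K := j) (fun ξ => ?_) ha hk hk0 ?_ ?_
    · rw [abs_of_nonneg (le_min (hq0 ξ) j.cast_nonneg)]
      exact min_le_right _ _
    · exact (eLpNorm_mono fun ξ => hmin j ξ _).trans hA
    · exact fun τ hτ => (eLpNorm_mono fun ξ => hmin j ξ _).trans (hle τ hτ)

/-! ### Scalar inequalities, singular time integrals and continuous induction -/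

/-- With `z = √r x` this is `z^p ≤ 1 + z² ≤ 2 e^{z²/2}`. The exponent keeps only half of the heat
decay; the other half is reserved for the growth of the Gevrey radius. -/
theorem rpow_mul_exp_neg_le {p r x : ℝ} (hp0 : 0 ≤ p) (hp2 : p ≤ 2) (hr : 0 < r) (hx : 0 ≤ x) :
    x ^ p * Real.exp (-r * x ^ 2 / 2) ≤ 2 * r ^ (-(p / 2)) := by
  have h1 : (r ^ (1 / 2 : ℝ) * x) ^ p ≤ 1 + r * x ^ 2 := by
    have hz : 0 ≤ r ^ (1 / 2 : ℝ) * x := by positivity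
    have hz2 : (r ^ (1 / 2 : ℝ) * x) ^ (2 : ℝ) = r * x ^ 2 := by
      rw [Real.mul_rpow (by positivity) hx, ← Real.rpow_mul hr.le]
      norm_num
    rcases le_total (r ^ (1 / 2 : ℝ) * x) 1 with h | h
    · have := Real.rpow_le_one hz h hp0
      have : 0 ≤ r * x ^ 2 := by positivity
      linarith
    · have := Real.rpow_le_rpow_of_exponent_le h hp2
      linarith
  have h2 : 1 + r * x ^ 2 ≤ 2 * Real.exp (r * x ^ 2 / 2) := by
    have := Real.add_one_le_exp (r * x ^ 2 / 2)
    linarith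
  rw [Real.mul_rpow (by positivity) hx, ← Real.rpow_mul hr.le] at h1
  have h3 : r ^ (1 / 2 * p) * x ^ p ≤ 2 * Real.exp (r * x ^ 2 / 2) := h1.trans h2
  have h4 : x ^ p ≤ r ^ (-(p / 2)) * (2 * Real.exp (r * x ^ 2 / 2)) := by
    have h5 := mul_le_mul_of_nonneg_left h3 (by positivity : 0 ≤ r ^ (-(p / 2)))
    rw [← mul_assoc, ← Real.rpow_add hr] at h5
    have : -(p / 2) + 1 / 2 * p = 0 := by ring
    rwa [this, Real.rpow_zero, one_mul] at h5
  calc x ^ p * Real.exp (-r * x ^ 2 / 2)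
      ≤ r ^ (-(p / 2)) * (2 * Real.exp (r * x ^ 2 / 2)) * Real.exp (-r * x ^ 2 / 2) := by gcongr
    _ = 2 * r ^ (-(p / 2)) * (Real.exp (r * x ^ 2 / 2) * Real.exp (-r * x ^ 2 / 2)) := by ring
    _ = _ := by
      rw [← Real.exp_add]
      simp [neg_div]

/-- Trades exponential decay for the small factor `μ^{-1/8}`. The exponent `1/8` worsens the
singularity `(s-τ)^{-5/8}` only to `(s-τ)^{-3/4}`, which is still integrable. -/
theorem exp_neg_mul_le {μ x : ℝ} (hμ : 0 < μ) (hx : 0 < x) :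
    Real.exp (-(μ * x)) ≤ μ ^ (-(1 / 8) : ℝ) * x ^ (-(1 / 8) : ℝ) := by
  rw [← Real.mul_rpow hμ.le hx.le]
  have hz : 0 < μ * x := by positivity
  have h := Real.add_one_le_exp (μ * x)
  rw [Real.rpow_neg hz.le, Real.exp_neg]
  refine inv_anti₀ (by positivity) ?_
  rcases le_total (μ * x) 1 with h1 | h1
  · have := Real.rpow_le_one hz.le h1 (by norm_num : (0 : ℝ) ≤ 1 / 8)
    linarith
  · have := Real.rpow_le_rpow_of_exponent_le h1 (by norm_num : (1 / 8 : ℝ) ≤ 1)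
    rw [Real.rpow_one] at this
    linarith

/-- A bound for Euler's beta integral on `]0,s[`. -/
theorem exists_integral_beta_le {a b : ℝ} (ha0 : 0 ≤ a) (ha : a < 1) (hb0 : 0 ≤ b) (hb : b < 1) :
    ∃ β : ℝ, 0 ≤ β ∧ ∀ s : ℝ, 0 < s →
      IntegrableOn (fun τ => (s - τ) ^ (-a) * τ ^ (-b)) (Ioo 0 s) ∧
      ∫ τ in Ioo 0 s, (s - τ) ^ (-a) * τ ^ (-b) ≤ β * s ^ (1 - a - b) := by
  have ha' : 0 < 1 - a := by linarith
  have hb' : 0 < 1 - b := by linarith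
  refine ⟨(1 / 2) ^ (-a) / (1 - b) + (1 / 2) ^ (-b) / (1 - a), by positivity, fun s hs => ?_⟩
  have hI1 : IntervalIntegrable (fun τ : ℝ => τ ^ (-b)) volume 0 s :=
    intervalIntegral.intervalIntegrable_rpow' (by linarith)
  have hI2 : IntervalIntegrable (fun τ : ℝ => (s - τ) ^ (-a)) volume 0 s := by
    have := (intervalIntegral.intervalIntegrable_rpow' (a := 0) (b := s) (r := -a)
      (by linarith)).comp_sub_left s
    simpa using this.symm
  have hV1 : ∫ τ in (0 : ℝ)..s, τ ^ (-b) = s ^ (1 - b) / (1 - b) := by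
    rw [integral_rpow (Or.inl (by linarith)), show -b + 1 = 1 - b by ring,
      Real.zero_rpow hb'.ne', sub_zero]
  have hV2 : ∫ τ in (0 : ℝ)..s, (s - τ) ^ (-a) = s ^ (1 - a) / (1 - a) := by
    rw [intervalIntegral.integral_comp_sub_left (fun τ => τ ^ (-a)) s, sub_self, sub_zero,
      integral_rpow (Or.inl (by linarith)), show -a + 1 = 1 - a by ring,
      Real.zero_rpow ha'.ne', sub_zero]
  -- On each half of the interval one of the two factors is bounded by its value at `s/2`.
  set D : ℝ → ℝ := fun τ => (s / 2) ^ (-a) * τ ^ (-b) + (s / 2) ^ (-b) * (s - τ) ^ (-a) with hD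
  have hDI : IntervalIntegrable D volume 0 s := (hI1.const_mul _).add (hI2.const_mul _)
  have hDI' : IntegrableOn D (Ioo 0 s) := (intervalIntegrable_iff_integrableOn_Ioo_of_le hs.le).1 hDI
  have hDV : ∫ τ in Ioo 0 s, D τ = (s / 2) ^ (-a) * (s ^ (1 - b) / (1 - b)) +
      (s / 2) ^ (-b) * (s ^ (1 - a) / (1 - a)) := by
    rw [← integral_Ioc_eq_integral_Ioo, ← intervalIntegral.integral_of_le hs.le,
      intervalIntegral.integral_add (hI1.const_mul _) (hI2.const_mul _),
      intervalIntegral.integral_const_mul, intervalIntegral.integral_const_mul, hV1, hV2]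
  have hle : ∀ τ ∈ Ioo 0 s, (s - τ) ^ (-a) * τ ^ (-b) ≤ D τ := by
    intro τ hτ
    have h1 : 0 < s - τ := by linarith [hτ.2]
    have h2 := hτ.1
    rcases le_total τ (s / 2) with h | h
    · have h3 : (s - τ) ^ (-a) ≤ (s / 2) ^ (-a) :=
        Real.rpow_le_rpow_of_nonpos (by positivity) (by linarith) (by linarith)
      have h4 : 0 ≤ (s / 2) ^ (-b) * (s - τ) ^ (-a) := by positivity
      have h5 := mul_le_mul_of_nonneg_right h3 (by positivity : 0 ≤ τ ^ (-b))
      simp only [hD]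
      linarith
    · have h3 : τ ^ (-b) ≤ (s / 2) ^ (-b) :=
        Real.rpow_le_rpow_of_nonpos (by positivity) h (by linarith)
      have h4 : 0 ≤ (s / 2) ^ (-a) * τ ^ (-b) := by positivity
      have h5 := mul_le_mul_of_nonneg_right h3 (by positivity : 0 ≤ (s - τ) ^ (-a))
      simp only [hD]
      linarith
  have hint : IntegrableOn (fun τ => (s - τ) ^ (-a) * τ ^ (-b)) (Ioo 0 s) := by
    refine Integrable.mono' hDI' (by fun_prop) ?_
    filter_upwards [ae_restrict_mem measurableSet_Ioo] with τ hτ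
    have h1 : 0 < s - τ := by linarith [hτ.2]
    have h2 := hτ.1
    rw [Real.norm_of_nonneg (by positivity)]
    exact hle τ hτ
  refine ⟨hint, (setIntegral_mono_on hint hDI' measurableSet_Ioo hle).trans (le_of_eq ?_)⟩
  rw [hDV, div_eq_mul_one_div s 2, Real.mul_rpow hs.le (by norm_num),
    Real.mul_rpow hs.le (by norm_num)]
  have e1 : s ^ (-a) * s ^ (1 - b) = s ^ (1 - a - b) := by rw [← Real.rpow_add hs]; congr 1; ring
  have e2 : s ^ (-b) * s ^ (1 - a) = s ^ (1 - a - b) := by rw [← Real.rpow_add hs]; congr 1; ring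
  rw [add_mul, ← e1]
  nth_rewrite 2 [e1]
  rw [← e2]
  ring

/-- The integral kernel of the bootstrap argument, for a Kato weight and an exponential weight. -/
theorem exists_integral_kernel_le :
    ∃ β : ℝ, 0 ≤ β ∧ ∀ κ B μ t s : ℝ, 0 ≤ κ → 0 ≤ B → 0 < μ → s ∈ Ioc 0 t →
      IntegrableOn (fun τ => (s - τ) ^ (-(5 / 8) : ℝ) * ((κ * τ ^ (-(3 / 8) : ℝ) + B) *
        (Real.exp (μ * τ) * τ ^ (-(3 / 8) : ℝ)))) (Ioo 0 s) ∧
      ∫ τ in Ioo 0 s, (s - τ) ^ (-(5 / 8) : ℝ) * ((κ * τ ^ (-(3 / 8) : ℝ) + B) *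
        (Real.exp (μ * τ) * τ ^ (-(3 / 8) : ℝ))) ≤
        (κ * β + B * μ ^ (-(1 / 8) : ℝ) * β * t ^ (1 / 4 : ℝ)) *
          (Real.exp (μ * s) * s ^ (-(3 / 8) : ℝ)) := by
  obtain ⟨β₁, h1, hβ₁⟩ := exists_integral_beta_le (a := 5 / 8) (b := 3 / 4) (by norm_num)
    (by norm_num) (by norm_num) (by norm_num)
  obtain ⟨β₂, h2, hβ₂⟩ := exists_integral_beta_le (a := 3 / 4) (b := 3 / 8) (by norm_num)
    (by norm_num) (by norm_num) (by norm_num)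
  refine ⟨max β₁ β₂, h1.trans (le_max_left _ _), fun κ B μ t s hκ hB hμ hs => ?_⟩
  obtain ⟨hi1, hv1⟩ := hβ₁ s hs.1
  obtain ⟨hi2, hv2⟩ := hβ₂ s hs.1
  -- The `κ` term is critical: its integral scales exactly like `s^{-3/8}`, so its only smallness is
  -- `κ`. The `B` term is subcritical, which leaves room to gain `μ^{-1/8}` from the exponential.
  set D : ℝ → ℝ := fun τ => κ * Real.exp (μ * s) * ((s - τ) ^ (-(5 / 8) : ℝ) * τ ^ (-(3 / 4) : ℝ)) +
    B * μ ^ (-(1 / 8) : ℝ) * Real.exp (μ * s) * ((s - τ) ^ (-(3 / 4) : ℝ) * τ ^ (-(3 / 8) : ℝ))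
    with hD
  have hDI : IntegrableOn D (Ioo 0 s) := (hi1.const_mul _).add (hi2.const_mul _)
  have hle : ∀ τ ∈ Ioo 0 s, (s - τ) ^ (-(5 / 8) : ℝ) * ((κ * τ ^ (-(3 / 8) : ℝ) + B) *
        (Real.exp (μ * τ) * τ ^ (-(3 / 8) : ℝ))) ≤ D τ := by
    intro τ hτ
    have h3 : 0 < s - τ := by linarith [hτ.2]
    have h4 := hτ.1
    have e1 : τ ^ (-(3 / 8) : ℝ) * τ ^ (-(3 / 8) : ℝ) = τ ^ (-(3 / 4) : ℝ) := by
      rw [← Real.rpow_add h4]; norm_num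
    have e2 : (s - τ) ^ (-(5 / 8) : ℝ) * (s - τ) ^ (-(1 / 8) : ℝ) = (s - τ) ^ (-(3 / 4) : ℝ) := by
      rw [← Real.rpow_add h3]; norm_num
    have e3 : Real.exp (μ * τ) = Real.exp (μ * s) * Real.exp (-(μ * (s - τ))) := by
      rw [← Real.exp_add]; congr 1; ring
    have i1 : Real.exp (μ * τ) ≤ Real.exp (μ * s) :=
      Real.exp_le_exp.2 (mul_le_mul_of_nonneg_left hτ.2.le hμ.le)
    have i2 : Real.exp (μ * τ) ≤
        Real.exp (μ * s) * (μ ^ (-(1 / 8) : ℝ) * (s - τ) ^ (-(1 / 8) : ℝ)) := by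
      rw [e3]
      exact mul_le_mul_of_nonneg_left (exp_neg_mul_le hμ h3) (Real.exp_pos _).le
    calc _ = κ * ((s - τ) ^ (-(5 / 8) : ℝ) * (τ ^ (-(3 / 8) : ℝ) * τ ^ (-(3 / 8) : ℝ))) *
            Real.exp (μ * τ) +
          B * ((s - τ) ^ (-(5 / 8) : ℝ) * τ ^ (-(3 / 8) : ℝ)) * Real.exp (μ * τ) := by ring
      _ ≤ κ * ((s - τ) ^ (-(5 / 8) : ℝ) * (τ ^ (-(3 / 8) : ℝ) * τ ^ (-(3 / 8) : ℝ))) *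
            Real.exp (μ * s) +
          B * ((s - τ) ^ (-(5 / 8) : ℝ) * τ ^ (-(3 / 8) : ℝ)) *
            (Real.exp (μ * s) * (μ ^ (-(1 / 8) : ℝ) * (s - τ) ^ (-(1 / 8) : ℝ))) := by gcongr
      _ = D τ := by
        simp only [hD]
        rw [e1, ← e2]
        ring
  have hint : IntegrableOn (fun τ => (s - τ) ^ (-(5 / 8) : ℝ) * ((κ * τ ^ (-(3 / 8) : ℝ) + B) *
        (Real.exp (μ * τ) * τ ^ (-(3 / 8) : ℝ)))) (Ioo 0 s) := by
    refine Integrable.mono' hDI (by fun_prop) ?_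
    filter_upwards [ae_restrict_mem measurableSet_Ioo] with τ hτ
    have h3 : 0 < s - τ := by linarith [hτ.2]
    have h4 := hτ.1
    rw [Real.norm_of_nonneg (by positivity)]
    exact hle τ hτ
  refine ⟨hint, (setIntegral_mono_on hint hDI measurableSet_Ioo hle).trans ?_⟩
  have hs0 := hs.1
  have ht0 : 0 < t := hs.1.trans_le hs.2
  have e1 : s ^ (1 - 5 / 8 - 3 / 4 : ℝ) = s ^ (-(3 / 8) : ℝ) := by norm_num
  have e2 : s ^ (1 - 3 / 4 - 3 / 8 : ℝ) ≤ t ^ (1 / 4 : ℝ) * s ^ (-(3 / 8) : ℝ) := by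
    rw [show (1 - 3 / 4 - 3 / 8 : ℝ) = 1 / 4 + -(3 / 8) by norm_num, Real.rpow_add hs0]
    gcongr
    exact hs.2
  simp only [hD]
  rw [integral_add (hi1.const_mul _) (hi2.const_mul _), integral_const_mul, integral_const_mul]
  calc _ ≤ κ * Real.exp (μ * s) * (max β₁ β₂ * s ^ (-(3 / 8) : ℝ)) +
        B * μ ^ (-(1 / 8) : ℝ) * Real.exp (μ * s) *
          (max β₁ β₂ * (t ^ (1 / 4 : ℝ) * s ^ (-(3 / 8) : ℝ))) := by
        gcongr
        · refine hv1.trans ?_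
          rw [e1]
          gcongr
          exact le_max_left _ _
        · refine hv2.trans ?_
          refine mul_le_mul (le_max_right _ _) e2 (by positivity) (h1.trans (le_max_left _ _))
    _ = _ := by ring

/-- Continuous induction on `]0,t]`. -/
theorem forall_Ioc_of_continuous_induction {t : ℝ} {p : ℝ → Prop}
    (hnear : ∃ ε > 0, ∀ τ ∈ Ioc 0 t, τ < ε → p τ)
    (hclosed : ∀ s ∈ Ioc 0 t, (∀ τ ∈ Ioo 0 s, p τ) → p s)
    (hopen : ∀ s ∈ Ioo 0 t, p s → ∀ᶠ τ in 𝓝[>] s, p τ) : ∀ s ∈ Ioc 0 t, p s := by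
  by_contra! hcon
  obtain ⟨s₁, hs₁, hps₁⟩ := hcon
  obtain ⟨ε, hε, hnear⟩ := hnear
  -- The infimum of the failure set is positive by `hnear`, is not a failure by `hclosed`, and then
  -- cannot be the infimum by `hopen`.
  set S : Set ℝ := {s | s ∈ Ioc 0 t ∧ ¬ p s} with hS
  have hbdd : BddBelow S := ⟨0, fun s hs => hs.1.1.le⟩
  have hne : S.Nonempty := ⟨s₁, hs₁, hps₁⟩
  have hσε : ε ≤ sInf S := le_csInf hne fun s hs => by
    by_contra! h
    exact hs.2 (hnear s hs.1 h)
  have hσs : sInf S ≤ s₁ := csInf_le hbdd ⟨hs₁, hps₁⟩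
  have hσ : sInf S ∈ Ioc 0 t := ⟨hε.trans_le hσε, hσs.trans hs₁.2⟩
  have hpσ : p (sInf S) := hclosed _ hσ fun τ hτ => by
    by_contra h
    exact absurd (csInf_le hbdd (⟨⟨hτ.1, hτ.2.le.trans hσ.2⟩, h⟩ : τ ∈ S)) (not_le.2 hτ.2)
  have hlt : sInf S < s₁ := lt_of_le_of_ne hσs fun h => hps₁ (h ▸ hpσ)
  have hev := hopen _ ⟨hσ.1, hlt.trans_le hs₁.2⟩ hpσ
  obtain ⟨d, hd, hsub⟩ := mem_nhdsGT_iff_exists_Ioo_subset.1 hev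
  obtain ⟨s, hs, hsd⟩ := exists_lt_of_csInf_lt hne hd
  rcases (csInf_le hbdd hs).eq_or_lt with h | h
  · exact hs.2 (h ▸ hpσ)
  · exact hs.2 (hsub ⟨h, hsd⟩)

/-! ### Gevrey norms and the estimate of the nonlinearity -/

/-- The truncated Gevrey weight `e^{λ min(|2πξ|, R)}`, which is submultiplicative. -/
def gevreyWeight (R l : ℝ) (ξ : R3) : ℝ := Real.exp (l * min (symbA ξ) R)

/-- The weight `|2πξ|^{5/4} e^{λ min(|2πξ|, R)}`. -/
def katoWeight (R l : ℝ) (ξ : R3) : ℝ := symbA ξ ^ (5 / 4 : ℝ) * gevreyWeight R l ξ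

/-- The norm of `A^{5/4} e^{λ min(A, R)} f`, up to equivalence. -/
def gevreyNorm (R l : ℝ) (f : L2Vec) : ℝ≥0∞ :=
  ∑ i, eLpNorm (fun ξ => (katoWeight R l ξ : ℂ) * (𝓕 (f i) : L2) ξ) 2 volume

/-- The convolution of `|F|` and `|2πξ| |G|`. -/
def absConvolution (F G : L2) (ξ : R3) : ℝ≥0∞ :=
  ∫⁻ η, ‖F (ξ - η)‖ₑ * (ENNReal.ofReal (symbA η) * ‖G η‖ₑ)

theorem measurable_gevreyWeight (R l : ℝ) : Measurable (gevreyWeight R l) := by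
  have := measurable_symbA
  unfold gevreyWeight
  fun_prop

theorem measurable_katoWeight (R l : ℝ) : Measurable (katoWeight R l) :=
  (measurable_symbA.pow_const _).mul (measurable_gevreyWeight R l)

theorem gevreyWeight_pos (R l : ℝ) (ξ : R3) : 0 < gevreyWeight R l ξ := Real.exp_pos _

theorem katoWeight_nonneg (R l : ℝ) (ξ : R3) : 0 ≤ katoWeight R l ξ :=
  mul_nonneg (Real.rpow_nonneg (symbA_nonneg ξ) _) (gevreyWeight_pos R l ξ).le

theorem symbA_le_add (ξ η : R3) : symbA ξ ≤ symbA (ξ - η) + symbA η := by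
  unfold symbA
  rw [← mul_add]
  gcongr
  simpa using norm_add_le (ξ - η) η

theorem norm_le_symbA (ξ : R3) : ‖ξ‖ ≤ symbA ξ := by
  unfold symbA
  have := Real.pi_gt_three
  nlinarith [norm_nonneg ξ]

/-- The truncation `x ↦ min x R` is increasing and subadditive on `[0, ∞[`, so the triangle
inequality for `|2πξ|` survives it. -/
theorem gevreyWeight_le_mul {R l : ℝ} (hR : 0 ≤ R) (hl : 0 ≤ l) (ξ η : R3) :
    gevreyWeight R l ξ ≤ gevreyWeight R l (ξ - η) * gevreyWeight R l η := by
  unfold gevreyWeight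
  rw [← Real.exp_add, ← mul_add]
  refine Real.exp_le_exp.2 (mul_le_mul_of_nonneg_left ?_ hl)
  have h1 := symbA_le_add ξ η
  have h2 := symbA_nonneg (ξ - η)
  have h3 := symbA_nonneg η
  rcases min_cases (symbA ξ) R with h | h <;> rcases min_cases (symbA (ξ - η)) R with h' | h' <;>
    rcases min_cases (symbA η) R with h'' | h'' <;> linarith

theorem measurable_absConvolution (F G : L2) : Measurable (absConvolution F G) := by
  have h1 := (Lp.stronglyMeasurable F).measurable
  have h2 := (Lp.stronglyMeasurable G).measurable
  have h3 := measurable_symbA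
  have : Measurable fun p : R3 × R3 => ‖F (p.1 - p.2)‖ₑ *
      (ENNReal.ofReal (symbA p.2) * ‖G p.2‖ₑ) := by fun_prop
  exact this.lintegral_prod_right' (ν := volume)

theorem eLpNorm_two_sq {α ε : Type*} [MeasurableSpace α] [TopologicalSpace ε] [ContinuousENorm ε]
    (f : α → ε) (μ : Measure α) : eLpNorm f 2 μ ^ 2 = ∫⁻ x, ‖f x‖ₑ ^ 2 ∂μ := by
  have := eLpNorm_nnreal_pow_eq_lintegral (f := f) (μ := μ) (p := 2) (by norm_num)
  simpa using this

/-- Submultiplicativity moves the weight inside the convolution onto both factors, and the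
unweighted estimate applies to the weighted functions. Hence the constant depends on neither `R` nor
`l`. -/
theorem exists_eLpNorm_absConvolution_le :
    ∃ C : ℝ≥0, ∀ R l : ℝ, 0 ≤ R → 0 ≤ l → ∀ F G : L2,
      eLpNorm (fun ξ => ENNReal.ofReal (gevreyWeight R l ξ) * absConvolution F G ξ) 2 volume ≤
        C * (eLpNorm (fun ξ => (katoWeight R l ξ : ℂ) * F ξ) 2 volume *
          eLpNorm (fun ξ => (katoWeight R l ξ : ℂ) * G ξ) 2 volume) := by
  obtain ⟨c, hc, h⟩ := exists_lintegral_convolution_sq_le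
  refine ⟨Real.toNNReal (2 * Real.pi * √c), fun R l hR hl F G => ?_⟩
  have hF := (Lp.stronglyMeasurable F).measurable
  have hG := (Lp.stronglyMeasurable G).measurable
  have hw := measurable_gevreyWeight R l
  have hkato : ∀ H : L2, ∫⁻ ζ, (ENNReal.ofReal (‖ζ‖ ^ (5 / 4 : ℝ)) *
      (ENNReal.ofReal (gevreyWeight R l ζ) * ‖H ζ‖ₑ)) ^ 2 ≤
      eLpNorm (fun ξ => (katoWeight R l ξ : ℂ) * H ξ) 2 volume ^ 2 := by
    intro H
    rw [eLpNorm_two_sq]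
    refine lintegral_mono fun ζ => pow_le_pow_left' ?_ 2
    rw [enorm_mul, ← mul_assoc, ← ENNReal.ofReal_mul (by positivity), ← ofReal_norm
      ((katoWeight R l ζ : ℂ)), Complex.norm_real, Real.norm_of_nonneg (katoWeight_nonneg R l ζ)]
    gcongr
    unfold katoWeight
    have := (gevreyWeight_pos R l ζ).le
    gcongr
    exact norm_le_symbA ζ
  have key := h (fun ζ => ENNReal.ofReal (gevreyWeight R l ζ) * ‖F ζ‖ₑ)
    (fun ζ => ENNReal.ofReal (gevreyWeight R l ζ) * ‖G ζ‖ₑ) (by fun_prop) (by fun_prop)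
  have hpt : ∀ ξ, ENNReal.ofReal (gevreyWeight R l ξ) * absConvolution F G ξ ≤
      ENNReal.ofReal (2 * Real.pi) * ∫⁻ η, ENNReal.ofReal (gevreyWeight R l (ξ - η)) *
        ‖F (ξ - η)‖ₑ * (ENNReal.ofReal ‖η‖ * (ENNReal.ofReal (gevreyWeight R l η) * ‖G η‖ₑ)) := by
    intro ξ
    unfold absConvolution
    rw [← lintegral_const_mul' _ _ ENNReal.ofReal_ne_top,
      ← lintegral_const_mul' _ _ ENNReal.ofReal_ne_top]
    refine lintegral_mono fun η => ?_
    have h1 := ENNReal.ofReal_le_ofReal (gevreyWeight_le_mul hR hl ξ η)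
    rw [ENNReal.ofReal_mul (gevreyWeight_pos R l _).le] at h1
    refine (mul_le_mul_left h1 _).trans (le_of_eq ?_)
    rw [symbA, ENNReal.ofReal_mul (by positivity)]
    ring
  refine (ENNReal.pow_le_pow_left_iff (n := 2) two_ne_zero).1 ?_
  rw [eLpNorm_two_sq]
  calc _ ≤ ∫⁻ ξ, (ENNReal.ofReal (2 * Real.pi) * ∫⁻ η, ENNReal.ofReal (gevreyWeight R l (ξ - η)) *
        ‖F (ξ - η)‖ₑ * (ENNReal.ofReal ‖η‖ * (ENNReal.ofReal (gevreyWeight R l η) * ‖G η‖ₑ))) ^ 2 :=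
        lintegral_mono fun ξ => pow_le_pow_left' (by rw [enorm_eq_self]; exact hpt ξ) 2
    _ ≤ ENNReal.ofReal (2 * Real.pi) ^ 2 * (ENNReal.ofReal c *
        (eLpNorm (fun ξ => (katoWeight R l ξ : ℂ) * F ξ) 2 volume ^ 2 *
          eLpNorm (fun ξ => (katoWeight R l ξ : ℂ) * G ξ) 2 volume ^ 2)) := by
        simp_rw [mul_pow (ENNReal.ofReal (2 * Real.pi))]
        rw [lintegral_const_mul' _ _ (by finiteness)]
        refine mul_le_mul_right (key.trans ?_) _
        gcongr
        · exact hkato F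
        · exact hkato G
    _ = _ := by
        rw [mul_pow, mul_pow, ← ENNReal.ofReal_coe_nnreal, Real.coe_toNNReal _ (by positivity),
          ENNReal.ofReal_mul (p := 2 * Real.pi) (by positivity), mul_pow,
          ← ENNReal.ofReal_pow (p := √c) (by positivity), Real.sq_sqrt hc]
        ring

/-- From `P = P* = P²`, the diagonal entries satisfy `P_ii = ∑ₖ |P_ik|²`. Thus `|P_ii|² ≤ |P_ii|`,
so `|P_ii| ≤ 1`, and every `|P_ik|² ≤ |P_ii|`. -/
theorem FiberedProjection.norm_symbol_le_one (P : FiberedProjection) :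
    ∀ᵐ ξ, ∀ i k, ‖P.symbol ξ i k‖ ≤ 1 := by
  filter_upwards [P.isHermitian, P.idempotent] with ξ h1 h2 i k
  have h3 : ∀ i, (P.symbol ξ i i) = ((∑ k, ‖P.symbol ξ i k‖ ^ 2 : ℝ) : ℂ) := by
    intro i
    have h4 := congrFun (congrFun h2 i) i
    rw [Matrix.mul_apply] at h4
    rw [← h4]
    push_cast
    refine Finset.sum_congr rfl fun k _ => ?_
    rw [← h1.apply k i, RCLike.star_def, Complex.mul_conj']
  have h5 : ∀ k, ‖P.symbol ξ i k‖ ^ 2 ≤ ‖P.symbol ξ i i‖ := by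
    intro k
    rw [h3 i, Complex.norm_real, Real.norm_of_nonneg (by positivity)]
    exact Finset.single_le_sum (f := fun k => ‖P.symbol ξ i k‖ ^ 2) (fun _ _ => by positivity)
      (Finset.mem_univ k)
  have h6 := h5 i
  have h7 := h5 k
  have h8 : ‖P.symbol ξ i i‖ ≤ 1 := by
    by_contra! h
    nlinarith
  by_contra! h
  nlinarith

theorem IsPartial.sub {j : Fin 3} {f f' g g' : L2} (h : IsPartial j f g) (h' : IsPartial j f' g') :
    IsPartial j (f' - f) (g' - g) := by
  unfold IsPartial at *
  have e1 : (𝓕 (g' - g) : L2) = 𝓕 g' - 𝓕 g := map_sub (Lp.fourierTransformₗᵢ R3 ℂ) g' g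
  have e2 : (𝓕 (f' - f) : L2) = 𝓕 f' - 𝓕 f := map_sub (Lp.fourierTransformₗᵢ R3 ℂ) f' f
  rw [e1, e2]
  filter_upwards [h, h', Lp.coeFn_sub (𝓕 g' : L2) (𝓕 g), Lp.coeFn_sub (𝓕 f' : L2) (𝓕 f)]
    with ξ h1 h2 h3 h4
  rw [h3, h4, Pi.sub_apply, Pi.sub_apply, h1, h2]
  ring

theorem IsPartial.enorm_le {j : Fin 3} {f g : L2} (h : IsPartial j f g) :
    ∀ᵐ ξ, ‖(𝓕 g : L2) ξ‖ₑ ≤ ENNReal.ofReal (symbA ξ) * ‖(𝓕 f : L2) ξ‖ₑ := by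
  filter_upwards [h] with ξ hξ
  rw [hξ, enorm_mul]
  gcongr
  rw [← ofReal_norm]
  refine ENNReal.ofReal_le_ofReal ?_
  have := PiLp.norm_apply_le ξ j
  simp only [norm_mul, Complex.norm_real, Complex.norm_I, mul_one, RCLike.norm_ofNat, symbA]
  rw [Real.norm_of_nonneg Real.pi_pos.le]
  gcongr

theorem enorm_integral_le_absConvolution {j : Fin 3} {f g D : L2} (h : IsPartial j g D) (ξ : R3) :
    ‖∫ η, (𝓕 f : L2) (ξ - η) * (𝓕 D : L2) η‖ₑ ≤ absConvolution (𝓕 f) (𝓕 g) ξ := by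
  refine (enorm_integral_le_lintegral_enorm _).trans (lintegral_mono_ae ?_)
  filter_upwards [h.enorm_le] with η hη
  rw [enorm_mul]
  gcongr

theorem fourier_sub_L2 (f g : L2) : (𝓕 (f - g) : L2) = 𝓕 f - 𝓕 g :=
  map_sub (Lp.fourierTransformₗᵢ R3 ℂ) f g

theorem eLpNorm_fourier_le_gevreyNorm (R l : ℝ) (f : L2Vec) (i : Fin 3) :
    eLpNorm (fun ξ => (katoWeight R l ξ : ℂ) * (𝓕 (f i) : L2) ξ) 2 volume ≤ gevreyNorm R l f :=
  Finset.single_le_sum (f := fun i => eLpNorm (fun ξ => (katoWeight R l ξ : ℂ) *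
    (𝓕 (f i) : L2) ξ) 2 volume) (fun _ _ => zero_le) (Finset.mem_univ i)

theorem eLpNorm_fourier_smul (R l : ℝ) (c : ℂ) (f : L2) :
    eLpNorm (fun ξ => (katoWeight R l ξ : ℂ) * (𝓕 (c • f) : L2) ξ) 2 volume =
      ‖c‖ₑ * eLpNorm (fun ξ => (katoWeight R l ξ : ℂ) * (𝓕 f : L2) ξ) 2 volume := by
  rw [← eLpNorm_const_smul, FourierTransform.fourier_smul]
  refine eLpNorm_congr_ae ?_
  filter_upwards [Lp.coeFn_smul c (𝓕 f : L2)] with ξ hξ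
  rw [hξ]
  simp only [Pi.smul_apply, smul_eq_mul]
  ring

theorem aestronglyMeasurable_ofReal_mul {b : R3 → ℝ} (hb : Measurable b) (f : L2) :
    AEStronglyMeasurable (fun ξ => (b ξ : ℂ) * f ξ) volume :=
  (Complex.measurable_ofReal.comp hb).aestronglyMeasurable.mul (Lp.aestronglyMeasurable f)

theorem gevreyNorm_le_add (R l : ℝ) (f g : L2Vec) :
    gevreyNorm R l g ≤ gevreyNorm R l f + gevreyNorm R l (g - f) := by
  unfold gevreyNorm
  rw [← Finset.sum_add_distrib]
  refine Finset.sum_le_sum fun i _ => ?_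
  refine le_trans (le_of_eq ?_) (eLpNorm_add_le
    (aestronglyMeasurable_ofReal_mul (measurable_katoWeight R l) _)
    (aestronglyMeasurable_ofReal_mul (measurable_katoWeight R l) _) (by norm_num))
  refine eLpNorm_congr_ae ?_
  rw [PiLp.sub_apply, fourier_sub_L2]
  filter_upwards [Lp.coeFn_sub (𝓕 (g i) : L2) (𝓕 (f i))] with ξ hξ
  rw [Pi.add_apply, hξ, Pi.sub_apply]
  ring

/-- The difference of two convection terms, expanded into products. -/
theorem convection_sub_ae_eq {M : Matrix (Fin 3) (Fin 3) ℝ} {f g N N' : L2Vec}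
    {D D' : Fin 3 → Fin 3 → L2} {i : Fin 3}
    (h : (N i : R3 → ℂ) =ᵐ[volume]
      fun x => ∑ j, (∑ k, (M j k : ℂ) * (f k : R3 → ℂ) x) * (D i j : R3 → ℂ) x)
    (h' : (N' i : R3 → ℂ) =ᵐ[volume]
      fun x => ∑ j, (∑ k, (M j k : ℂ) * (g k : R3 → ℂ) x) * (D' i j : R3 → ℂ) x) :
    ((N' i - N i : L2) : R3 → ℂ) =ᵐ[volume] fun x => ∑ p : Bool × Fin 3 × Fin 3,
      (((M p.2.1 p.2.2 : ℂ) • (if p.1 then g p.2.2 else g p.2.2 - f p.2.2) : L2) : R3 → ℂ) x *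
        ((if p.1 then D' i p.2.1 - D i p.2.1 else D i p.2.1 : L2) : R3 → ℂ) x := by
  have h1 : ∀ᵐ x, ∀ j k, (((M j k : ℂ) • g k : L2) : R3 → ℂ) x = M j k * (g k : R3 → ℂ) x :=
    ae_all_iff.2 fun j => ae_all_iff.2 fun k => Lp.coeFn_smul (M j k : ℂ) (g k)
  have h2 : ∀ᵐ x, ∀ j k, (((M j k : ℂ) • (g k - f k) : L2) : R3 → ℂ) x =
      M j k * ((g k - f k : L2) : R3 → ℂ) x :=
    ae_all_iff.2 fun j => ae_all_iff.2 fun k => Lp.coeFn_smul (M j k : ℂ) (g k - f k)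
  have h3 : ∀ᵐ x, ∀ k, ((g k - f k : L2) : R3 → ℂ) x = (g k : R3 → ℂ) x - (f k : R3 → ℂ) x :=
    ae_all_iff.2 fun k => Lp.coeFn_sub (g k) (f k)
  have h4 : ∀ᵐ x, ∀ j, ((D' i j - D i j : L2) : R3 → ℂ) x =
      (D' i j : R3 → ℂ) x - (D i j : R3 → ℂ) x :=
    ae_all_iff.2 fun j => Lp.coeFn_sub (D' i j) (D i j)
  filter_upwards [h, h', h1, h2, h3, h4, Lp.coeFn_sub (N' i) (N i)] with x e e' e1 e2 e3 e4 e5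
  rw [e5, Pi.sub_apply, e, e']
  simp only [Fintype.sum_prod_type, Fintype.sum_bool, if_true, Bool.false_eq_true, if_false, e1, e2,
    e3, e4]
  rw [← Finset.sum_sub_distrib, ← Finset.sum_add_distrib]
  refine Finset.sum_congr rfl fun j _ => ?_
  rw [← Finset.sum_add_distrib, Finset.sum_mul, Finset.sum_mul, ← Finset.sum_sub_distrib]
  refine Finset.sum_congr rfl fun k _ => ?_
  ring

/-- Bilinearity gives `(Mg·∇)g - (Mf·∇)f = (Mg·∇)(g-f) + (M(g-f)·∇)f`; the Boolean index selects one
of the two terms. Each has a factor `g - f`, and the convolution estimate applies to each product.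
-/
theorem exists_eLpNorm_convection_sub_le (M : Matrix (Fin 3) (Fin 3) ℝ) :
    ∃ C : ℝ≥0, ∀ f g N N' : L2Vec, IsConvection M f N → IsConvection M g N' →
      ∀ R l : ℝ, 0 ≤ R → 0 ≤ l → ∀ i,
        eLpNorm (fun ξ => (gevreyWeight R l ξ : ℂ) * (𝓕 (N' i - N i) : L2) ξ) 2 volume ≤
          C * ((gevreyNorm R l g + gevreyNorm R l f) * gevreyNorm R l (g - f)) := by
  obtain ⟨C, hC⟩ := exists_eLpNorm_absConvolution_le
  refine ⟨(∑ j, ∑ k, ‖M j k‖₊) * C, ?_⟩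
  rintro f g N N' ⟨D, hD, hN⟩ ⟨D', hD', hN'⟩ R l hR hl i
  have hF := fourier_sum_mul_ae_eq Finset.univ (N' i - N i)
    (fun p : Bool × Fin 3 × Fin 3 => (M p.2.1 p.2.2 : ℂ) •
      (if p.1 then g p.2.2 else g p.2.2 - f p.2.2))
    (fun p => if p.1 then D' i p.2.1 - D i p.2.1 else D i p.2.1)
    (convection_sub_ae_eq (hN i) (hN' i))
  set F : Bool × Fin 3 × Fin 3 → L2 := fun p => (M p.2.1 p.2.2 : ℂ) •
      (if p.1 then g p.2.2 else g p.2.2 - f p.2.2)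
  set G : Bool × Fin 3 × Fin 3 → L2 := fun p => if p.1 then g i - f i else f i
  have hG : ∀ p : Bool × Fin 3 × Fin 3, IsPartial p.2.1 (G p)
      (if p.1 then D' i p.2.1 - D i p.2.1 else D i p.2.1) := by
    rintro ⟨b, j, k⟩
    cases b
    · simpa [G] using hD i j
    · simpa [G] using (hD i j).sub (hD' i j)
  calc _ ≤ eLpNorm (∑ p, fun ξ => ENNReal.ofReal (gevreyWeight R l ξ) *
        absConvolution (𝓕 (F p)) (𝓕 (G p)) ξ) 2 volume := by
        refine eLpNorm_mono_enorm_ae ?_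
        filter_upwards [hF] with ξ hξ
        rw [enorm_mul, hξ, enorm_eq_self, Finset.sum_apply, ← Finset.mul_sum, ← ofReal_norm,
          Complex.norm_real, Real.norm_of_nonneg (gevreyWeight_pos R l ξ).le]
        gcongr
        refine (enorm_sum_le _ _).trans (Finset.sum_le_sum fun p _ => ?_)
        exact enorm_integral_le_absConvolution (hG p) ξ
    _ ≤ ∑ p, eLpNorm (fun ξ => ENNReal.ofReal (gevreyWeight R l ξ) *
        absConvolution (𝓕 (F p)) (𝓕 (G p)) ξ) 2 volume := by
        refine eLpNorm_sum_le (fun p _ => ?_) (by norm_num)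
        exact (((measurable_gevreyWeight R l).ennreal_ofReal).mul
          (measurable_absConvolution _ _)).aestronglyMeasurable
    _ ≤ ∑ p : Bool × Fin 3 × Fin 3, C * ‖M p.2.1 p.2.2‖ₑ *
          ((if p.1 then gevreyNorm R l g else gevreyNorm R l f) * gevreyNorm R l (g - f)) := by
        refine Finset.sum_le_sum fun p _ => (hC R l hR hl _ _).trans ?_
        rw [mul_assoc (C : ℝ≥0∞)]
        refine mul_le_mul_right ?_ _
        obtain ⟨b, j, k⟩ := p
        simp only [F, G]
        have hM : ‖((M j k : ℝ) : ℂ)‖ₑ = ‖M j k‖ₑ := by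
          rw [← ofReal_norm, Complex.norm_real, ofReal_norm]
        rw [eLpNorm_fourier_smul, mul_assoc, hM]
        refine mul_le_mul_right ?_ _
        cases b
        · simp only [Bool.false_eq_true, if_false]
          rw [mul_comm]
          exact mul_le_mul' (eLpNorm_fourier_le_gevreyNorm R l f i)
            (eLpNorm_fourier_le_gevreyNorm R l (g - f) k)
        · simp only [if_true]
          exact mul_le_mul' (eLpNorm_fourier_le_gevreyNorm R l g k)
            (eLpNorm_fourier_le_gevreyNorm R l (g - f) i)
    _ = _ := by
        simp only [Fintype.sum_prod_type, Fintype.sum_bool, if_true, Bool.false_eq_true, if_false]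
        rw [← Finset.sum_add_distrib]
        push_cast
        rw [Finset.sum_mul, Finset.sum_mul]
        refine Finset.sum_congr rfl fun j _ => ?_
        rw [← Finset.sum_add_distrib, Finset.sum_mul, Finset.sum_mul]
        refine Finset.sum_congr rfl fun k _ => ?_
        rw [enorm_eq_nnnorm]
        ring

theorem FiberedProjection.Maps.eLpNorm_sub_le {P : FiberedProjection} {f f' g g' : L2Vec}
    (h : P.Maps f g) (h' : P.Maps f' g') {b : R3 → ℝ} (hb : Measurable b) (i : Fin 3) :
    eLpNorm (fun ξ => (b ξ : ℂ) * (𝓕 (g' i - g i) : L2) ξ) 2 volume ≤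
      ∑ k, eLpNorm (fun ξ => (b ξ : ℂ) * (𝓕 (f' k - f k) : L2) ξ) 2 volume := by
  have hk : ∀ᵐ ξ, ∀ k, (𝓕 (f' k - f k) : L2) ξ = (𝓕 (f' k) : L2) ξ - (𝓕 (f k) : L2) ξ :=
    ae_all_iff.2 fun k => by
      rw [fourier_sub_L2]
      exact Lp.coeFn_sub _ _
  have hm : ∀ k, AEStronglyMeasurable
      (fun ξ => P.symbol ξ i k * ((b ξ : ℂ) * (𝓕 (f' k - f k) : L2) ξ)) volume := fun k =>
    (P.measurable_symbol i k).aestronglyMeasurable.mul (aestronglyMeasurable_ofReal_mul hb _)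
  calc _ = eLpNorm (∑ k, fun ξ => P.symbol ξ i k * ((b ξ : ℂ) * (𝓕 (f' k - f k) : L2) ξ)) 2
        volume := by
        refine eLpNorm_congr_ae ?_
        rw [fourier_sub_L2]
        filter_upwards [h i, h' i, hk, Lp.coeFn_sub (𝓕 (g' i) : L2) (𝓕 (g i))] with ξ h1 h2 h3 h4
        rw [h4, Pi.sub_apply, h1, h2, ← Finset.sum_sub_distrib, Finset.mul_sum, Finset.sum_apply]
        refine Finset.sum_congr rfl fun k _ => ?_
        rw [h3]
        ring
    _ ≤ ∑ k, eLpNorm (fun ξ => P.symbol ξ i k * ((b ξ : ℂ) * (𝓕 (f' k - f k) : L2) ξ)) 2 volume :=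
        eLpNorm_sum_le (fun k _ => hm k) (by norm_num)
    _ ≤ _ := by
        refine Finset.sum_le_sum fun k _ => eLpNorm_mono_ae ?_
        filter_upwards [P.norm_symbol_le_one] with ξ hξ
        rw [norm_mul]
        exact mul_le_of_le_one_left (norm_nonneg _) (hξ i k)

/-- The basic estimate of the nonlinearity: the difference of `P(Mg·∇)g` and `P(Mf·∇)f`. -/
theorem exists_eLpNorm_nonlinearity_sub_le (M : Matrix (Fin 3) (Fin 3) ℝ) :
    ∃ C : ℝ≥0, ∀ (P : FiberedProjection) (f g N N' PN PN' : L2Vec), IsConvection M f N →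
      IsConvection M g N' → P.Maps N PN → P.Maps N' PN' → ∀ R l : ℝ, 0 ≤ R → 0 ≤ l → ∀ i,
        eLpNorm (fun ξ => (gevreyWeight R l ξ : ℂ) * (𝓕 (PN' i - PN i) : L2) ξ) 2 volume ≤
          C * ((2 * gevreyNorm R l f + gevreyNorm R l (g - f)) * gevreyNorm R l (g - f)) := by
  obtain ⟨C, hC⟩ := exists_eLpNorm_convection_sub_le M
  refine ⟨3 * C, fun P f g N N' PN PN' hN hN' hP hP' R l hR hl i => ?_⟩
  refine (hP.eLpNorm_sub_le hP' (measurable_gevreyWeight R l) i).trans ?_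
  refine (Finset.sum_le_sum fun k _ => hC f g N N' hN hN' R l hR hl k).trans ?_
  rw [Finset.sum_const, Finset.card_univ, Fintype.card_fin, nsmul_eq_mul]
  push_cast
  rw [mul_assoc]
  -- The norm of `g` is eliminated, so that the bound involves only the reference function and the
  -- difference.
  have h : gevreyNorm R l g + gevreyNorm R l f ≤ 2 * gevreyNorm R l f + gevreyNorm R l (g - f) := by
    refine (add_le_add_left (gevreyNorm_le_add R l f g) _).trans (le_of_eq ?_)
    ring
  exact mul_le_mul_right (mul_le_mul_right (mul_le_mul_left h _) _) _

/-! ### Strong solutions on the Fourier side -/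

/-- Test the equation with `φ = 𝓕ψ` and move the transform onto the solution; the Laplacian becomes
multiplication by `-|2πξ|²`. -/
theorem IsStrongSolution.isWeakHeatSolution_of_equation {r T : ℝ} {u : ℝ → SobolevVec r}
    {PN : ℝ → L2Vec} {i : Fin 3}
    (h : ∀ φ : 𝓢(R3, ℂ), ∀ t ∈ Ioc 0 T, HasDerivWithinAt (fun s => pairing ((u s).toL2Vec i) φ)
      (pairing ((u t).toL2Vec i) (Δ φ) - pairing (PN t i) φ) (Ioc 0 T) t) :
    IsWeakHeatSolution T (fun s => 𝓕 ((u s).toL2Vec i)) (fun s => 𝓕 (PN s i)) := by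
  intro ψ hψ hc t ht
  let ψS : 𝓢(R3, ℂ) := hc.toSchwartzMap hψ
  have hd := (h (𝓕 ψS) t ⟨ht.1, ht.2.le⟩).hasDerivAt (Ioc_mem_nhds ht.1 ht.2)
  rw [laplacian_fourier] at hd
  simp only [pairing_fourier] at hd
  have e : ∀ ξ, (-(SchwartzMap.smulLeftCLM ℂ (fun ξ : R3 => symbA ξ ^ 2) ψS)) ξ =
      -(((symbA ξ ^ 2 : ℝ) : ℂ) * ψ ξ) := by
    intro ξ
    rw [neg_apply, SchwartzMap.smulLeftCLM_apply_apply symbA_sq_hasTemperateGrowth,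
      Complex.real_smul]
    rfl
  simp only [e, neg_mul, integral_neg] at hd
  exact hd

theorem IsWeakHeatSolution.sub {T : ℝ} {y n y' n' : ℝ → L2} (h : IsWeakHeatSolution T y n)
    (h' : IsWeakHeatSolution T y' n') :
    IsWeakHeatSolution T (fun s => y' s - y s) (fun s => n' s - n s) := by
  intro ψ hψ hc t ht
  have hd := h ψ hψ hc t ht
  have hd' := h' ψ hψ hc t ht
  have hm := memLp_of_contDiff hψ hc
  have hm' : MemLp (fun ξ => ((symbA ξ ^ 2 : ℝ) : ℂ) * ψ ξ) 2 volume :=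
    memLp_of_contDiff (contDiff_ofReal_mul contDiff_symbA_sq hψ) hc.mul_left
  simp only [← bilinL2_toLp hm, ← bilinL2_toLp hm'] at hd hd' ⊢
  simp only [map_sub]
  refine (hd'.sub hd).congr_deriv ?_
  ring

theorem one_le_symbBessel {r : ℝ} (hr : 0 ≤ r) (ξ : R3) : 1 ≤ symbBessel r ξ := by
  unfold symbBessel
  exact Real.one_le_rpow (by nlinarith [sq_nonneg (symbA ξ)]) (by positivity)

theorem Sobolev.norm_eq {r : ℝ} (f : Sobolev r) : ‖f‖ = ‖Sobolev.bessel f‖ := rfl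

theorem Sobolev.enorm_eq {r : ℝ} (f : Sobolev r) :
    eLpNorm (fun ξ => (symbBessel r ξ : ℂ) * (𝓕 (Sobolev.toL2 f) : L2) ξ) 2 volume =
      ENNReal.ofReal ‖f‖ := by
  rw [Sobolev.norm_eq]
  change _ = ENNReal.ofReal ‖(Sobolev.memLp_bessel f).toLp _‖
  rw [Lp.norm_toLp, ENNReal.ofReal_toReal (Sobolev.memLp_bessel f).eLpNorm_ne_top]

theorem Sobolev.norm_toL2_le {r : ℝ} (hr : 0 ≤ r) (f : Sobolev r) : ‖Sobolev.toL2 f‖ ≤ ‖f‖ := by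
  rw [← Lp.norm_fourier_eq, Lp.norm_def]
  refine ENNReal.toReal_le_of_le_ofReal (norm_nonneg _) ?_
  rw [← Sobolev.enorm_eq]
  refine eLpNorm_mono fun ξ => ?_
  rw [norm_mul, Complex.norm_real, Real.norm_of_nonneg (zero_le_one.trans (one_le_symbBessel hr ξ))]
  exact le_mul_of_one_le_left (norm_nonneg _) (one_le_symbBessel hr ξ)

theorem Sobolev.continuous_toL2 {r : ℝ} (hr : 0 ≤ r) :
    Continuous (Sobolev.toL2 : Sobolev r → L2) :=
  AddMonoidHomClass.continuous_of_bound (Sobolev.toL2 : Sobolev r →ₗ[ℂ] L2) 1 fun f => by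
    simpa using Sobolev.norm_toL2_le hr f

theorem SobolevVec.toL2Vec_sub {r : ℝ} (f g : SobolevVec r) :
    (f - g).toL2Vec = f.toL2Vec - g.toL2Vec := by
  ext1 i
  exact map_sub Sobolev.toL2 (f i) (g i)

theorem IsStrongSolution.continuousOn_fourier {M : Matrix (Fin 3) (Fin 3) ℝ} {P : FiberedProjection}
    {r T : ℝ} (hr : 0 ≤ r) {u : ℝ → SobolevVec r} (hu : IsStrongSolution M P r T u) (i : Fin 3) :
    ContinuousOn (fun s => (𝓕 ((u s).toL2Vec i) : L2)) (Icc 0 T) := by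
  have h1 : Continuous fun f : SobolevVec r => f i := PiLp.continuous_apply 2 _ i
  exact (FourierTransform.continuous_fourier (E := L2)).comp_continuousOn
    ((Sobolev.continuous_toL2 hr).comp_continuousOn (h1.comp_continuousOn hu.continuousOn))

theorem IsPowA.sub {s : ℝ} {f f' w w' : L2Vec} (h : IsPowA s f w) (h' : IsPowA s f' w') :
    IsPowA s (f' - f) (w' - w) := by
  intro i
  rw [PiLp.sub_apply, PiLp.sub_apply, fourier_sub_L2, fourier_sub_L2]
  filter_upwards [h i, h' i, Lp.coeFn_sub (𝓕 (w' i) : L2) (𝓕 (w i)),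
    Lp.coeFn_sub (𝓕 (f' i) : L2) (𝓕 (f i))] with ξ h1 h2 h3 h4
  rw [h3, h4, Pi.sub_apply, Pi.sub_apply, h1, h2]
  ring

theorem IsPowA.gevreyNorm_eq {f w : L2Vec} (h : IsPowA (5 / 4) f w) (R l : ℝ) :
    gevreyNorm R l f =
      ∑ i, eLpNorm (fun ξ => (gevreyWeight R l ξ : ℂ) * (𝓕 (w i) : L2) ξ) 2 volume := by
  refine Finset.sum_congr rfl fun i _ => eLpNorm_congr_ae ?_
  filter_upwards [h i] with ξ hξ
  rw [hξ, katoWeight]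
  push_cast
  ring

theorem eLpNorm_gevreyWeight_le {R l : ℝ} (hl : 0 ≤ l) (g : L2) :
    eLpNorm (fun ξ => (gevreyWeight R l ξ : ℂ) * g ξ) 2 volume ≤
      ENNReal.ofReal (Real.exp (l * R) * ‖g‖) := by
  rw [ENNReal.ofReal_mul (Real.exp_pos _).le, Lp.norm_def, ENNReal.ofReal_toReal (Lp.eLpNorm_ne_top g)]
  refine eLpNorm_le_mul_eLpNorm_of_ae_le_mul (.of_forall fun ξ => ?_) 2
  rw [norm_mul, Complex.norm_real, Real.norm_of_nonneg (gevreyWeight_pos R l ξ).le]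
  gcongr
  unfold gevreyWeight
  gcongr
  exact min_le_right _ _

theorem IsPowA.gevreyNorm_le {f w : L2Vec} (h : IsPowA (5 / 4) f w) {R l : ℝ} (hl : 0 ≤ l) :
    gevreyNorm R l f ≤ ENNReal.ofReal (3 * Real.exp (l * R) * ‖w‖) := by
  rw [h.gevreyNorm_eq]
  calc _ ≤ ∑ _i : Fin 3, ENNReal.ofReal (Real.exp (l * R) * ‖w‖) := by
        refine Finset.sum_le_sum fun i _ => (eLpNorm_gevreyWeight_le hl _).trans ?_
        rw [Lp.norm_fourier_eq]
        gcongr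
        exact PiLp.norm_apply_le w i
    _ = _ := by
        rw [Finset.sum_const, Finset.card_univ, Fintype.card_fin, nsmul_eq_mul, mul_assoc,
          ENNReal.ofReal_mul (by norm_num : (0 : ℝ) ≤ 3)]
        norm_num

theorem IsPowA.gevreyNorm_ne_top {f w : L2Vec} (h : IsPowA (5 / 4) f w) {R l : ℝ} (hl : 0 ≤ l) :
    gevreyNorm R l f ≠ ∞ :=
  ((h.gevreyNorm_le hl).trans_lt ENNReal.ofReal_lt_top).ne

theorem gevreyNorm_le_exp_mul {R l l' : ℝ} (hR : 0 ≤ R) (f : L2Vec) :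
    gevreyNorm R l' f ≤ ENNReal.ofReal (Real.exp (|l' - l| * R)) * gevreyNorm R l f := by
  unfold gevreyNorm
  rw [Finset.mul_sum]
  refine Finset.sum_le_sum fun i _ => ?_
  refine eLpNorm_le_mul_eLpNorm_of_ae_le_mul (.of_forall fun ξ => ?_) 2
  rw [norm_mul, norm_mul, Complex.norm_real, Complex.norm_real, Real.norm_of_nonneg
    (katoWeight_nonneg R _ ξ), Real.norm_of_nonneg (katoWeight_nonneg R _ ξ), ← mul_assoc]
  refine mul_le_mul_of_nonneg_right ?_ (norm_nonneg _)
  unfold katoWeight gevreyWeight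
  rw [mul_left_comm, ← Real.exp_add]
  have h0 := symbA_nonneg ξ
  have h1 : 0 ≤ min (symbA ξ) R := le_min h0 hR
  gcongr
  have h2 : (l' - l) * min (symbA ξ) R ≤ |l' - l| * R :=
    mul_le_mul (le_abs_self _) (min_le_right _ _) h1 (abs_nonneg _)
  linarith

/-- Continuity of the truncated norm in both the exponent and the function. The truncation is
essential: the weight `e^{l min(A,R)}` is a bounded operator, and changing `l` costs only a finite
factor, which depends on `R`. -/
theorem IsPowA.gevreyNorm_le_of_near {f w f' w' : L2Vec} (h : IsPowA (5 / 4) f w)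
    (h' : IsPowA (5 / 4) f' w') {R l l' : ℝ} (hR : 0 ≤ R) (hl : 0 ≤ l) :
    (gevreyNorm R l' f').toReal ≤ Real.exp (|l' - l| * R) *
      ((gevreyNorm R l f).toReal + 3 * Real.exp (l * R) * ‖w' - w‖) := by
  refine ENNReal.toReal_le_of_le_ofReal (by positivity) ?_
  rw [ENNReal.ofReal_mul (by positivity), ENNReal.ofReal_add (by positivity) (by positivity),
    ENNReal.ofReal_toReal (h.gevreyNorm_ne_top hl)]
  refine (gevreyNorm_le_exp_mul (l := l) hR f').trans ?_
  gcongr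
  refine (gevreyNorm_le_add R l f f').trans ?_
  gcongr
  exact (h.sub h').gevreyNorm_le hl

/-- Completing the square: `Λ r a ≤ r a²/2 + Λ² r/2`. Half of the heat decay pays for an exponent
that grows at rate at most `Λ`. -/
theorem exp_weight_le {Λ r T l l' a m : ℝ} (hΛ : 0 ≤ Λ) (hr : 0 ≤ r) (hrT : r ≤ T)
    (hm0 : 0 ≤ m) (hma : m ≤ a) (hll' : l' - l ≤ Λ * r) :
    Real.exp (l' * m) * Real.exp (-r * a ^ 2) ≤
      Real.exp (Λ ^ 2 * T / 2) * Real.exp (l * m) * Real.exp (-r * a ^ 2 / 2) := by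
  rw [← Real.exp_add, ← Real.exp_add, ← Real.exp_add]
  refine Real.exp_le_exp.2 ?_
  have h1 : (l' - l) * m ≤ Λ * r * a :=
    (mul_le_mul_of_nonneg_right hll' hm0).trans (mul_le_mul_of_nonneg_left hma (by positivity))
  have h2 : Λ ^ 2 * r ≤ Λ ^ 2 * T := mul_le_mul_of_nonneg_left hrT (by positivity)
  nlinarith [mul_nonneg hr (sq_nonneg (Λ - a))]

theorem katoWeight_mul_symbHeat_le {Λ r T l l' R : ℝ} (hR : 0 ≤ R) (hΛ : 0 ≤ Λ) (hr : 0 < r)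
    (hrT : r ≤ T) (hll' : l' - l ≤ Λ * r) (ξ : R3) :
    katoWeight R l' ξ * symbHeat r ξ ≤
      2 * Real.exp (Λ ^ 2 * T / 2) * r ^ (-(5 / 8) : ℝ) * gevreyWeight R l ξ := by
  have h0 := symbA_nonneg ξ
  have h1 := exp_weight_le hΛ hr.le hrT (le_min h0 hR) (min_le_left _ _) hll'
  have h2 := rpow_mul_exp_neg_le (p := 5 / 4) (by norm_num) (by norm_num) hr h0
  unfold katoWeight gevreyWeight symbHeat
  calc _ = symbA ξ ^ (5 / 4 : ℝ) * (Real.exp (l' * min (symbA ξ) R) *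
        Real.exp (-r * symbA ξ ^ 2)) := by ring
    _ ≤ symbA ξ ^ (5 / 4 : ℝ) * (Real.exp (Λ ^ 2 * T / 2) * Real.exp (l * min (symbA ξ) R) *
        Real.exp (-r * symbA ξ ^ 2 / 2)) := by gcongr
    _ = (symbA ξ ^ (5 / 4 : ℝ) * Real.exp (-r * symbA ξ ^ 2 / 2)) *
        (Real.exp (Λ ^ 2 * T / 2) * Real.exp (l * min (symbA ξ) R)) := by ring
    _ ≤ (2 * r ^ (-(5 / 4 / 2) : ℝ)) *
        (Real.exp (Λ ^ 2 * T / 2) * Real.exp (l * min (symbA ξ) R)) := by gcongr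
    _ = _ := by norm_num; ring

/-- The variant for initial data. As `H^{1/2}` already supplies half a power of `A`, only `A^{3/4}`
has to be smoothed, which produces the Kato rate `r^{-3/8}`. -/
theorem katoWeight_mul_symbHeat_le_symbBessel {Λ r T l' R : ℝ} (hR : 0 ≤ R) (hΛ : 0 ≤ Λ)
    (hr : 0 < r) (hrT : r ≤ T) (hll' : l' ≤ Λ * r) (ξ : R3) :
    katoWeight R l' ξ * symbHeat r ξ ≤
      2 * Real.exp (Λ ^ 2 * T / 2) * r ^ (-(3 / 8) : ℝ) * symbBessel (1 / 2) ξ := by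
  have h0 := symbA_nonneg ξ
  have h1 := exp_weight_le (l := 0) hΛ hr.le hrT (le_min h0 hR) (min_le_left _ _)
    (by simpa using hll')
  have h2 := rpow_mul_exp_neg_le (p := 3 / 4) (by norm_num) (by norm_num) hr h0
  have h3 : symbA ξ ^ (1 / 2 : ℝ) ≤ symbBessel (1 / 2) ξ := by
    unfold symbBessel
    have h5 : symbA ξ ^ (1 / 2 : ℝ) = (symbA ξ ^ 2) ^ (1 / 2 / 2 : ℝ) := by
      rw [← Real.rpow_natCast, ← Real.rpow_mul h0]
      norm_num
    rw [h5]
    exact Real.rpow_le_rpow (sq_nonneg _) (by linarith) (by norm_num)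
  have h4 : symbA ξ ^ (5 / 4 : ℝ) = symbA ξ ^ (3 / 4 : ℝ) * symbA ξ ^ (1 / 2 : ℝ) := by
    rw [← Real.rpow_add_of_nonneg h0 (by norm_num) (by norm_num)]
    norm_num
  unfold katoWeight gevreyWeight symbHeat
  calc _ = symbA ξ ^ (5 / 4 : ℝ) * (Real.exp (l' * min (symbA ξ) R) *
        Real.exp (-r * symbA ξ ^ 2)) := by ring
    _ ≤ symbA ξ ^ (5 / 4 : ℝ) * (Real.exp (Λ ^ 2 * T / 2) * Real.exp (0 * min (symbA ξ) R) *
        Real.exp (-r * symbA ξ ^ 2 / 2)) := by gcongr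
    _ = (symbA ξ ^ (3 / 4 : ℝ) * Real.exp (-r * symbA ξ ^ 2 / 2)) *
        Real.exp (Λ ^ 2 * T / 2) * symbA ξ ^ (1 / 2 : ℝ) := by rw [h4, zero_mul, Real.exp_zero]; ring
    _ ≤ (2 * r ^ (-(3 / 4 / 2) : ℝ)) * Real.exp (Λ ^ 2 * T / 2) * symbBessel (1 / 2) ξ := by gcongr
    _ = _ := by rw [show (-(3 / 4 / 2) : ℝ) = -(3 / 8) by norm_num]; ring

/-! ### Kato bounds and the integral inequality for differences -/

/-- `f(t) ∈ D(A^{5/4})` for `t ∈ ]0,T]`, with `t^{3/8} A^{5/4} f(t)` bounded and continuous in `L²`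
and vanishing as `t → 0`. -/
def HasKatoBound (T : ℝ) (f : ℝ → L2Vec) : Prop :=
  ∃ w : ℝ → L2Vec,
    (∀ t ∈ Ioc 0 T, IsPowA (5 / 4) (f t) (w t)) ∧
    ContinuousOn w (Ioc 0 T) ∧
    (∃ C : ℝ, ∀ t ∈ Ioc 0 T, t ^ (3 / 8 : ℝ) * ‖w t‖ ≤ C) ∧
    Tendsto (fun t : ℝ => t ^ (3 / 8 : ℝ) * ‖w t‖) (𝓝[>] 0) (𝓝 0)

theorem HasKatoBound.sub {T : ℝ} {f f' : ℝ → L2Vec} (h : HasKatoBound T f)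
    (h' : HasKatoBound T f') : HasKatoBound T (fun t => f' t - f t) := by
  obtain ⟨w, h1, h2, ⟨C, hC⟩, h4⟩ := h
  obtain ⟨w', h1', h2', ⟨C', hC'⟩, h4'⟩ := h'
  have key : ∀ t : ℝ, 0 < t → t ^ (3 / 8 : ℝ) * ‖w' t - w t‖ ≤
      t ^ (3 / 8 : ℝ) * ‖w' t‖ + t ^ (3 / 8 : ℝ) * ‖w t‖ := fun t ht => by
    rw [← mul_add]
    exact mul_le_mul_of_nonneg_left (norm_sub_le _ _) (by positivity)
  refine ⟨fun t => w' t - w t, fun t ht => (h1 t ht).sub (h1' t ht), h2'.sub h2,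
    ⟨C' + C, fun t ht => (key t ht.1).trans (add_le_add (hC' t ht) (hC t ht))⟩, ?_⟩
  refine squeeze_zero' ?_ ?_ (by simpa using h4'.add h4)
  · filter_upwards [self_mem_nhdsWithin] with t ht
    have : (0 : ℝ) < t := ht
    positivity
  · filter_upwards [self_mem_nhdsWithin] with t ht using key t ht

theorem gevreyNorm_le_of_mul_le {f w : L2Vec} (h : IsPowA (5 / 4) f w) {R t K : ℝ} (ht : 0 < t)
    (hK : t ^ (3 / 8 : ℝ) * ‖w‖ ≤ K) :
    gevreyNorm R 0 f ≤ ENNReal.ofReal (3 * K * t ^ (-(3 / 8) : ℝ)) := by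
  refine (h.gevreyNorm_le le_rfl).trans (ENNReal.ofReal_le_ofReal ?_)
  rw [zero_mul, Real.exp_zero, mul_one, mul_assoc, Real.rpow_neg ht.le]
  gcongr
  rwa [← div_eq_mul_inv, le_div_iff₀ (by positivity), mul_comm]

theorem HasKatoBound.exists_gevreyNorm_le {T : ℝ} {f : ℝ → L2Vec} (h : HasKatoBound T f) :
    ∃ K : ℝ, 0 ≤ K ∧ ∀ R, ∀ t ∈ Ioc 0 T,
      gevreyNorm R 0 (f t) ≤ ENNReal.ofReal (K * t ^ (-(3 / 8) : ℝ)) := by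
  obtain ⟨w, h1, h2, ⟨C, hC⟩, h4⟩ := h
  refine ⟨3 * max C 0, by positivity, fun R t ht => ?_⟩
  exact gevreyNorm_le_of_mul_le (h1 t ht) ht.1 ((hC t ht).trans (le_max_left _ _))

theorem HasKatoBound.exists_forall_gevreyNorm_le {T : ℝ} {f : ℝ → L2Vec} (h : HasKatoBound T f)
    {κ : ℝ} (hκ : 0 < κ) :
    ∃ ε > 0, ∀ R, ∀ t ∈ Ioc 0 T, t < ε →
      gevreyNorm R 0 (f t) ≤ ENNReal.ofReal (κ * t ^ (-(3 / 8) : ℝ)) := by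
  obtain ⟨w, h1, h2, -, h4⟩ := h
  have h5 := h4.eventually (eventually_le_nhds (show (0 : ℝ) < κ / 3 by positivity))
  obtain ⟨ε, hε, h6⟩ := (mem_nhdsGT_iff_exists_Ioo_subset).1 h5
  refine ⟨ε, hε, fun R t ht hlt => ?_⟩
  have h7 := gevreyNorm_le_of_mul_le (R := R) (h1 t ht) ht.1 (h6 ⟨ht.1, hlt⟩)
  rwa [mul_div_cancel₀ κ (by norm_num : (3 : ℝ) ≠ 0)] at h7

theorem HasKatoBound.gevreyNorm_ne_top {T : ℝ} {f : ℝ → L2Vec} (h : HasKatoBound T f) {t R l : ℝ}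
    (ht : t ∈ Ioc 0 T) (hl : 0 ≤ l) : gevreyNorm R l (f t) ≠ ∞ := by
  obtain ⟨w, h1, -⟩ := h
  exact (h1 t ht).gevreyNorm_ne_top hl

/-- The openness step of the continuous induction: a strict bound persists for a short time because
`A^{5/4} f` is continuous in `L²` and the truncated weight is bounded. -/
theorem HasKatoBound.eventually_lt {T : ℝ} {f : ℝ → L2Vec} (h : HasKatoBound T f) {R : ℝ}
    (hR : 0 ≤ R) {l : ℝ → ℝ} (hl : Continuous l) (hl0 : ∀ s, 0 ≤ l s) {b : ℝ → ℝ} {s : ℝ}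
    (hb : ContinuousAt b s) (hs : s ∈ Ioo 0 T)
    (hlt : gevreyNorm R (l s) (f s) < ENNReal.ofReal (b s)) :
    ∀ᶠ τ in 𝓝[>] s, gevreyNorm R (l τ) (f τ) < ENNReal.ofReal (b τ) := by
  have hsT : s ∈ Ioc 0 T := ⟨hs.1, hs.2.le⟩
  have hne : ∀ τ ∈ Ioo 0 T, gevreyNorm R (l τ) (f τ) ≠ ∞ := fun τ hτ =>
    h.gevreyNorm_ne_top ⟨hτ.1, hτ.2.le⟩ (hl0 τ)
  obtain ⟨w, h1, h2, -⟩ := h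
  have hw : ContinuousAt w s := h2.continuousAt (Ioc_mem_nhds hs.1 hs.2)
  have hc : ContinuousAt (fun τ => Real.exp (|l τ - l s| * R) *
      ((gevreyNorm R (l s) (f s)).toReal + 3 * Real.exp (l s * R) * ‖w τ - w s‖)) s := by
    have hl' := hl.continuousAt (x := s)
    fun_prop
  have hlt' : (gevreyNorm R (l s) (f s)).toReal < b s := by
    rwa [ENNReal.lt_ofReal_iff_toReal_lt (hne s hs)] at hlt
  have hev := hc.eventually_lt hb (by simpa using hlt')
  filter_upwards [nhdsWithin_le_nhds hev, nhdsWithin_le_nhds (Ioo_mem_nhds hs.1 hs.2)] with τ h3 h4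
  rw [ENNReal.lt_ofReal_iff_toReal_lt (hne τ h4)]
  exact ((h1 s hsT).gevreyNorm_le_of_near (h1 τ ⟨h4.1, h4.2.le⟩) hR (hl0 s)).trans_lt h3

theorem gevreyWeight_zero (R : ℝ) (ξ : R3) : gevreyWeight R 0 ξ = 1 := by simp [gevreyWeight]

theorem IsStrongSolution.exists_difference {M : Matrix (Fin 3) (Fin 3) ℝ} {P : FiberedProjection}
    {T : ℝ} {u v : ℝ → SobolevVec (1 / 2)} {C : ℝ≥0}
    (hC : ∀ (P : FiberedProjection) (f g N N' PN PN' : L2Vec), IsConvection M f N →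
      IsConvection M g N' → P.Maps N PN → P.Maps N' PN' → ∀ R l : ℝ, 0 ≤ R → 0 ≤ l → ∀ i,
        eLpNorm (fun ξ => (gevreyWeight R l ξ : ℂ) * (𝓕 (PN' i - PN i) : L2) ξ) 2 volume ≤
          C * ((2 * gevreyNorm R l f + gevreyNorm R l (g - f)) * gevreyNorm R l (g - f)))
    (hu : IsStrongSolution M P (1 / 2) T u) (hv : IsStrongSolution M P (1 / 2) T v) :
    ∃ n : ℝ → Fin 3 → L2,
      (∀ i, IsWeakHeatSolution T (fun s => 𝓕 ((v s - u s).toL2Vec i)) (fun s => n s i)) ∧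
      ∀ s ∈ Ioc 0 T, ∀ R l : ℝ, 0 ≤ R → 0 ≤ l → ∀ i,
        eLpNorm (fun ξ => (gevreyWeight R l ξ : ℂ) * n s i ξ) 2 volume ≤
          C * ((2 * gevreyNorm R l (u s).toL2Vec + gevreyNorm R l (v s - u s).toL2Vec) *
            gevreyNorm R l (v s - u s).toL2Vec) := by
  obtain ⟨N, PN, h1, h2⟩ := hu.equation
  obtain ⟨N', PN', h1', h2'⟩ := hv.equation
  refine ⟨fun s i => 𝓕 (PN' s i - PN s i), fun i => ?_, fun s hs R l hR hl i => ?_⟩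
  · simp only [SobolevVec.toL2Vec_sub, PiLp.sub_apply, fourier_sub_L2]
    exact (isWeakHeatSolution_of_equation fun φ => (h2 φ i).1).sub
      (isWeakHeatSolution_of_equation fun φ => (h2' φ i).1)
  · rw [SobolevVec.toL2Vec_sub]
    exact hC P _ _ _ _ _ _ (h1 s hs).1 (h1' s hs).1 (h1 s hs).2 (h1' s hs).2 R l hR hl i

theorem IsStrongSolution.hasKatoBound {M : Matrix (Fin 3) (Fin 3) ℝ} {P : FiberedProjection}
    {r T : ℝ} {u : ℝ → SobolevVec r} (hu : IsStrongSolution M P r T u) :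
    HasKatoBound T (fun s => (u s).toL2Vec) := hu.kato

theorem IsStrongSolution.hasKatoBound_sub {M : Matrix (Fin 3) (Fin 3) ℝ} {P : FiberedProjection}
    {r T : ℝ} {u v : ℝ → SobolevVec r} (hu : IsStrongSolution M P r T u)
    (hv : IsStrongSolution M P r T v) : HasKatoBound T (fun s => (v s - u s).toL2Vec) := by
  simp only [SobolevVec.toL2Vec_sub]
  exact hu.hasKatoBound.sub hv.hasKatoBound

theorem symbHeat_nonneg (r : ℝ) (ξ : R3) : 0 ≤ symbHeat r ξ := (Real.exp_pos _).le

theorem norm_le_of_eLpNorm_gevreyWeight {g : L2} {c : ℝ} (hc : 0 ≤ c)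
    (h : eLpNorm (fun ξ => (gevreyWeight 0 0 ξ : ℂ) * g ξ) 2 volume ≤ ENNReal.ofReal c) :
    ‖g‖ ≤ c := by
  rw [Lp.norm_def]
  refine ENNReal.toReal_le_of_le_ofReal hc ?_
  simpa only [gevreyWeight_zero, Complex.ofReal_one, one_mul] using h

/-- The integral inequality for the Gevrey norm of the difference of two strong solutions. -/
theorem IsStrongSolution.gevreyNorm_sub_le {M : Matrix (Fin 3) (Fin 3) ℝ} {P : FiberedProjection}
    {T : ℝ} {u v : ℝ → SobolevVec (1 / 2)} {C : ℝ≥0}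
    (hC : ∀ (P : FiberedProjection) (f g N N' PN PN' : L2Vec), IsConvection M f N →
      IsConvection M g N' → P.Maps N PN → P.Maps N' PN' → ∀ R l : ℝ, 0 ≤ R → 0 ≤ l → ∀ i,
        eLpNorm (fun ξ => (gevreyWeight R l ξ : ℂ) * (𝓕 (PN' i - PN i) : L2) ξ) 2 volume ≤
          C * ((2 * gevreyNorm R l f + gevreyNorm R l (g - f)) * gevreyNorm R l (g - f)))
    (hu : IsStrongSolution M P (1 / 2) T u) (hv : IsStrongSolution M P (1 / 2) T v)
    {Λ R : ℝ} (hΛ : 0 ≤ Λ) (hR : 0 ≤ R) {l : ℝ → ℝ} (hl0 : ∀ s, 0 ≤ l s) (hl00 : l 0 = 0)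
    (hl : ∀ τ s, τ ≤ s → l s - l τ ≤ Λ * (s - τ)) {s : ℝ} (hs : s ∈ Ioc 0 T) {G W : ℝ → ℝ}
    (hG0 : ∀ τ ∈ Ioo 0 s, 0 ≤ G τ) (hW0 : ∀ τ ∈ Ioo 0 s, 0 ≤ W τ)
    (hint : IntegrableOn (fun τ => (s - τ) ^ (-(5 / 8) : ℝ) * (G τ * W τ)) (Ioo 0 s))
    (hG : ∀ τ ∈ Ioo 0 s, 2 * gevreyNorm R (l τ) (u τ).toL2Vec +
      gevreyNorm R (l τ) (v τ - u τ).toL2Vec ≤ ENNReal.ofReal (G τ))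
    (hW : ∀ τ ∈ Ioo 0 s, gevreyNorm R (l τ) (v τ - u τ).toL2Vec ≤ ENNReal.ofReal (W τ)) :
    gevreyNorm R (l s) (v s - u s).toL2Vec ≤ ENNReal.ofReal (3 *
      (2 * Real.exp (Λ ^ 2 * T / 2) * s ^ (-(3 / 8) : ℝ) * ‖v 0 - u 0‖ +
        2 * Real.exp (Λ ^ 2 * T / 2) * C *
          ∫ τ in Ioo 0 s, (s - τ) ^ (-(5 / 8) : ℝ) * (G τ * W τ))) := by
  have hs0 := hs.1
  obtain ⟨n, hn, hnC⟩ := IsStrongSolution.exists_difference hC hu hv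
  obtain ⟨K, hK0, hK⟩ := hu.hasKatoBound.exists_gevreyNorm_le
  obtain ⟨K', hK0', hK'⟩ := (hu.hasKatoBound_sub hv).exists_gevreyNorm_le
  have hsub : ∀ τ ∈ Ioo 0 s, τ ∈ Ioc 0 T := fun τ hτ => ⟨hτ.1, hτ.2.le.trans hs.2⟩
  -- The unweighted norm of the forcing is `O(τ^{-3/4})`, as the product of two Kato bounds. This
  -- integrability is all that the approximation in Duhamel's inequality needs.
  have hν : IntegrableOn (fun τ : ℝ => C * ((2 * K + K') * K') * τ ^ (-(3 / 4) : ℝ)) (Ioo 0 s) := by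
    refine Integrable.const_mul ?_ _
    exact (intervalIntegral.integrableOn_Ioo_rpow_iff hs0).2 (by norm_num)
  have hnν : ∀ i, ∀ τ ∈ Ioo 0 s, ‖n τ i‖ ≤ C * ((2 * K + K') * K') * τ ^ (-(3 / 4) : ℝ) := by
    intro i τ hτ
    have hτ0 := hτ.1
    refine norm_le_of_eLpNorm_gevreyWeight (by positivity) ?_
    refine (hnC τ (hsub τ hτ) 0 0 le_rfl le_rfl i).trans ?_
    calc _ ≤ (C : ℝ≥0∞) * ((2 * ENNReal.ofReal (K * τ ^ (-(3 / 8) : ℝ)) +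
          ENNReal.ofReal (K' * τ ^ (-(3 / 8) : ℝ))) * ENNReal.ofReal (K' * τ ^ (-(3 / 8) : ℝ))) := by
          gcongr
          · exact hK 0 τ (hsub τ hτ)
          · exact hK' 0 τ (hsub τ hτ)
          · exact hK' 0 τ (hsub τ hτ)
      _ = ENNReal.ofReal (C * ((2 * (K * τ ^ (-(3 / 8) : ℝ)) + K' * τ ^ (-(3 / 8) : ℝ)) *
          (K' * τ ^ (-(3 / 8) : ℝ)))) := by
          have e : ∀ x y : ℝ, 0 ≤ x → 0 ≤ y → (C : ℝ≥0∞) * ((2 * ENNReal.ofReal x +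
              ENNReal.ofReal y) * ENNReal.ofReal y) = ENNReal.ofReal (C * ((2 * x + y) * y)) := by
            intro x y hx hy
            rw [ENNReal.ofReal_mul (by positivity), ENNReal.ofReal_mul (by positivity),
              ENNReal.ofReal_add (by positivity) hy, ENNReal.ofReal_mul (by norm_num),
              ENNReal.ofReal_coe_nnreal]
            norm_num
          exact e _ _ (by positivity) (by positivity)
      _ = _ := by
          congr 1
          rw [show (-(3 / 4) : ℝ) = -(3 / 8) + -(3 / 8) by norm_num, Real.rpow_add hτ0]
          ring
  have hi : ∀ i, eLpNorm (fun ξ => (katoWeight R (l s) ξ : ℂ) *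
      (𝓕 ((v s - u s).toL2Vec i) : L2) ξ) 2 volume ≤ ENNReal.ofReal
      (2 * Real.exp (Λ ^ 2 * T / 2) * s ^ (-(3 / 8) : ℝ) * ‖v 0 - u 0‖ +
        2 * Real.exp (Λ ^ 2 * T / 2) * C *
          ∫ τ in Ioo 0 s, (s - τ) ^ (-(5 / 8) : ℝ) * (G τ * W τ)) := by
    intro i
    have hy : ContinuousOn (fun s => (𝓕 ((v s - u s).toL2Vec i) : L2)) (Icc 0 T) := by
      simp only [SobolevVec.toL2Vec_sub, PiLp.sub_apply, fourier_sub_L2]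
      exact (hv.continuousOn_fourier (by norm_num) i).sub
        (hu.continuousOn_fourier (by norm_num) i)
    rw [← integral_const_mul]
    refine (hn i).eLpNorm_le hy hs hν (hnν i) (measurable_katoWeight R (l s))
      (katoWeight_nonneg R (l s)) (by positivity) (hint.const_mul _) (fun τ hτ => ?_) ?_ ?_
    · have h1 := hG0 τ hτ
      have h2 := hW0 τ hτ
      have h3 : 0 < s - τ := sub_pos.2 hτ.2
      positivity
    -- The initial datum: since `l 0 = 0`, the exponent has grown by at most `Λ s` at time `s`.
    · have hb : eLpNorm (fun ξ => (symbBessel (1 / 2) ξ : ℂ) *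
          (𝓕 ((v 0 - u 0).toL2Vec i) : L2) ξ) 2 volume ≤ ENNReal.ofReal ‖v 0 - u 0‖ :=
        (Sobolev.enorm_eq ((v 0 - u 0) i)).trans_le
          (ENNReal.ofReal_le_ofReal (PiLp.norm_apply_le (v 0 - u 0) i))
      rw [ENNReal.ofReal_mul (by positivity)]
      refine le_trans ?_ (mul_le_mul_right hb _)
      refine eLpNorm_le_mul_eLpNorm_of_ae_le_mul (.of_forall fun ξ => ?_) 2
      rw [← mul_assoc, ← Complex.ofReal_mul, norm_mul, norm_mul, ← mul_assoc, Complex.norm_real,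
        Complex.norm_real, Real.norm_of_nonneg (mul_nonneg (katoWeight_nonneg _ _ _)
        (symbHeat_nonneg _ _)), Real.norm_of_nonneg (zero_le_one.trans (one_le_symbBessel
        (by norm_num) ξ))]
      refine mul_le_mul_of_nonneg_right ?_ (norm_nonneg _)
      refine katoWeight_mul_symbHeat_le_symbBessel hR hΛ hs0 hs.2 ?_ ξ
      simpa [hl00] using hl 0 s hs0.le
    · intro τ hτ
      have h1 := hG0 τ hτ
      have h2 := hW0 τ hτ
      have h3 : 0 < s - τ := sub_pos.2 hτ.2
      -- The forcing is measured with exponent `l τ`; the heat flow over time `s - τ` raises it to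
      -- `l s`.
      have hb : eLpNorm (fun ξ => (gevreyWeight R (l τ) ξ : ℂ) * n τ i ξ) 2 volume ≤
          ENNReal.ofReal (C * (G τ * W τ)) := by
        rw [ENNReal.ofReal_mul (by positivity), ENNReal.ofReal_mul h1, ENNReal.ofReal_coe_nnreal]
        refine (hnC τ (hsub τ hτ) R (l τ) hR (hl0 τ) i).trans ?_
        gcongr
        · exact hG τ hτ
        · exact hW τ hτ
      rw [show 2 * Real.exp (Λ ^ 2 * T / 2) * C * ((s - τ) ^ (-(5 / 8) : ℝ) * (G τ * W τ)) =
        2 * Real.exp (Λ ^ 2 * T / 2) * (s - τ) ^ (-(5 / 8) : ℝ) * (C * (G τ * W τ)) by ring,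
        ENNReal.ofReal_mul (by positivity)]
      refine le_trans ?_ (mul_le_mul_right hb _)
      refine eLpNorm_le_mul_eLpNorm_of_ae_le_mul (.of_forall fun ξ => ?_) 2
      rw [← mul_assoc, ← Complex.ofReal_mul, norm_mul, norm_mul, ← mul_assoc, Complex.norm_real,
        Complex.norm_real, Real.norm_of_nonneg (mul_nonneg (katoWeight_nonneg _ _ _)
        (symbHeat_nonneg _ _)), Real.norm_of_nonneg (gevreyWeight_pos _ _ ξ).le]
      refine mul_le_mul_of_nonneg_right ?_ (norm_nonneg _)
      exact katoWeight_mul_symbHeat_le hR hΛ h3 (by linarith [hτ.1, hs.2]) (hl τ s hτ.2.le) ξ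
  unfold gevreyNorm
  refine (Finset.sum_le_sum fun i _ => hi i).trans ?_
  rw [Finset.sum_const, Finset.card_univ, Fintype.card_fin, nsmul_eq_mul,
    ENNReal.ofReal_mul (by norm_num : (0 : ℝ) ≤ 3)]
  norm_num

/-! ### The bootstrap along the ramp -/

/-- The piecewise linear radius `Λ (s - s₀)₊`. -/
def radiusRamp (Λ s₀ s : ℝ) : ℝ := Λ * max (s - s₀) 0

theorem continuous_radiusRamp (Λ s₀ : ℝ) : Continuous (radiusRamp Λ s₀) := by
  unfold radiusRamp
  fun_prop

theorem radiusRamp_nonneg {Λ : ℝ} (hΛ : 0 ≤ Λ) (s₀ s : ℝ) : 0 ≤ radiusRamp Λ s₀ s :=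
  mul_nonneg hΛ (le_max_right _ _)

theorem radiusRamp_eq_zero (Λ : ℝ) {s₀ s : ℝ} (h : s ≤ s₀) : radiusRamp Λ s₀ s = 0 := by
  rw [radiusRamp, max_eq_right (sub_nonpos.2 h), mul_zero]

theorem radiusRamp_sub_le {Λ : ℝ} (hΛ : 0 ≤ Λ) (s₀ : ℝ) {τ s : ℝ} (h : τ ≤ s) :
    radiusRamp Λ s₀ s - radiusRamp Λ s₀ τ ≤ Λ * (s - τ) := by
  unfold radiusRamp
  rw [← mul_sub]
  refine mul_le_mul_of_nonneg_left ?_ hΛ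
  rcases max_cases (s - s₀) 0 with h1 | h1 <;> rcases max_cases (τ - s₀) 0 with h2 | h2 <;> linarith

/-- Stability of the Gevrey norm of strong solutions with respect to the initial data. -/
theorem IsStrongSolution.exists_gevreyNorm_sub_le {M : Matrix (Fin 3) (Fin 3) ℝ}
    {P : FiberedProjection} {T : ℝ} {u : ℝ → SobolevVec (1 / 2)}
    (hu : IsStrongSolution M P (1 / 2) T u) {t : ℝ} (ht : t ∈ Ioc 0 T) {Λ s₀ : ℝ} (hΛ : 0 ≤ Λ)
    (hs₀ : 0 < s₀)
    (hgu : ∀ κ > 0, ∃ B : ℝ, 0 ≤ B ∧ ∀ R, 0 ≤ R → ∀ τ ∈ Ioc 0 t,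
      gevreyNorm R (radiusRamp Λ s₀ τ) (u τ).toL2Vec ≤
        ENNReal.ofReal (κ * τ ^ (-(3 / 8) : ℝ) + B)) :
    ∃ δ > 0, ∃ Q : ℝ, ∀ v, IsStrongSolution M P (1 / 2) T v → ‖v 0 - u 0‖ < δ →
      ∀ R, 0 ≤ R → ∀ s ∈ Ioc 0 t, gevreyNorm R (radiusRamp Λ s₀ s) (v s - u s).toL2Vec ≤
        ENNReal.ofReal (Q * s ^ (-(3 / 8) : ℝ)) := by
  obtain ⟨C, hC⟩ := exists_eLpNorm_nonlinearity_sub_le M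
  obtain ⟨β, hβ, hker⟩ := exists_integral_kernel_le
  have ht0 := ht.1
  set E : ℝ := Real.exp (Λ ^ 2 * T / 2) with hE
  have hE0 : 0 < E := Real.exp_pos _
  -- The constants are arranged so that the initial datum contributes at most one quarter of the
  -- barrier `Q e^{μs} s^{-3/8}`, and the Duhamel integral at most one half, shared equally by the
  -- `κ` and `B` terms. The sum is strictly below the barrier.
  set κ : ℝ := 1 / (72 * E * C * β + 1) with hκ
  have hκ0 : 0 < κ := by positivity
  obtain ⟨B, hB, hgu⟩ := hgu κ hκ0
  set Y : ℝ := 48 * E * C * B * β * t ^ (1 / 4 : ℝ) + 1 with hY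
  have hY0 : 0 < Y := by positivity
  -- The eighth power makes `μ^{-1/8} = Y⁻¹`, which compensates the size of `B`.
  set μ : ℝ := Y ^ 8 with hμ
  have hμ0 : 0 < μ := by positivity
  have hμY : μ ^ (-(1 / 8) : ℝ) = Y⁻¹ := by
    rw [hμ, ← Real.rpow_natCast, ← Real.rpow_mul hY0.le, ← Real.rpow_neg_one]
    norm_num
  -- With this choice the barrier stays below `κ s^{-3/8}` up to time `t`, so the quadratic term is
  -- treated like the small singular part of `u`.
  set Q : ℝ := κ * Real.exp (-(μ * t)) with hQ
  have hQ0 : 0 < Q := by positivity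
  refine ⟨Q / (24 * E), by positivity, Q * Real.exp (μ * t), fun v hv hv0 R hR => ?_⟩
  set l := radiusRamp Λ s₀ with hl
  set p : ℝ → Prop := fun s => gevreyNorm R (l s) (v s - u s).toL2Vec <
    ENNReal.ofReal (Q * Real.exp (μ * s) * s ^ (-(3 / 8) : ℝ)) with hp
  have hd := hu.hasKatoBound_sub hv
  have hmain : ∀ s ∈ Ioc 0 t, p s := by
    refine forall_Ioc_of_continuous_induction ?_ ?_ ?_
    -- Near time `0` the ramp vanishes, and the Kato condition on the difference gives half of the
    -- barrier. Here `ε` may depend on `v`, while `δ` and `Q` do not.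
    · obtain ⟨ε, hε, h⟩ := hd.exists_forall_gevreyNorm_le (half_pos hQ0)
      refine ⟨min ε s₀, lt_min hε hs₀, fun τ hτ hlt => ?_⟩
      have hτ0 := hτ.1
      have h1 := h R τ ⟨hτ.1, hτ.2.trans ht.2⟩ (hlt.trans_le (min_le_left _ _))
      simp only [hp]
      rw [hl, radiusRamp_eq_zero Λ (hlt.trans_le (min_le_right _ _)).le]
      refine h1.trans_lt ((ENNReal.ofReal_lt_ofReal_iff (by positivity)).2 ?_)
      have h2 : 1 ≤ Real.exp (μ * τ) := Real.one_le_exp (by positivity)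
      refine mul_lt_mul_of_pos_right ?_ (by positivity)
      nlinarith
    · intro s hs hps
      have hs0 := hs.1
      -- Twice the bound `κ τ^{-3/8} + B` for `u`, plus `κ τ^{-3/8}` for the difference.
      set G : ℝ → ℝ := fun τ => 3 * κ * τ ^ (-(3 / 8) : ℝ) + 2 * B with hG
      set W : ℝ → ℝ := fun τ => Real.exp (μ * τ) * τ ^ (-(3 / 8) : ℝ) * Q with hW
      have hQe : ∀ τ ≤ t, Real.exp (μ * τ) * Q ≤ κ := by
        intro τ hτ
        rw [hQ, mul_left_comm, ← Real.exp_add]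
        refine mul_le_of_le_one_right hκ0.le (Real.exp_le_one_iff.2 ?_)
        nlinarith
      obtain ⟨hk1, hk2⟩ := hker (3 * κ) (2 * B) μ t s (by positivity) (by positivity) hμ0 hs
      have hGW : (fun τ => (s - τ) ^ (-(5 / 8) : ℝ) * (G τ * W τ)) = fun τ =>
          (s - τ) ^ (-(5 / 8) : ℝ) * ((3 * κ * τ ^ (-(3 / 8) : ℝ) + 2 * B) *
            (Real.exp (μ * τ) * τ ^ (-(3 / 8) : ℝ))) * Q := by
        ext τ
        simp only [hG, hW]
        ring
      have hWle : ∀ τ ∈ Ioo 0 s, gevreyNorm R (l τ) (v τ - u τ).toL2Vec ≤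
          ENNReal.ofReal (W τ) := fun τ hτ => by
        refine (hps τ hτ).le.trans_eq ?_
        congr 1
        simp only [hW]
        ring
      have key := hu.gevreyNorm_sub_le hC hv hΛ hR (l := l) (radiusRamp_nonneg hΛ s₀)
        (radiusRamp_eq_zero Λ hs₀.le) (fun τ s h => radiusRamp_sub_le hΛ s₀ h)
        (s := s) ⟨hs0, hs.2.trans ht.2⟩ (G := G) (W := W)
        (fun τ hτ => by have := hτ.1; positivity) (fun τ hτ => by have := hτ.1; positivity)
        (by rw [hGW]; exact hk1.mul_const _) (fun τ hτ => ?_) hWle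
      · refine key.trans_lt ((ENNReal.ofReal_lt_ofReal_iff (by positivity)).2 ?_)
        rw [hGW, integral_mul_const]
        set X : ℝ := Real.exp (μ * s) * s ^ (-(3 / 8) : ℝ) with hX
        have hX0 : 0 < X := by positivity
        have hsX : s ^ (-(3 / 8) : ℝ) ≤ X :=
          le_mul_of_one_le_left (by positivity) (Real.one_le_exp (by positivity))
        have e1 : 2 * E * s ^ (-(3 / 8) : ℝ) * ‖v 0 - u 0‖ ≤ 2 * E * X * (Q / (24 * E)) := by
          gcongr
        have e2 : 2 * E * X * (Q / (24 * E)) = X * Q / 12 := by field_simp; norm_num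
        have e3 : E * C * β * κ ≤ 1 / 72 := by
          rw [hκ, mul_one_div, div_le_div_iff₀ (by positivity) (by norm_num)]
          linarith
        have e4 : E * C * B * β * t ^ (1 / 4 : ℝ) * Y⁻¹ ≤ 1 / 48 := by
          rw [← div_eq_mul_inv, div_le_div_iff₀ hY0 (by norm_num), hY]
          linarith
        have e5 : E * C * (3 * κ * β + 2 * B * μ ^ (-(1 / 8) : ℝ) * β * t ^ (1 / 4 : ℝ)) ≤
            1 / 12 := by
          rw [hμY]
          calc _ = 3 * (E * C * β * κ) + 2 * (E * C * B * β * t ^ (1 / 4 : ℝ) * Y⁻¹) := by ring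
            _ ≤ 1 / 12 := by linarith
        have e6 := mul_le_mul_of_nonneg_left hk2 (show 0 ≤ 2 * E * C * Q by positivity)
        have e7 := mul_le_mul_of_nonneg_left e5 (show 0 ≤ 2 * Q * X by positivity)
        have e8 : 0 < Q * X := by positivity
        rw [mul_assoc Q, ← hX]
        nlinarith
      · have hτ0 := hτ.1
        have hτt : τ ≤ t := hτ.2.le.trans hs.2
        calc _ ≤ 2 * ENNReal.ofReal (κ * τ ^ (-(3 / 8) : ℝ) + B) + ENNReal.ofReal (W τ) := by
              gcongr
              · exact hgu R hR τ ⟨hτ0, hτt⟩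
              · exact hWle τ hτ
          _ = ENNReal.ofReal (2 * (κ * τ ^ (-(3 / 8) : ℝ) + B) + W τ) := by
              rw [ENNReal.ofReal_add (p := 2 * _) (by positivity) (by positivity),
                ENNReal.ofReal_mul (p := 2) (by norm_num)]
              norm_num
          _ ≤ _ := by
              refine ENNReal.ofReal_le_ofReal ?_
              have := mul_le_mul_of_nonneg_left (hQe τ hτt)
                (show 0 ≤ τ ^ (-(3 / 8) : ℝ) by positivity)
              simp only [hG, hW]
              linarith
    · intro s hs hps
      refine hd.eventually_lt hR (continuous_radiusRamp Λ s₀) (radiusRamp_nonneg hΛ s₀)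
        (b := fun s => Q * Real.exp (μ * s) * s ^ (-(3 / 8) : ℝ)) ?_ ⟨hs.1, hs.2.trans_le ht.2⟩ hps
      have := Real.continuousAt_rpow_const s (-(3 / 8)) (Or.inl hs.1.ne')
      fun_prop
  intro s hs
  have hs0 := hs.1
  refine (hmain s hs).le.trans (ENNReal.ofReal_le_ofReal ?_)
  gcongr
  exact hs.2

/-! ### From Gevrey norms back to the modified radius -/

theorem eLpNorm_le_expNorm (α : ℝ) (f : L2Vec) (i : Fin 3) :
    eLpNorm (fun ξ => (Real.exp (α * symbA ξ) : ℂ) * (𝓕 (f i) : L2) ξ) 2 volume ≤ expNorm α f := by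
  unfold expNorm
  rw [one_div, ENNReal.le_rpow_inv_iff (by norm_num), ENNReal.rpow_two]
  exact Finset.single_le_sum (f := fun i => eLpNorm (fun ξ => (Real.exp (α * symbA ξ) : ℂ) *
    (𝓕 (f i) : L2) ξ) 2 volume ^ 2) (fun _ _ => zero_le) (Finset.mem_univ i)

theorem expNorm_le_sum (α : ℝ) (f : L2Vec) : expNorm α f ≤
    ∑ i, eLpNorm (fun ξ => (Real.exp (α * symbA ξ) : ℂ) * (𝓕 (f i) : L2) ξ) 2 volume := by
  unfold expNorm
  rw [one_div, ENNReal.rpow_inv_le_iff (by norm_num), ENNReal.rpow_two, sq, Finset.sum_mul]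
  refine Finset.sum_le_sum fun i _ => ?_
  rw [sq]
  gcongr
  exact Finset.single_le_sum (f := fun i => eLpNorm (fun ξ => (Real.exp (α * symbA ξ) : ℂ) *
    (𝓕 (f i) : L2) ξ) 2 volume) (fun _ _ => zero_le) (Finset.mem_univ i)

theorem eLpNorm_ofReal_mul_le {b b' : R3 → ℝ} (hb : ∀ ξ, 0 ≤ b ξ) {c : ℝ} (hc : 0 ≤ c)
    (h : ∀ ξ, b ξ ≤ c * b' ξ) (g : R3 → ℂ) :
    eLpNorm (fun ξ => (b ξ : ℂ) * g ξ) 2 volume ≤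
      ENNReal.ofReal c * eLpNorm (fun ξ => (b' ξ : ℂ) * g ξ) 2 volume := by
  refine eLpNorm_le_mul_eLpNorm_of_ae_le_mul (.of_forall fun ξ => ?_) 2
  rw [norm_mul, norm_mul, ← mul_assoc, Complex.norm_real, Complex.norm_real,
    Real.norm_of_nonneg (hb ξ)]
  refine mul_le_mul_of_nonneg_right ((h ξ).trans ?_) (norm_nonneg _)
  exact mul_le_mul_of_nonneg_left (le_abs_self _) hc

theorem rpow_le_mul_exp {d x : ℝ} (hd : 0 < d) (hx : 0 ≤ x) :
    x ^ (5 / 4 : ℝ) ≤ (1 + 2 / d ^ 2) * Real.exp (d * x) := by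
  have h1 : x ^ (5 / 4 : ℝ) ≤ 1 + x ^ 2 := by
    rcases le_total x 1 with h | h
    · have := Real.rpow_le_one hx h (by norm_num : (0 : ℝ) ≤ 5 / 4)
      nlinarith
    · have := Real.rpow_le_rpow_of_exponent_le h (by norm_num : (5 / 4 : ℝ) ≤ 2)
      rw [Real.rpow_two] at this
      linarith
  have h2 := Real.quadratic_le_exp_of_nonneg (mul_nonneg hd.le hx)
  have h3 : 1 ≤ Real.exp (d * x) := Real.one_le_exp (by positivity)
  have h4 : x ^ 2 = 2 / d ^ 2 * ((d * x) ^ 2 / 2) := by field_simp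
  have h5 : x ^ 2 ≤ 2 / d ^ 2 * Real.exp (d * x) := by
    rw [h4]
    refine mul_le_mul_of_nonneg_left ?_ (by positivity)
    have := mul_nonneg hd.le hx
    linarith
  linarith

/-- The gap `α - l` absorbs the factor `A^{5/4}`, at a cost independent of `R`. -/
theorem gevreyNorm_le_expNorm {R l α : ℝ} (hl : 0 ≤ l) (h : l < α) (f : L2Vec) :
    gevreyNorm R l f ≤ ENNReal.ofReal (3 * (1 + 2 / (α - l) ^ 2)) * expNorm α f := by
  have hi : ∀ i, eLpNorm (fun ξ => (katoWeight R l ξ : ℂ) * (𝓕 (f i) : L2) ξ) 2 volume ≤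
      ENNReal.ofReal (1 + 2 / (α - l) ^ 2) * expNorm α f := fun i => by
    refine (eLpNorm_ofReal_mul_le (b' := fun ξ => Real.exp (α * symbA ξ)) (katoWeight_nonneg R l)
      (by positivity : 0 ≤ 1 + 2 / (α - l) ^ 2) (fun ξ => ?_) _).trans ?_
    · have h1 := rpow_le_mul_exp (sub_pos.2 h) (symbA_nonneg ξ)
      have h2 : Real.exp (l * min (symbA ξ) R) ≤ Real.exp (l * symbA ξ) :=
        Real.exp_le_exp.2 (mul_le_mul_of_nonneg_left (min_le_left _ _) hl)
      unfold katoWeight gevreyWeight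
      calc _ ≤ (1 + 2 / (α - l) ^ 2) * Real.exp ((α - l) * symbA ξ) * Real.exp (l * symbA ξ) := by
            gcongr
        _ = _ := by
            rw [mul_assoc, ← Real.exp_add]
            ring_nf
    · gcongr
      exact eLpNorm_le_expNorm α f i
  unfold gevreyNorm
  refine (Finset.sum_le_sum fun i _ => hi i).trans ?_
  rw [Finset.sum_const, Finset.card_univ, Fintype.card_fin, nsmul_eq_mul,
    ENNReal.ofReal_mul (by norm_num : (0 : ℝ) ≤ 3), mul_assoc]
  norm_num

theorem gevreyNorm_mono {R l l' : ℝ} (hR : 0 ≤ R) (h : l ≤ l') (f : L2Vec) :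
    gevreyNorm R l f ≤ gevreyNorm R l' f := by
  unfold gevreyNorm
  refine Finset.sum_le_sum fun i _ => ?_
  refine (eLpNorm_ofReal_mul_le (b' := katoWeight R l') (katoWeight_nonneg R l) zero_le_one
    (fun ξ => ?_) _).trans_eq (by simp)
  rw [one_mul]
  unfold katoWeight gevreyWeight
  have h1 : 0 ≤ min (symbA ξ) R := le_min (symbA_nonneg ξ) hR
  have h2 := symbA_nonneg ξ
  gcongr

/-- Three time ranges before and after the ramp starts: for `τ < ε` the Kato limit gives the small
factor `κ`, between `ε` and `s₀` the Kato bound is a constant, and after `s₀` the exponent is at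
most `α < α'`, where `e^{α'A} f` is bounded. -/
theorem HasKatoBound.exists_gevreyNorm_radiusRamp_le {T : ℝ} {f : ℝ → L2Vec}
    (hf : HasKatoBound T f) {t : ℝ} (ht : t ≤ T) {a s₀ α α' : ℝ} (has : a < s₀) (hst : s₀ < t)
    (hα : 0 ≤ α) (hα' : α < α') (hsup : ⨆ s ∈ Ioc a t, expNorm α' (f s) < ∞) {κ : ℝ} (hκ : 0 < κ) :
    ∃ B : ℝ, 0 ≤ B ∧ ∀ R, 0 ≤ R → ∀ τ ∈ Ioc 0 t,
      gevreyNorm R (radiusRamp (α / (t - s₀)) s₀ τ) (f τ) ≤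
        ENNReal.ofReal (κ * τ ^ (-(3 / 8) : ℝ) + B) := by
  obtain ⟨K, hK0, hK⟩ := hf.exists_gevreyNorm_le
  obtain ⟨ε, hε, hsmall⟩ := hf.exists_forall_gevreyNorm_le hκ
  set S := ⨆ s ∈ Ioc a t, expNorm α' (f s) with hS
  refine ⟨K * ε ^ (-(3 / 8) : ℝ) + 3 * (1 + 2 / (α' - α) ^ 2) * S.toReal, by positivity,
    fun R hR τ hτ => ?_⟩
  have hτ0 := hτ.1
  have hτT : τ ∈ Ioc 0 T := ⟨hτ.1, hτ.2.trans ht⟩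
  have hκτ : 0 ≤ κ * τ ^ (-(3 / 8) : ℝ) := by positivity
  have hKε : 0 ≤ K * ε ^ (-(3 / 8) : ℝ) := by positivity
  have hS0 : 0 ≤ 3 * (1 + 2 / (α' - α) ^ 2) * S.toReal := by positivity
  rcases le_or_gt τ s₀ with h | h
  · rw [radiusRamp_eq_zero _ h]
    rcases lt_or_ge τ ε with h1 | h1
    · exact (hsmall R τ hτT h1).trans (ENNReal.ofReal_le_ofReal (by linarith))
    · refine (hK R τ hτT).trans (ENNReal.ofReal_le_ofReal ?_)
      have : K * τ ^ (-(3 / 8) : ℝ) ≤ K * ε ^ (-(3 / 8) : ℝ) :=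
        mul_le_mul_of_nonneg_left (Real.rpow_le_rpow_of_nonpos hε h1 (by norm_num)) hK0
      linarith
  · have hl : radiusRamp (α / (t - s₀)) s₀ τ ≤ α := by
      have h2 : 0 < t - s₀ := sub_pos.2 hst
      rw [radiusRamp, max_eq_left (sub_pos.2 h).le, div_mul_eq_mul_div, div_le_iff₀ h2]
      exact mul_le_mul_of_nonneg_left (by linarith [hτ.2]) hα
    have hSτ : expNorm α' (f τ) ≤ S := le_iSup₂ (f := fun s _ => expNorm α' (f s)) τ
      ⟨has.trans h, hτ.2⟩
    calc _ ≤ _ := gevreyNorm_mono hR hl _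
      _ ≤ _ := gevreyNorm_le_expNorm hα hα' _
      _ ≤ ENNReal.ofReal (3 * (1 + 2 / (α' - α) ^ 2)) * ENNReal.ofReal S.toReal := by
          rw [ENNReal.ofReal_toReal hsup.ne]
          gcongr
      _ ≤ _ := by
          rw [← ENNReal.ofReal_mul (by positivity)]
          exact ENNReal.ofReal_le_ofReal (by linarith)

/-- Removes the truncation by Fatou as `R → ∞`. Frequencies with `|2πξ| ≤ 1` are controlled by the
`L²` norm; above, the factor `|2πξ|^{5/4}` is at least `1` and can be dropped. -/
theorem eLpNorm_exp_mul_le {l α : ℝ} (hα0 : 0 ≤ α) (hα : α ≤ l) {f : L2Vec} {c : ℝ≥0∞}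
    (h : ∀ R, 0 ≤ R → gevreyNorm R l f ≤ c) (i : Fin 3) :
    eLpNorm (fun ξ => (Real.exp (α * symbA ξ) : ℂ) * (𝓕 (f i) : L2) ξ) 2 volume ≤
      ENNReal.ofReal (Real.exp α * ‖f i‖) + c := by
  set w : R3 → ℝ := fun ξ => symbA ξ ^ (5 / 4 : ℝ) * Real.exp (l * symbA ξ) with hw
  have hwm : Measurable w := by
    have := measurable_symbA
    fun_prop
  have hlim : eLpNorm (fun ξ => (w ξ : ℂ) * (𝓕 (f i) : L2) ξ) 2 volume ≤ c := by
    refine eLpNorm_le_of_tendsto (f := fun j ξ => (katoWeight (j : ℝ) l ξ : ℂ) * (𝓕 (f i) : L2) ξ)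
      (fun j => aestronglyMeasurable_ofReal_mul (measurable_katoWeight _ _) _) (fun ξ => ?_)
      (fun j => (eLpNorm_fourier_le_gevreyNorm _ _ f i).trans (h j (Nat.cast_nonneg j)))
    refine tendsto_const_nhds.congr' ?_
    obtain ⟨J, hJ⟩ := exists_nat_ge (symbA ξ)
    filter_upwards [eventually_ge_atTop J] with j hj
    have : symbA ξ ≤ (j : ℝ) := hJ.trans (by exact_mod_cast hj)
    simp only [katoWeight, gevreyWeight, min_eq_left this, hw]
  have hconst : eLpNorm (fun ξ => (Real.exp α : ℂ) * (𝓕 (f i) : L2) ξ) 2 volume ≤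
      ENNReal.ofReal (Real.exp α * ‖f i‖) := by
    refine (eLpNorm_le_mul_eLpNorm_of_ae_le_mul (g := (𝓕 (f i) : L2)) (c := Real.exp α)
      (.of_forall fun ξ => ?_) 2).trans ?_
    · rw [norm_mul, Complex.norm_real, Real.norm_of_nonneg (Real.exp_pos _).le]
    · rw [ENNReal.ofReal_mul (Real.exp_pos _).le, ← Lp.norm_fourier_eq, Lp.norm_def,
        ENNReal.ofReal_toReal (Lp.eLpNorm_ne_top _)]
  have hm : AEStronglyMeasurable (fun ξ => (Real.exp α : ℂ) * (𝓕 (f i) : L2) ξ) volume :=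
    aestronglyMeasurable_ofReal_mul measurable_const _
  have hm' : AEStronglyMeasurable (fun ξ => (w ξ : ℂ) * (𝓕 (f i) : L2) ξ) volume :=
    aestronglyMeasurable_ofReal_mul hwm _
  refine le_trans ?_ (add_le_add hconst hlim)
  rw [← eLpNorm_norm (fun ξ => (Real.exp α : ℂ) * (𝓕 (f i) : L2) ξ),
    ← eLpNorm_norm (fun ξ => (w ξ : ℂ) * (𝓕 (f i) : L2) ξ)]
  refine le_trans (eLpNorm_mono_real fun ξ => ?_) (eLpNorm_add_le hm.norm hm'.norm (by norm_num))
  have h0 := symbA_nonneg ξ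
  simp only [Pi.add_apply, norm_mul, Complex.norm_real, ← add_mul]
  have hw0 : 0 ≤ w ξ := by positivity
  rw [Real.norm_of_nonneg (Real.exp_pos _).le, Real.norm_of_nonneg (Real.exp_pos _).le,
    Real.norm_of_nonneg hw0]
  refine mul_le_mul_of_nonneg_right ?_ (norm_nonneg _)
  rcases le_total (symbA ξ) 1 with h1 | h1
  · refine le_add_of_le_of_nonneg (Real.exp_le_exp.2 ?_) hw0
    exact mul_le_of_le_one_right hα0 h1
  · refine le_add_of_nonneg_of_le (Real.exp_pos _).le ?_
    refine le_trans (Real.exp_le_exp.2 (mul_le_mul_of_nonneg_right hα h0)) ?_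
    exact le_mul_of_one_le_left (Real.exp_pos _).le (Real.one_le_rpow h1 (by norm_num))

theorem eLpNorm_fourier_le_add {b : R3 → ℝ} (hb : Measurable b) (f g : L2) :
    eLpNorm (fun ξ => (b ξ : ℂ) * (𝓕 g : L2) ξ) 2 volume ≤
      eLpNorm (fun ξ => (b ξ : ℂ) * (𝓕 f : L2) ξ) 2 volume +
        eLpNorm (fun ξ => (b ξ : ℂ) * (𝓕 (g - f) : L2) ξ) 2 volume := by
  refine le_trans (le_of_eq ?_) (eLpNorm_add_le (aestronglyMeasurable_ofReal_mul hb _)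
    (aestronglyMeasurable_ofReal_mul hb _) (by norm_num))
  refine eLpNorm_congr_ae ?_
  rw [fourier_sub_L2]
  filter_upwards [Lp.coeFn_sub (𝓕 g : L2) (𝓕 f)] with ξ hξ
  rw [Pi.add_apply, hξ, Pi.sub_apply]
  ring

/-- The modified radius is lower semicontinuous with respect to the initial data. -/
theorem IsStrongSolution.exists_forall_le_modifiedRad {M : Matrix (Fin 3) (Fin 3) ℝ}
    {P : FiberedProjection} {T : ℝ} {u : ℝ → SobolevVec (1 / 2)}
    (hu : IsStrongSolution M P (1 / 2) T u) {t : ℝ} (ht : t ∈ Ioc 0 T) {c : ℝ≥0}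
    (hc : (c : ℝ≥0∞) < modifiedRad t u) :
    ∃ δ > 0, ∀ v, IsStrongSolution M P (1 / 2) T v → ‖v 0 - u 0‖ < δ → c ≤ modifiedRad t v := by
  obtain ⟨α', hα'⟩ := lt_iSup_iff.1 hc
  obtain ⟨⟨a, ha, hsup⟩, hcα'⟩ := lt_iSup_iff.1 hα'
  have hcα : (c : ℝ) < α' := by exact_mod_cast hcα'
  have hc0 : (0 : ℝ) ≤ c := c.2
  have ha0 := ha.1
  have hat := ha.2
  -- The midpoint is positive even when `a = 0`, as the induction near time `0` requires, and the
  -- ramp has room to reach `α` before `t`.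
  set s₀ : ℝ := (a + t) / 2 with hs₀
  have has : a < s₀ := by linarith
  have hst : s₀ < t := by linarith
  have hs0 : 0 < s₀ := by linarith [ht.1]
  set α : ℝ := (c + α') / 2 with hα
  have hc1 : (c : ℝ) < α := by linarith
  have hα1 : α < α' := by linarith
  have hα0 : 0 < α := by linarith
  have hts : 0 < t - s₀ := sub_pos.2 hst
  have hΛ : 0 < α / (t - s₀) := by positivity
  obtain ⟨δ, hδ, Q, h⟩ := hu.exists_gevreyNorm_sub_le ht hΛ.le hs0 fun κ hκ =>
    hu.hasKatoBound.exists_gevreyNorm_radiusRamp_le ht.2 has hst hα0.le hα1 hsup hκ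
  refine ⟨δ, hδ, fun v hv hv0 => ?_⟩
  set S := ⨆ s ∈ Ioc a t, expNorm α' (u s).toL2Vec with hS
  obtain ⟨K, hK⟩ := isCompact_Icc.exists_bound_of_continuousOn
    (hv.continuousOn.sub hu.continuousOn)
  -- This is the time when the ramp reaches the level `c`; it precedes `t` because `c < α`.
  have hts' : s₀ + c / (α / (t - s₀)) < t := by
    have : c / (α / (t - s₀)) < t - s₀ := by
      rw [div_lt_iff₀ hΛ, mul_div_cancel₀ _ hts.ne']
      exact hc1
    linarith
  have hs1 : s₀ ≤ s₀ + c / (α / (t - s₀)) := le_add_of_nonneg_right (by positivity)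
  have hbound : ∀ s ∈ Ioc (s₀ + c / (α / (t - s₀))) t, expNorm c (v s).toL2Vec ≤
      3 * (S + (ENNReal.ofReal (Real.exp c * K) +
        ENNReal.ofReal (|Q| * s₀ ^ (-(3 / 8) : ℝ)))) := by
    intro s hs
    have hss : s₀ < s := hs1.trans_lt hs.1
    have hcl : (c : ℝ) ≤ radiusRamp (α / (t - s₀)) s₀ s := by
      rw [radiusRamp, max_eq_left (sub_pos.2 hss).le]
      have h1 : c / (α / (t - s₀)) ≤ s - s₀ := by linarith [hs.1]
      rw [div_le_iff₀ hΛ] at h1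
      linarith
    refine (expNorm_le_sum _ _).trans ?_
    have hi : ∀ i, eLpNorm (fun ξ => (Real.exp (c * symbA ξ) : ℂ) *
        (𝓕 ((v s).toL2Vec i) : L2) ξ) 2 volume ≤ S + (ENNReal.ofReal (Real.exp c * K) +
        ENNReal.ofReal (|Q| * s₀ ^ (-(3 / 8) : ℝ))) := by
      intro i
      refine (eLpNorm_fourier_le_add (b := fun ξ => Real.exp (c * symbA ξ))
        (by have := measurable_symbA; fun_prop) ((u s).toL2Vec i) _).trans (add_le_add ?_ ?_)
      · refine (eLpNorm_ofReal_mul_le (b' := fun ξ => Real.exp (α' * symbA ξ))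
          (fun ξ => (Real.exp_pos _).le) zero_le_one (fun ξ => ?_) _).trans ?_
        · rw [one_mul]
          exact Real.exp_le_exp.2 (mul_le_mul_of_nonneg_right hcα.le (symbA_nonneg ξ))
        · rw [ENNReal.ofReal_one, one_mul]
          refine (eLpNorm_le_expNorm _ _ i).trans ?_
          exact le_iSup₂ (f := fun s _ => expNorm α' (u s).toL2Vec) s ⟨has.trans hss, hs.2⟩
      · have h1 := eLpNorm_exp_mul_le hc0 hcl
          (fun R hR => h v hv hv0 R hR s ⟨hs0.trans hss, hs.2⟩) i
        rw [SobolevVec.toL2Vec_sub, PiLp.sub_apply] at h1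
        refine h1.trans ?_
        gcongr ENNReal.ofReal (_ * ?_) + ENNReal.ofReal ?_
        · calc _ = ‖Sobolev.toL2 ((v s - u s) i)‖ := by
                rw [PiLp.sub_apply, map_sub]
                rfl
            _ ≤ ‖(v s - u s) i‖ := Sobolev.norm_toL2_le (by norm_num) _
            _ ≤ ‖v s - u s‖ := PiLp.norm_apply_le _ i
            _ ≤ K := hK s ⟨(hs0.trans hss).le, hs.2.trans ht.2⟩
        · exact mul_le_mul (le_abs_self Q) (Real.rpow_le_rpow_of_nonpos hs0 hss.le (by norm_num))
            (Real.rpow_nonneg (hs0.trans hss).le _) (abs_nonneg Q)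
    refine (Finset.sum_le_sum fun i _ => hi i).trans_eq ?_
    rw [Finset.sum_const, Finset.card_univ, Fintype.card_fin, nsmul_eq_mul]
    norm_num
  refine le_iSup₂ (f := fun (α : ℝ≥0) (_ : ∃ a ∈ Ico 0 t,
    ⨆ s ∈ Ioc a t, expNorm α (v s).toL2Vec < ∞) => (α : ℝ≥0∞)) c
    ⟨s₀ + c / (α / (t - s₀)), ⟨by linarith, hts'⟩, (iSup₂_le hbound).trans_lt ?_⟩
  refine ENNReal.mul_lt_top (by norm_num) (ENNReal.add_lt_top.2 ⟨hsup, ?_⟩)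
  exact ENNReal.add_lt_top.2 ⟨ENNReal.ofReal_lt_top, ENNReal.ofReal_lt_top⟩

/-! ### Complex translations and the Paley–Wiener argument -/

/-- The symbol `e^{2πi ξ·η}` of the translation `f ↦ f(· + η)`, `η ∈ ℂ³`. -/
def symbTranslation (η : EuclideanSpace ℂ (Fin 3)) (ξ : R3) : ℂ :=
  Complex.exp (2 * Real.pi * Complex.I * inner ℂ (complexify ξ) η)

theorem inner_complexify (ξ : R3) (η : EuclideanSpace ℂ (Fin 3)) :
    inner ℂ (complexify ξ) η = ∑ j, (ξ j : ℂ) * η j := by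
  rw [PiLp.inner_apply]
  refine Finset.sum_congr rfl fun j _ => ?_
  simp [complexify, mul_comm]

theorem norm_complexify (ξ : R3) : ‖complexify ξ‖ = ‖ξ‖ := by
  simp [EuclideanSpace.norm_eq, complexify]

theorem inner_complexify_complexify (ξ η : R3) :
    inner ℂ (complexify ξ) (complexify η) = ((inner ℝ ξ η : ℝ) : ℂ) := by
  rw [inner_complexify, PiLp.inner_apply]
  push_cast
  refine Finset.sum_congr rfl fun j _ => ?_
  simp [complexify, mul_comm]

theorem inner_complexify_im (ξ : R3) (η : EuclideanSpace ℂ (Fin 3)) :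
    (inner ℂ (complexify ξ) η).im = inner ℝ ξ (imPart η) := by
  rw [inner_complexify, PiLp.inner_apply, Complex.im_sum]
  refine Finset.sum_congr rfl fun j _ => ?_
  simp [imPart, mul_comm]

theorem continuous_complexify : Continuous complexify := by
  unfold complexify
  fun_prop

theorem continuous_symbTranslation (η : EuclideanSpace ℂ (Fin 3)) :
    Continuous (symbTranslation η) := by
  have := continuous_complexify
  unfold symbTranslation
  fun_prop

theorem norm_exponent_le (ξ : R3) (η : EuclideanSpace ℂ (Fin 3)) :
    ‖2 * Real.pi * Complex.I * inner ℂ (complexify ξ) η‖ ≤ ‖η‖ * symbA ξ := by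
  have h := norm_inner_le_norm (𝕜 := ℂ) (complexify ξ) η
  rw [norm_complexify] at h
  simp only [norm_mul, Complex.norm_real, Complex.norm_I, mul_one, RCLike.norm_ofNat, symbA]
  rw [Real.norm_of_nonneg Real.pi_pos.le]
  calc _ ≤ 2 * Real.pi * (‖ξ‖ * ‖η‖) := by gcongr
    _ = _ := by ring

/-- The modulus is `e^{-2π ξ·Im η}`; apply Cauchy–Schwarz to the exponent. -/
theorem norm_symbTranslation_le (η : EuclideanSpace ℂ (Fin 3)) (ξ : R3) :
    ‖symbTranslation η ξ‖ ≤ Real.exp (‖imPart η‖ * symbA ξ) := by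
  rw [symbTranslation, Complex.norm_exp]
  refine Real.exp_le_exp.2 ?_
  have e : (2 * Real.pi * Complex.I * inner ℂ (complexify ξ) η).re =
      -(2 * Real.pi * inner ℝ ξ (imPart η)) := by
    rw [← inner_complexify_im]
    simp [Complex.mul_re]
  rw [e, symbA]
  have h := abs_le.1 (abs_real_inner_le_norm ξ (imPart η))
  have := Real.pi_pos
  nlinarith [h.1]

theorem symbTranslation_add (η h : EuclideanSpace ℂ (Fin 3)) (ξ : R3) :
    symbTranslation (η + h) ξ = symbTranslation η ξ *
      Complex.exp (2 * Real.pi * Complex.I * inner ℂ (complexify ξ) h) := by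
  rw [symbTranslation, symbTranslation, ← Complex.exp_add, inner_add_right, mul_add]

theorem sq_le_mul_exp {d x : ℝ} (hd : 0 < d) (hx : 0 ≤ x) :
    x ^ 2 ≤ 2 / d ^ 2 * Real.exp (d * x) := by
  have h2 := Real.quadratic_le_exp_of_nonneg (mul_nonneg hd.le hx)
  have h4 : x ^ 2 = 2 / d ^ 2 * ((d * x) ^ 2 / 2) := by field_simp
  rw [h4]
  refine mul_le_mul_of_nonneg_left ?_ (by positivity)
  have := mul_nonneg hd.le hx
  linarith

theorem norm_exp_sub_one_sub_le (z : ℂ) : ‖Complex.exp z - 1 - z‖ ≤ ‖z‖ ^ 2 * Real.exp ‖z‖ := by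
  have h := Complex.norm_exp_sub_sum_le_norm_mul_exp z 2
  simpa [Finset.sum_range_succ, sub_sub] using h

/-- Second order Taylor estimate for the symbol of the translation. -/
theorem norm_symbTranslation_sub_le {a b : ℝ} {η h : EuclideanSpace ℂ (Fin 3)}
    (hab : ‖imPart η‖ + ‖h‖ ≤ a) (hb : a < b) (ξ : R3) :
    ‖symbTranslation (η + h) ξ - symbTranslation η ξ -
      symbTranslation η ξ * (2 * Real.pi * Complex.I * inner ℂ (complexify ξ) h)‖ ≤
      2 / (b - a) ^ 2 * ‖h‖ ^ 2 * Real.exp (b * symbA ξ) := by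
  set z := 2 * Real.pi * Complex.I * inner ℂ (complexify ξ) h with hz
  have h0 := symbA_nonneg ξ
  have h1 := norm_exponent_le ξ h
  rw [← hz] at h1
  have e : symbTranslation (η + h) ξ - symbTranslation η ξ - symbTranslation η ξ * z =
      symbTranslation η ξ * (Complex.exp z - 1 - z) := by
    rw [symbTranslation_add]
    ring
  rw [e, norm_mul]
  calc _ ≤ Real.exp (‖imPart η‖ * symbA ξ) *
        ((‖h‖ * symbA ξ) ^ 2 * Real.exp (‖h‖ * symbA ξ)) := by
        refine mul_le_mul (norm_symbTranslation_le η ξ) ((norm_exp_sub_one_sub_le z).trans ?_)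
          (norm_nonneg _) (Real.exp_pos _).le
        gcongr
    _ = ‖h‖ ^ 2 * symbA ξ ^ 2 * Real.exp ((‖imPart η‖ + ‖h‖) * symbA ξ) := by
        rw [add_mul, Real.exp_add]
        ring
    _ ≤ ‖h‖ ^ 2 * (2 / (b - a) ^ 2 * Real.exp ((b - a) * symbA ξ)) * Real.exp (a * symbA ξ) := by
        gcongr
        exact sq_le_mul_exp (sub_pos.2 hb) h0
    _ = _ := by
        rw [show b * symbA ξ = (b - a) * symbA ξ + a * symbA ξ by ring, Real.exp_add]
        ring

/-! ### Translations in Fourier space -/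

theorem fourier_comp_sub (ψ : 𝓢(R3, ℂ)) (η x : R3) (φ : 𝓢(R3, ℂ))
    (h : ∀ ξ, φ ξ = symbTranslation (complexify η) ξ * ψ ξ) :
    (𝓕 ψ : 𝓢(R3, ℂ)) (x - η) = (𝓕 φ : 𝓢(R3, ℂ)) x := by
  rw [SchwartzMap.fourier_coe, SchwartzMap.fourier_coe, Real.fourier_eq', Real.fourier_eq']
  refine integral_congr_ae (.of_forall fun ξ => ?_)
  simp only [smul_eq_mul, h, symbTranslation, inner_complexify_complexify, ← mul_assoc,
    ← Complex.exp_add, inner_sub_right]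
  congr 2
  push_cast
  ring

/-- A translate of `f` is tested against `𝓕ψ`; shifting the variable moves the phase onto `ψ`. The
two transforms agree against all test functions, and the transform is injective. -/
theorem ae_eq_comp_add_of_fourier {f g : L2} {η : R3}
    (h : (𝓕 g : L2) =ᵐ[volume] fun ξ => symbTranslation (complexify η) ξ * (𝓕 f : L2) ξ) :
    (g : R3 → ℂ) =ᵐ[volume] fun x => f (x + η) := by
  have hmp : MeasurePreserving (fun x : R3 => x + η) volume volume :=
    measurePreserving_add_right volume η
  have hm : MemLp (fun x => (f : R3 → ℂ) (x + η)) 2 volume :=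
    (Lp.memLp f).comp_measurePreserving hmp
  have heq : (𝓕 (hm.toLp _) : L2) = 𝓕 g := by
    refine Lp.ext ?_
    refine ae_eq_of_integral_contDiff_smul_eq
      ((Lp.memLp _).locallyIntegrable (by norm_num)) ((Lp.memLp _).locallyIntegrable (by norm_num))
      fun ψ hψ hc => ?_
    have hψ' : ContDiff ℝ (⊤ : ℕ∞) fun ξ => (ψ ξ : ℂ) := Complex.ofRealCLM.contDiff.comp hψ
    have hc' : HasCompactSupport fun ξ => (ψ ξ : ℂ) := hc.comp_left Complex.ofReal_zero
    let ψS : 𝓢(R3, ℂ) := hc'.toSchwartzMap hψ'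
    have hphase : ContDiff ℝ (⊤ : ℕ∞) (symbTranslation (complexify η)) := by
      unfold symbTranslation
      simp only [inner_complexify_complexify]
      refine Complex.contDiff_exp.comp (contDiff_const.mul (Complex.ofRealCLM.contDiff.comp ?_))
      exact contDiff_id.inner ℝ contDiff_const
    let φS : 𝓢(R3, ℂ) := HasCompactSupport.toSchwartzMap
      (f := fun ξ => symbTranslation (complexify η) ξ * (ψ ξ : ℂ)) hc'.mul_left (hphase.mul hψ')
    have e1 := pairing_fourier (hm.toLp _) ψS
    have e2 := pairing_fourier f φS
    have e3 : pairing (hm.toLp _) (𝓕 ψS) = pairing f (𝓕 φS) := by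
      unfold pairing
      calc _ = ∫ x, (𝓕 ψS : 𝓢(R3, ℂ)) (x + η - η) * f (x + η) := by
            refine integral_congr_ae ?_
            filter_upwards [hm.coeFn_toLp] with x hx
            rw [hx, add_sub_cancel_right]
        _ = ∫ x, (𝓕 ψS : 𝓢(R3, ℂ)) (x - η) * f x :=
            integral_add_right_eq_self (fun x => (𝓕 ψS : 𝓢(R3, ℂ)) (x - η) * f x) η
        _ = _ := by
            refine integral_congr_ae (.of_forall fun x => ?_)
            simp only
            rw [fourier_comp_sub ψS η x φS fun ξ => rfl]
    rw [e1, e2] at e3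
    simp only [Complex.real_smul]
    refine e3.trans (integral_congr_ae ?_)
    filter_upwards [h] with ξ hξ
    rw [hξ]
    change symbTranslation (complexify η) ξ * (ψ ξ : ℂ) * _ = _
    ring
  have hinj : hm.toLp _ = g := (Lp.fourierTransformₗᵢ R3 ℂ).injective heq
  rw [← hinj]
  exact hm.coeFn_toLp

theorem measurable_symbBessel (r : ℝ) : Measurable (symbBessel r) := by
  have := measurable_symbA
  unfold symbBessel
  fun_prop

theorem Sobolev.bessel_surjective {r : ℝ} (hr : 0 ≤ r) :
    Function.Surjective (Sobolev.bessel : Sobolev r →ₗ[ℂ] L2) := by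
  intro h
  have hpos : ∀ ξ, 0 < symbBessel r ξ := fun ξ => zero_lt_one.trans_le (one_le_symbBessel hr ξ)
  have hk : MemLp (fun ξ => (((symbBessel r ξ)⁻¹ : ℝ) : ℂ) * h ξ) 2 volume :=
    (Lp.memLp h).ofReal_mul (measurable_symbBessel r).inv fun ξ => by
      rw [abs_of_pos (inv_pos.2 (hpos ξ))]
      exact inv_le_one_of_one_le₀ (one_le_symbBessel hr ξ)
  have hF : (𝓕 (𝓕⁻ (hk.toLp _) : L2) : L2) = hk.toLp _ := FourierTransform.fourier_fourierInv_eq _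
  have hmem : (fun ξ => (symbBessel r ξ : ℂ) * (𝓕 (𝓕⁻ (hk.toLp _) : L2) : L2) ξ) =ᵐ[volume] h := by
    rw [hF]
    filter_upwards [hk.coeFn_toLp] with ξ hξ
    rw [hξ, ← mul_assoc, ← Complex.ofReal_mul, mul_inv_cancel₀ (hpos ξ).ne', Complex.ofReal_one,
      one_mul]
  let f : Sobolev r := ⟨𝓕⁻ (hk.toLp _), (memLp_congr_ae hmem).2 (Lp.memLp h)⟩
  refine ⟨f, Lp.ext ?_⟩
  exact (Sobolev.memLp_bessel f).coeFn_toLp.trans hmem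

/-- `f ↦ 𝓕 (⟨A⟩^r f)` as an isometry from `H^r` onto `L²`. -/
def Sobolev.besselEquiv {r : ℝ} (hr : 0 ≤ r) : Sobolev r ≃ₗᵢ[ℂ] L2 where
  __ := LinearEquiv.ofBijective Sobolev.bessel ⟨Sobolev.bessel_injective,
    Sobolev.bessel_surjective hr⟩
  norm_map' _ := rfl

theorem Sobolev.besselEquiv_symm_ae_eq {r : ℝ} (hr : 0 ≤ r) (h : L2) :
    (fun ξ => (symbBessel r ξ : ℂ) * (𝓕 (Sobolev.toL2 ((Sobolev.besselEquiv hr).symm h)) : L2) ξ)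
      =ᵐ[volume] h := by
  have h1 := (Sobolev.memLp_bessel ((Sobolev.besselEquiv hr).symm h)).coeFn_toLp
  have h2 : (Sobolev.memLp_bessel ((Sobolev.besselEquiv hr).symm h)).toLp _ = h :=
    (Sobolev.besselEquiv hr).apply_symm_apply h
  rw [h2] at h1
  exact h1.symm

theorem memLp_mul_of_le_exp {m : R3 → ℂ} (hm : Continuous m) {g : R3 → ℂ} {b K : ℝ}
    (hg : AEStronglyMeasurable g volume)
    (hgb : MemLp (fun ξ => (Real.exp (b * symbA ξ) : ℂ) * g ξ) 2 volume)
    (h : ∀ ξ, ‖m ξ‖ ≤ K * Real.exp (b * symbA ξ)) : MemLp (fun ξ => m ξ * g ξ) 2 volume := by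
  refine hgb.of_le_mul (c := K) (hm.aestronglyMeasurable.mul hg) (.of_forall fun ξ => ?_)
  rw [norm_mul, norm_mul, Complex.norm_real, Real.norm_of_nonneg (Real.exp_pos _).le, ← mul_assoc]
  exact mul_le_mul_of_nonneg_right (h ξ) (norm_nonneg _)

theorem norm_toLp_mul_le {m : R3 → ℂ} {g : R3 → ℂ} {b K : ℝ}
    (hgb : MemLp (fun ξ => (Real.exp (b * symbA ξ) : ℂ) * g ξ) 2 volume)
    (h : ∀ ξ, ‖m ξ‖ ≤ K * Real.exp (b * symbA ξ)) {k : L2}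
    (hk : k =ᵐ[volume] fun ξ => m ξ * g ξ) : ‖k‖ ≤ K * ‖hgb.toLp _‖ := by
  refine Lp.norm_le_mul_norm_of_ae_le_mul ?_
  filter_upwards [hk, hgb.coeFn_toLp] with ξ h1 h2
  rw [h1, h2, norm_mul, norm_mul, Complex.norm_real, Real.norm_of_nonneg (Real.exp_pos _).le,
    ← mul_assoc]
  exact mul_le_mul_of_nonneg_right (h ξ) (norm_nonneg _)

theorem le_div_mul_exp {d x : ℝ} (hd : 0 < d) : x ≤ 1 / d * Real.exp (d * x) := by
  have h := Real.add_one_le_exp (d * x)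
  rw [one_div, inv_mul_eq_div, le_div_iff₀ hd]
  linarith

open Classical in
/-- The function `e^{2πi ξ·η} g(ξ)` as an element of `L²`, if it is one. -/
def translationL2 (g : R3 → ℂ) (η : EuclideanSpace ℂ (Fin 3)) : L2 :=
  if h : MemLp (fun ξ => symbTranslation η ξ * g ξ) 2 volume then h.toLp _ else 0

theorem translationL2_ae_eq {g : R3 → ℂ} {b : ℝ} (hg : AEStronglyMeasurable g volume)
    (hgb : MemLp (fun ξ => (Real.exp (b * symbA ξ) : ℂ) * g ξ) 2 volume)
    {η : EuclideanSpace ℂ (Fin 3)} (hη : ‖imPart η‖ ≤ b) :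
    (translationL2 g η : R3 → ℂ) =ᵐ[volume] fun ξ => symbTranslation η ξ * g ξ := by
  have h : MemLp (fun ξ => symbTranslation η ξ * g ξ) 2 volume :=
    memLp_mul_of_le_exp (continuous_symbTranslation η) (K := 1) hg hgb fun ξ => by
      rw [one_mul]
      exact (norm_symbTranslation_le η ξ).trans
        (Real.exp_le_exp.2 (mul_le_mul_of_nonneg_right hη (symbA_nonneg ξ)))
  rw [translationL2, dif_pos h]
  exact h.coeFn_toLp

theorem norm_imPart_le (η : EuclideanSpace ℂ (Fin 3)) : ‖imPart η‖ ≤ ‖η‖ := by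
  rw [EuclideanSpace.norm_eq, EuclideanSpace.norm_eq]
  refine Real.sqrt_le_sqrt (Finset.sum_le_sum fun j _ => ?_)
  refine pow_le_pow_left₀ (norm_nonneg _) ?_ 2
  rw [Real.norm_eq_abs]
  exact Complex.abs_im_le_norm (η j)

theorem imPart_add (η h : EuclideanSpace ℂ (Fin 3)) : imPart (η + h) = imPart η + imPart h := by
  ext j
  simp [imPart]

/-- The symbol is entire in `η`. Near a point strictly inside the tube its second-order remainder is
at most a multiple of `|h|² e^{bA}`, since the gap to `b` absorbs the factor `|ξ|²`. Hence the
expansion holds in `L²`. -/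
theorem differentiableAt_translationL2 {g : R3 → ℂ} {b : ℝ} (hg : AEStronglyMeasurable g volume)
    (hgb : MemLp (fun ξ => (Real.exp (b * symbA ξ) : ℂ) * g ξ) 2 volume)
    {η : EuclideanSpace ℂ (Fin 3)} (hη : ‖imPart η‖ < b) :
    DifferentiableAt ℂ (translationL2 g) η := by
  have hd : 0 < b - ‖imPart η‖ := sub_pos.2 hη
  have hD : ∀ j : Fin 3, MemLp (fun ξ => (symbTranslation η ξ *
      (2 * Real.pi * Complex.I * (ξ j : ℂ))) * g ξ) 2 volume := by
    intro j
    refine memLp_mul_of_le_exp (K := 1 / (b - ‖imPart η‖)) ?_ hg hgb fun ξ => ?_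
    · have := continuous_symbTranslation η
      fun_prop
    · have h1 : ‖2 * Real.pi * Complex.I * (ξ j : ℂ)‖ ≤ symbA ξ := by
        simp only [norm_mul, Complex.norm_real, Complex.norm_I, mul_one, RCLike.norm_ofNat, symbA]
        rw [Real.norm_of_nonneg Real.pi_pos.le]
        exact mul_le_mul_of_nonneg_left (PiLp.norm_apply_le ξ j) (by positivity)
      rw [norm_mul]
      calc _ ≤ Real.exp (‖imPart η‖ * symbA ξ) *
            (1 / (b - ‖imPart η‖) * Real.exp ((b - ‖imPart η‖) * symbA ξ)) := by
            refine mul_le_mul (norm_symbTranslation_le η ξ) (h1.trans (le_div_mul_exp hd))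
              (norm_nonneg _) (Real.exp_pos _).le
        _ = _ := by
            rw [mul_left_comm, ← Real.exp_add]
            ring_nf
  -- The candidate derivative multiplies by `2πi ξ·h`, assembled from the three coordinate
  -- directions.
  let D : EuclideanSpace ℂ (Fin 3) →L[ℂ] L2 :=
    ∑ j, (EuclideanSpace.proj j : EuclideanSpace ℂ (Fin 3) →L[ℂ] ℂ).smulRight ((hD j).toLp _)
  have hDae : ∀ h, (D h : R3 → ℂ) =ᵐ[volume] fun ξ => (symbTranslation η ξ *
      (2 * Real.pi * Complex.I * inner ℂ (complexify ξ) h)) * g ξ := by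
    intro h
    have e : D h = h 0 • (hD 0).toLp _ + h 1 • (hD 1).toLp _ + h 2 • (hD 2).toLp _ := by
      simp [D, Fin.sum_univ_three]
    rw [e]
    filter_upwards [Lp.coeFn_add (h 0 • (hD 0).toLp _ + h 1 • (hD 1).toLp _) (h 2 • (hD 2).toLp _),
      Lp.coeFn_add (h 0 • (hD 0).toLp _) (h 1 • (hD 1).toLp _),
      Lp.coeFn_smul (h 0) ((hD 0).toLp _), Lp.coeFn_smul (h 1) ((hD 1).toLp _),
      Lp.coeFn_smul (h 2) ((hD 2).toLp _), (hD 0).coeFn_toLp, (hD 1).coeFn_toLp,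
      (hD 2).coeFn_toLp] with ξ h1 h2 h3 h4 h5 h6 h7 h8
    rw [h1, Pi.add_apply, h2, Pi.add_apply, h3, h4, h5, Pi.smul_apply, Pi.smul_apply,
      Pi.smul_apply, h6, h7, h8, inner_complexify, Fin.sum_univ_three]
    simp only [smul_eq_mul]
    ring
  have hder : HasFDerivAt (translationL2 g) D η := by
    rw [hasFDerivAt_iff_isLittleO_nhds_zero]
    refine Asymptotics.IsBigO.trans_isLittleO (g := fun h => ‖h‖ ^ 2) ?_
      (Asymptotics.isLittleO_norm_pow_id one_lt_two)
    set a : ℝ := (‖imPart η‖ + b) / 2 with ha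
    have hab : a < b := by linarith
    refine Asymptotics.IsBigO.of_bound (2 / (b - a) ^ 2 * ‖hgb.toLp _‖) ?_
    have hnear : ∀ᶠ h : EuclideanSpace ℂ (Fin 3) in 𝓝 0, ‖h‖ < (b - ‖imPart η‖) / 2 := by
      have := (continuous_norm (E := EuclideanSpace ℂ (Fin 3))).tendsto 0
      rw [norm_zero] at this
      exact this.eventually (gt_mem_nhds (by positivity))
    filter_upwards [hnear] with h hh
    have him : ‖imPart (η + h)‖ ≤ b := by
      rw [imPart_add]
      have := norm_imPart_le h
      linarith [norm_add_le (imPart η) (imPart h)]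
    rw [norm_pow, norm_norm, mul_right_comm]
    refine norm_toLp_mul_le hgb (fun ξ => norm_symbTranslation_sub_le (η := η) (h := h) (a := a)
      (by linarith) hab ξ) ?_
    filter_upwards [translationL2_ae_eq hg hgb him, translationL2_ae_eq hg hgb hη.le, hDae h,
      Lp.coeFn_sub (translationL2 g (η + h) - translationL2 g η) (D h),
      Lp.coeFn_sub (translationL2 g (η + h)) (translationL2 g η)] with ξ h1 h2 h3 h4 h5
    rw [h4, Pi.sub_apply, h5, Pi.sub_apply, h1, h2, h3]
    ring
  exact hder.differentiableAt

theorem symbBessel_le {r d : ℝ} (hr : r ≤ 2) (hd : 0 < d) (ξ : R3) :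
    symbBessel r ξ ≤ (1 + 2 / d ^ 2) * Real.exp (d * symbA ξ) := by
  have h0 := symbA_nonneg ξ
  have h1 : symbBessel r ξ ≤ 1 + symbA ξ ^ 2 := by
    unfold symbBessel
    refine (Real.rpow_le_rpow_of_exponent_le (by nlinarith) (by linarith : r / 2 ≤ 1)).trans_eq ?_
    rw [Real.rpow_one]
  have h2 := sq_le_mul_exp hd h0
  have h3 : 1 ≤ Real.exp (d * symbA ξ) := Real.one_le_exp (by positivity)
  linarith

theorem imPart_complexify (η : R3) : imPart (complexify η) = 0 := by
  ext j
  simp [imPart, complexify]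

/-- A Paley–Wiener theorem: `e^{αA} f ∈ L²` implies analyticity in every smaller tube. -/
theorem Sobolev.isUniformlyAnalytic {r : ℝ} (hr : 0 ≤ r) (hr2 : r ≤ 2) {f : Sobolev r} {α a : ℝ}
    (hf : eLpNorm (fun ξ => (Real.exp (α * symbA ξ) : ℂ) * (𝓕 (Sobolev.toL2 f) : L2) ξ) 2 volume <
      ∞) (ha : 0 < a) (haα : a < α) : IsUniformlyAnalytic f a := by
  have hpos : ∀ ξ, 0 < symbBessel r ξ := fun ξ => zero_lt_one.trans_le (one_le_symbBessel hr ξ)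
  set g : R3 → ℂ := fun ξ => (symbBessel r ξ : ℂ) * (𝓕 (Sobolev.toL2 f) : L2) ξ with hgdef
  have hg : AEStronglyMeasurable g volume :=
    aestronglyMeasurable_ofReal_mul (measurable_symbBessel r) _
  have hexp : ∀ c : ℝ, Measurable fun ξ => Real.exp (c * symbA ξ) := fun c => by
    have := measurable_symbA
    fun_prop
  have hfα : MemLp (fun ξ => (Real.exp (α * symbA ξ) : ℂ) * (𝓕 (Sobolev.toL2 f) : L2) ξ) 2 volume :=
    ⟨aestronglyMeasurable_ofReal_mul (hexp α) _, hf⟩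
  -- The gap `α - a` absorbs the Bessel weight. From here one works in `L²` with the transform of
  -- `⟨A⟩^r f` and returns to `H^r` through the isometry `Sobolev.besselEquiv`.
  have hgb : MemLp (fun ξ => (Real.exp (a * symbA ξ) : ℂ) * g ξ) 2 volume := by
    refine hfα.of_le_mul (c := 1 + 2 / (α - a) ^ 2)
      ((Complex.measurable_ofReal.comp (hexp a)).aestronglyMeasurable.mul hg)
      (.of_forall fun ξ => ?_)
    simp only [hgdef, norm_mul, Complex.norm_real, Real.norm_of_nonneg (Real.exp_pos _).le,
      Real.norm_of_nonneg (hpos ξ).le, ← mul_assoc]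
    refine mul_le_mul_of_nonneg_right ?_ (norm_nonneg _)
    calc _ ≤ Real.exp (a * symbA ξ) *
          ((1 + 2 / (α - a) ^ 2) * Real.exp ((α - a) * symbA ξ)) :=
          mul_le_mul_of_nonneg_left (symbBessel_le hr2 (sub_pos.2 haα) ξ) (Real.exp_pos _).le
      _ = _ := by
          rw [mul_left_comm, ← Real.exp_add]
          ring_nf
  refine ⟨fun η => (Sobolev.besselEquiv hr).symm (translationL2 g η), fun η => ?_, fun η hη => ?_,
    ‖hgb.toLp _‖, fun η hη => ?_⟩
  · refine ae_eq_comp_add_of_fourier ?_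
    filter_upwards [Sobolev.besselEquiv_symm_ae_eq hr (translationL2 g (complexify η)),
      translationL2_ae_eq hg hgb (η := complexify η) (by simp [imPart_complexify, ha.le])]
      with ξ h1 h2
    rw [h2] at h1
    have hne : (symbBessel r ξ : ℂ) ≠ 0 := Complex.ofReal_ne_zero.2 (hpos ξ).ne'
    refine mul_left_cancel₀ hne (h1.trans ?_)
    simp only [hgdef]
    ring
  · exact (((Sobolev.besselEquiv hr).symm.toContinuousLinearEquiv.differentiableAt).comp η
      (differentiableAt_translationL2 hg hgb hη)).differentiableWithinAt
  · rw [LinearIsometryEquiv.norm_map, ← one_mul ‖hgb.toLp _‖]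
    refine norm_toLp_mul_le hgb (fun ξ => ?_) (translationL2_ae_eq hg hgb (le_of_lt hη))
    rw [one_mul]
    exact (norm_symbTranslation_le η ξ).trans
      (Real.exp_le_exp.2 (mul_le_mul_of_nonneg_right (le_of_lt hη) (symbA_nonneg ξ)))

/-! ### Comparison of the radii and conclusion -/

/-- The supremum over `]a,t]` includes `s = t`, so `e^{αA} v(t) ∈ L²`, and Paley–Wiener makes every
`b < α` admissible for each component. -/
theorem modifiedRad_le_rad {r t : ℝ} (hr : 0 ≤ r) (hr2 : r ≤ 2) (v : ℝ → SobolevVec r) :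
    modifiedRad t v ≤ rad (v t) := by
  refine iSup₂_le fun α ⟨a, ha, hsup⟩ => le_iInf fun j => ?_
  have h1 : expNorm α (v t).toL2Vec < ∞ := lt_of_le_of_lt
    (le_iSup₂ (f := fun s _ => expNorm α (v s).toL2Vec) t ⟨ha.2, le_rfl⟩) hsup
  have h2 := (eLpNorm_le_expNorm α (v t).toL2Vec j).trans_lt h1
  refine le_of_forall_lt fun c hc => ?_
  obtain ⟨b, hcb, hbα⟩ := exists_between hc
  lift b to ℝ≥0 using hbα.ne_top
  refine hcb.trans_le ?_
  have hb0 : 0 < b := by exact_mod_cast (zero_le.trans_lt hcb)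
  refine le_iSup₂ (f := fun (a : ℝ≥0) (_ : 0 < a ∧ IsUniformlyAnalytic (v t j) a) => (a : ℝ≥0∞)) b
    ⟨hb0, Sobolev.isUniformlyAnalytic hr hr2 h2 ?_ ?_⟩
  · exact_mod_cast hb0
  · exact_mod_cast hbα

theorem le_liminf_modifiedRad {M : Matrix (Fin 3) (Fin 3) ℝ} {P : FiberedProjection} {T : ℝ}
    {u : ℝ → SobolevVec (1 / 2)} (hu : IsStrongSolution M P (1 / 2) T u) {t : ℝ}
    (ht : t ∈ Ioc 0 T) :
    modifiedRad t u ≤ liminf (fun v => modifiedRad t v) (dataLimit M P T (u 0)) := by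
  refine le_of_forall_lt fun c hc => ?_
  obtain ⟨b, hcb, hb⟩ := exists_between hc
  lift b to ℝ≥0 using hb.ne_top
  obtain ⟨δ, hδ, h⟩ := hu.exists_forall_le_modifiedRad ht hb
  refine hcb.trans_le (le_liminf_of_le ?_ ?_)
  · isBoundedDefault
  · rw [dataLimit, eventually_inf_principal]
    refine Filter.Eventually.mono (preimage_mem_comap (Metric.ball_mem_nhds (u 0) hδ)) ?_
    intro v hv hs
    exact h v hs (mem_ball_iff_norm.1 hv)

end

theorem mainTheorem9 (M : Matrix (Fin 3) (Fin 3) ℝ) (P : FiberedProjection) (T : ℝ)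
    (u : ℝ → SobolevVec (1 / 2)) (hu : IsStrongSolution M P (1 / 2) T u)
    (t : ℝ) (ht : t ∈ Ioc 0 T) :
    modifiedRad t u ≤ liminf (fun v => modifiedRad t v) (dataLimit M P T (u 0)) ∧
    (rad (u t) ≤ liminf (fun s => rad (u s)) (𝓝[<] t) →
      (∀ α : ℝ≥0, (α : ℝ≥0∞) < rad (u t) →
        ∃ a ∈ Ico 0 t, ⨆ s ∈ Ioc a t, expNorm α (u s).toL2Vec < ∞) →
      modifiedRad t u = rad (u t) ∧
      rad (u t) ≤ liminf (fun v => rad (v t)) (dataLimit M P T (u 0))) := by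
  have hle := le_liminf_modifiedRad hu ht
  refine ⟨hle, fun _ h => ?_⟩
  have heq : modifiedRad t u = rad (u t) := by
    refine le_antisymm (modifiedRad_le_rad (by norm_num) (by norm_num) u) ?_
    refine le_of_forall_lt fun c hc => ?_
    obtain ⟨b, hcb, hb⟩ := exists_between hc
    lift b to ℝ≥0 using hb.ne_top
    exact hcb.trans_le (le_iSup₂ (f := fun (α : ℝ≥0) (_ : ∃ a ∈ Ico 0 t,
      ⨆ s ∈ Ioc a t, expNorm α (u s).toL2Vec < ∞) => (α : ℝ≥0∞)) b (h b hb))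
  -- The two radii agree at `u`, and `rad(v(t))` dominates the modified radius at every `v`, so its
  -- lower limit is at least as large.
  refine ⟨heq, heq.symm.trans_le (hle.trans (liminf_le_liminf ?_))⟩
  exact .of_forall fun v => modifiedRad_le_rad (by norm_num) (by norm_num) v
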